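/- **Setting.** Fix $\alpha\in(0,1)$. For each $n$ let $\mathcal L_n$ be a law of $(X,Y,Z)\in\mathbb R\times\mathbb R\times\mathbb R^{p_n}$ for which the conditional means $\mu_{n,x}(Z)=\mathbb E_{\mathcal L_n}[X\mid Z]$, $\mu_{n,y}(Z)=\mathbb E_{\mathcal L_n}[Y\mid Z]$ and the conditional variances of $X$ and of $Y$ given $Z$ exist and are finite almost surely. Let $(X_i,Y_i,Z_i)_{i\le n}$ be $n$ i.i.d. observations, write $\mathbf X,\mathbf Y,\mathbf Z$ for the three samples, and write $\mathbb P_{\mathcal L_n}$ for the law $\mathcal L_n^{\otimes n}$ of the whole sample. From $(\mathbf X,\mathbf Z)$ one learns conditional laws $\widehat{\mathcal L}_n(X_i\mid Z_i)$, with means $\widehat\mu_{n,x}(Z_i)$ and variances $\mathrm{Var}_{\widehat{\mathcal L}_n}[X_i\mid Z_i]$; from $(\mathbf Y,\mathbf Z)$ one learns a function $\widehat\mu_{n,y}$. **Tests.** Let $R_i=(X_i-\widehat\mu_{n,x}(Z_i))(Y_i-\widehat\mu_{n,y}(Z_i))$ and $T_n=n^{-1/2}\sum_{i\le n}R_i$.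 Given the data, draw $\widetilde X_i\sim\widehat{\mathcal L}_n(X_i\mid Z_i)$ independently and let $\widetilde T_n=n^{-1/2}\sum_i(\widetilde X_i-\widehat\mu_{n,x}(Z_i))(Y_i-\widehat\mu_{n,y}(Z_i))$ (no refitting). The $\widehat{\mathrm{dCRT}}$ is $\phi_n^{\widehat{\mathrm{dCRT}}}=\mathbf 1\{T_n>\mathbb Q_{1-\alpha}[\widetilde T_n\mid\mathbf X,\mathbf Y,\mathbf Z]\}$, where $\mathbb Q_q$ is the (conditional) quantile $\inf\{t:\mathbb P[\,\cdot\le t]\ge q\}$. The GCM test is $\phi_n^{\mathrm{GCM}}=\mathbf 1\{T_n/\widehat S_n>z_{1-\alpha}\}$, where $\widehat S_n^2=\frac1n\sum_iR_i^2-\big(\frac1n\sum_iR_i\big)^2$ and $z_{1-\alpha}$ is the standard normal quantile. **Assumptions on $\mathcal L_n$.** The null holds: $\mathcal L_n(X,Y\mid Z)=\mathcal L_n(X\mid Z)\times\mathcal L_n(Y\mid Z)$. Moreover, with convergence in probability under $\mathbb P_{\mathcal L_n}$: 1. $E_{n,x}E_{n,y}=o_P(n^{-1/2})$, $E'_{n,x}=o_P(1)$,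 $E'_{n,y}=o_P(1)$, $\widehat E'_{n,y}=o_P(1)$, where $E_{n,x}^2=\frac1n\sum_i(\widehat\mu_{n,x}(Z_i)-\mu_{n,x}(Z_i))^2$, $E_{n,y}^2=\frac1n\sum_i(\widehat\mu_{n,y}(Z_i)-\mu_{n,y}(Z_i))^2$, and $(E'_{n,x})^2$, $(E'_{n,y})^2$, $(\widehat E'_{n,y})^2$ are obtained by weighting the $i$-th summand of $E_{n,x}^2$, $E_{n,y}^2$, $E_{n,y}^2$ by $\mathrm{Var}_{\mathcal L_n}[Y_i\mid Z_i]$, $\mathrm{Var}_{\mathcal L_n}[X_i\mid Z_i]$, $\mathrm{Var}_{\widehat{\mathcal L}_n}[X_i\mid Z_i]$ respectively. 2. For some $c_1,c_2,\delta>0$: $\inf_n\mathbb E_{\mathcal L_n}[(X-\mu_{n,x}(Z))^2(Y-\mu_{n,y}(Z))^2]>c_1$ and $\sup_n\mathbb E_{\mathcal L_n}[|(X-\mu_{n,x}(Z))(Y-\mu_{n,y}(Z))|^{2+\delta}]<c_2$. 3. For all $n\ge1$ and $i\le n$, almost surely, $0<\mathrm{Var}_{\widehat{\mathcal L}_n}[X_i\mid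 Z_i],\ (Y_i-\widehat\mu_{n,y}(Z_i))^2,\ (Y_i-\mu_{n,y}(Z_i))^2<\infty$. 4. $\frac1n\sum_i\big(\mathrm{Var}_{\widehat{\mathcal L}_n}[X_i\mid Z_i]-\mathrm{Var}_{\mathcal L_n}[X_i\mid Z_i]\big)\mathrm{Var}_{\mathcal L_n}[Y_i\mid Z_i]\to0$ in probability. 5. For some $\delta>0$ (not necessarily that of 2), $\frac1{n^{1+\delta/2}}\sum_i\mathbb E_{\mathcal L_n}\big[|Y_i-\mu_{n,y}(Z_i)|^{2+\delta}\mid Z_i\big]\,\mathbb E_{\widehat{\mathcal L}_n}\big[|\widetilde X_i-\widehat\mu_{n,x}(Z_i)|^{2+\delta}\mid\mathbf X,\mathbf Z\big]\to0$ in probability. **Corollary.** Let $\mathcal L_n'$ be laws on $\mathbb R\times\mathbb R\times\mathbb R^{p_n}$ that are contiguous to $\mathcal L_n$, in the sense that $\mathbb P_{\mathcal L_n}[A_n]\to0$ implies $\mathbb P_{\mathcal L_n'}[A_n]\to0$ for every sequence of events $A_n$ depending on the $n$ observations. Then $$\lim_{n\to\infty}\mathbb P_{\mathcal L_n'}\big[\phi_n^{\widehat{\mathrm{dCRT}}}=\phi_n^{\mathrm{GCM}}\big]=1,$$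 and therefore the two tests have the same asymptotic power: $$\lim_{n\to\infty}\Big(\mathbb E_{\mathcal L_n'}[\phi_n^{\widehat{\mathrm{dCRT}}}]-\mathbb E_{\mathcal L_n'}[\phi_n^{\mathrm{GCM}}]\Big)=0.$$ -/

import Mathlib

open MeasureTheory ProbabilityTheory Filter Topology
open scoped ENNReal

noncomputable section

namespace CITest

/-! ### Laws of one observation `(X, Y, Z)` -/

/-- One observation `(X, Y, Z)` with `X, Y ∈ ℝ` and `Z ∈ ℝ^p`. -/
abbrev Obs (p : ℕ) : Type := ℝ × ℝ × (Fin p → ℝ)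

/-- The predictor `X`. -/
def Obs.x {p : ℕ} (o : Obs p) : ℝ := o.1

/-- The response `Y`. -/
def Obs.y {p : ℕ} (o : Obs p) : ℝ := o.2.1

/-- The covariate vector `Z`. -/
def Obs.z {p : ℕ} (o : Obs p) : Fin p → ℝ := o.2.2

section Law

variable {p : ℕ} (L : Measure (Obs p)) [IsFiniteMeasure L]

/-- The marginal law of `Z`. -/
def lawZ : Measure (Fin p → ℝ) := L.map Obs.z

/-- The (regular) conditional law `L(X ∣ Z)`. -/
def lawXZ : Kernel (Fin p → ℝ) ℝ := condDistrib Obs.x Obs.z L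

/-- The (regular) conditional law `L(Y ∣ Z)`. -/
def lawYZ : Kernel (Fin p → ℝ) ℝ := condDistrib Obs.y Obs.z L

/-- The (regular) conditional law `L(X, Y ∣ Z)`. -/
def lawXYZ : Kernel (Fin p → ℝ) (ℝ × ℝ) :=
  condDistrib (fun o : Obs p => (o.x, o.y)) Obs.z L

/-- The conditional independence null: `L(X, Y ∣ Z) = L(X ∣ Z) × L(Y ∣ Z)`. -/
def IsNull : Prop :=
  ∀ᵐ z ∂lawZ L, lawXYZ L z = (lawXZ L z).prod (lawYZ L z)

/-- `X` and `Y` have finite conditional second moments given `Z` (almost surely), so that the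
conditional means and variances below are the genuine ones. -/
def HasCondVariances : Prop :=
  ∀ᵐ z ∂lawZ L, MemLp id 2 (lawXZ L z) ∧ MemLp id 2 (lawYZ L z)

/-- `μ_x(z) = E[X ∣ Z = z]`. -/
def muX (z : Fin p → ℝ) : ℝ := ∫ u, u ∂lawXZ L z

/-- `μ_y(z) = E[Y ∣ Z = z]`. -/
def muY (z : Fin p → ℝ) : ℝ := ∫ u, u ∂lawYZ L z

/-- `Var[X ∣ Z = z]`. -/
def varX (z : Fin p → ℝ) : ℝ := variance id (lawXZ L z)

/-- `Var[Y ∣ Z = z]`. -/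
def varY (z : Fin p → ℝ) : ℝ := variance id (lawYZ L z)

end Law

/-! ### Samples of size `n` -/

/-- `n` observations. -/
abbrev Sample (n p : ℕ) : Type := Fin n → Obs p

/-- The joint law of `n` i.i.d. observations drawn from `L`. -/
def sampleLaw {p : ℕ} (n : ℕ) (L : Measure (Obs p)) : Measure (Sample n p) :=
  Measure.pi fun _ => L

def Sample.xs {n p : ℕ} (d : Sample n p) : Fin n → ℝ := fun i => (d i).x

def Sample.ys {n p : ℕ} (d : Sample n p) : Fin n → ℝ := fun i => (d i).y

def Sample.zs {n p : ℕ} (d : Sample n p) : Fin n → Fin p → ℝ := fun i => (d i).z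

/-! ### Learned quantities -/

/-- A learning procedure for sample size `n`.  The conditional law of `X` given `Z` is learned from
the `X`s and `Z`s of the sample, the conditional mean of `Y` given `Z` from the `Y`s and `Z`s.

`lawHat i ((x, z), ζ)` is the learned conditional law of `X` given `Z = ζ` that is used for the
`i`-th observation.  Usually it is the same for all `i`; the index also admits estimates such as
`Var[X_i ∣ Z_i] = (X_i - μ̂_x(Z_i))²`, which refer to the observation itself and not only to its
covariate value.  `muHatY ((y, z), ζ)` is the learned conditional mean of `Y` given `Z = ζ`. -/
structure Learner (n p : ℕ) where
  lawHat : Fin n → Kernel (((Fin n → ℝ) × (Fin n → Fin p → ℝ)) × (Fin p → ℝ)) ℝ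
  isMarkovKernel_lawHat : ∀ i, IsMarkovKernel (lawHat i)
  muHatY : ((Fin n → ℝ) × (Fin n → Fin p → ℝ)) × (Fin p → ℝ) → ℝ
  measurable_muHatY : Measurable muHatY

section Statistics

variable {n p : ℕ} (A : Learner n p)

/-- The learned conditional law of `X_i` given `Z_i`. -/
def lawHatAt (d : Sample n p) (i : Fin n) : Measure ℝ :=
  A.lawHat i ((d.xs, d.zs), d.zs i)

/-- `μ̂_x(Z_i)`, the mean of the learned conditional law of `X_i` given `Z_i`. -/
def muHatXAt (d : Sample n p) (i : Fin n) : ℝ := ∫ u, u ∂lawHatAt A d i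

/-- The variance of the learned conditional law of `X_i` given `Z_i`. -/
def varHatXAt (d : Sample n p) (i : Fin n) : ℝ := variance id (lawHatAt A d i)

/-- `μ̂_y(Z_i)`. -/
def muHatYAt (d : Sample n p) (i : Fin n) : ℝ := A.muHatY ((d.ys, d.zs), d.zs i)

/-- The resampled statistic `n^{-1/2} ∑ (X̃_i - μ̂_x(Z_i)) (Y_i - μ̂_y(Z_i))`; the estimates are not
refitted to `X̃`. -/
def resampledStat (xt : Fin n → ℝ) (d : Sample n p) : ℝ :=
  1 / √(n : ℝ) * ∑ i, (xt i - muHatXAt A d i) * (d.ys i - muHatYAt A d i)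

/-- The test statistic `n^{-1/2} ∑ (X_i - μ̂_x(Z_i)) (Y_i - μ̂_y(Z_i))`. -/
def dcrtStat (d : Sample n p) : ℝ := resampledStat A d.xs d

/-- The law of the resampled statistic given the data: the `X̃_i` are drawn independently from the
learned conditional laws of `X_i` given `Z_i`. -/
def resamplingLaw (d : Sample n p) : Measure ℝ :=
  (Measure.pi (lawHatAt A d)).map fun xt => resampledStat A xt d

/-- The `q`-quantile `inf {t : ν(-∞, t] ≥ q}` of a law `ν` on the real line. -/
def quantile (ν : Measure ℝ) (q : ℝ) : ℝ := sInf {t : ℝ | q ≤ ν.real (Set.Iic t)}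

/-- The level `α` dCRT test with learned conditional law (infinitely many resamples). -/
def dcrtTest (α : ℝ) (d : Sample n p) : ℝ :=
  if quantile (resamplingLaw A d) (1 - α) < dcrtStat A d then 1 else 0

/-- The product of residuals `(X_i - μ̂_x(Z_i)) (Y_i - μ̂_y(Z_i))`. -/
def residProd (d : Sample n p) (i : Fin n) : ℝ :=
  (d.xs i - muHatXAt A d i) * (d.ys i - muHatYAt A d i)

/-- The empirical variance of the products of residuals. -/
def gcmVar (d : Sample n p) : ℝ :=
  1 / (n : ℝ) * ∑ i, residProd A d i ^ 2 - (1 / (n : ℝ) * ∑ i, residProd A d i) ^ 2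

/-- The GCM statistic. -/
def gcmStat (d : Sample n p) : ℝ :=
  1 / √(gcmVar A d) * (1 / √(n : ℝ) * ∑ i, residProd A d i)

/-- The level `α` GCM test. -/
def gcmTest (α : ℝ) (d : Sample n p) : ℝ :=
  if quantile (gaussianReal 0 1) (1 - α) < gcmStat A d then 1 else 0

/-! ### In-sample estimation errors -/

variable (L : Measure (Obs p)) [IsFiniteMeasure L]

/-- `E_x`. -/
def errX (d : Sample n p) : ℝ :=
  √(1 / (n : ℝ) * ∑ i, (muHatXAt A d i - muX L (d.zs i)) ^ 2)

/-- `E'_x`. -/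
def errX' (d : Sample n p) : ℝ :=
  √(1 / (n : ℝ) * ∑ i, (muHatXAt A d i - muX L (d.zs i)) ^ 2 * varY L (d.zs i))

/-- `E_y`. -/
def errY (d : Sample n p) : ℝ :=
  √(1 / (n : ℝ) * ∑ i, (muHatYAt A d i - muY L (d.zs i)) ^ 2)

/-- `E'_y`. -/
def errY' (d : Sample n p) : ℝ :=
  √(1 / (n : ℝ) * ∑ i, (muHatYAt A d i - muY L (d.zs i)) ^ 2 * varX L (d.zs i))

/-- `Ê'_y`, in which the learned variance of `X_i` given `Z_i` replaces the true one. -/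
def errHatY' (d : Sample n p) : ℝ :=
  √(1 / (n : ℝ) * ∑ i, (muHatYAt A d i - muY L (d.zs i)) ^ 2 * varHatXAt A d i)

/-- The left-hand side of the variance consistency property. -/
def varDiscrepancy (d : Sample n p) : ℝ :=
  1 / (n : ℝ) * ∑ i, (varHatXAt A d i - varX L (d.zs i)) * varY L (d.zs i)

/-- The Lyapunov ratio of order `2 + δ`. -/
def lyapunovSum (δ : ℝ) (d : Sample n p) : ℝ≥0∞ :=
  ENNReal.ofReal (1 / (n : ℝ) ^ (1 + δ / 2)) *
    ∑ i, (∫⁻ v, ‖v - muY L (d.zs i)‖ₑ ^ (2 + δ) ∂lawYZ L (d.zs i)) *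
      ∫⁻ u, ‖u - muHatXAt A d i‖ₑ ^ (2 + δ) ∂lawHatAt A d i

end Statistics

/-! ### Asymptotic notions and assumptions -/

/-- `W_n → 0` in probability, where `W_n` is defined on a probability space depending on `n`. -/
def TendstoZeroInProb {Ω : ℕ → Type} [∀ n, MeasurableSpace (Ω n)]
    (P : ∀ n, Measure (Ω n)) (W : ∀ n, Ω n → ℝ) : Prop :=
  ∀ ε : ℝ, 0 < ε → Tendsto (fun n => P n {ω | ε ≤ |W n ω|}) atTop (𝓝 0)

/-- The same for `[0, ∞]`-valued variables. -/
def TendstoZeroInProbENN {Ω : ℕ → Type} [∀ n, MeasurableSpace (Ω n)]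
    (P : ∀ n, Measure (Ω n)) (W : ∀ n, Ω n → ℝ≥0∞) : Prop :=
  ∀ ε : ℝ≥0∞, 0 < ε → Tendsto (fun n => P n {ω | ε ≤ W n ω}) atTop (𝓝 0)

/-- The sequence `Q_n` is contiguous to the sequence `P_n`. -/
def Contiguous {Ω : ℕ → Type} [∀ n, MeasurableSpace (Ω n)]
    (Q P : ∀ n, Measure (Ω n)) : Prop :=
  ∀ E : ∀ n, Set (Ω n), (∀ n, MeasurableSet (E n)) →
    Tendsto (fun n => P n (E n)) atTop (𝓝 0) → Tendsto (fun n => Q n (E n)) atTop (𝓝 0)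

section Assumptions

variable {p : ℕ → ℕ} (A : ∀ n, Learner n (p n))
  (L : ∀ n, Measure (Obs (p n))) [∀ n, IsProbabilityMeasure (L n)]

/-- `E_x E_y = o_P(n^{-1/2})`, and `E'_x`, `E'_y`, `Ê'_y` are `o_P(1)`. -/
def SmallErrors : Prop :=
  TendstoZeroInProb (fun n => sampleLaw n (L n))
      (fun n d => √(n : ℝ) * (errX (A n) (L n) d * errY (A n) (L n) d)) ∧
    TendstoZeroInProb (fun n => sampleLaw n (L n)) (fun n d => errX' (A n) (L n) d) ∧
    TendstoZeroInProb (fun n => sampleLaw n (L n)) (fun n d => errY' (A n) (L n) d) ∧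
    TendstoZeroInProb (fun n => sampleLaw n (L n)) (fun n d => errHatY' (A n) (L n) d)

/-- `inf_n E[(X - μ_x(Z))² (Y - μ_y(Z))²] > c₁` and
`sup_n E[|(X - μ_x(Z)) (Y - μ_y(Z))|^{2 + δ}] < c₂` for some constants `c₁, c₂, δ > 0`. -/
def BoundedMoments : Prop :=
  ∃ c₁ c₂ δ : ℝ, 0 < c₁ ∧ 0 < c₂ ∧ 0 < δ ∧ ∀ n : ℕ, 1 ≤ n →
    ENNReal.ofReal c₁ <
        ∫⁻ o, ‖(o.x - muX (L n) o.z) * (o.y - muY (L n) o.z)‖ₑ ^ (2 : ℝ) ∂L n ∧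
      ∫⁻ o, ‖(o.x - muX (L n) o.z) * (o.y - muY (L n) o.z)‖ₑ ^ (2 + δ) ∂L n <
        ENNReal.ofReal c₂

/-- Almost surely, the learned variances of `X_i` given `Z_i` lie in `(0, ∞)`, and
`(Y_i - μ̂_y(Z_i))²` and `(Y_i - μ_y(Z_i))²` are positive. -/
def Nondegenerate : Prop :=
  ∀ n : ℕ, 1 ≤ n → ∀ᵐ d ∂sampleLaw n (L n), ∀ i : Fin n,
    (0 < evariance id (lawHatAt (A n) d i) ∧ evariance id (lawHatAt (A n) d i) < ∞) ∧
      0 < (d.ys i - muHatYAt (A n) d i) ^ 2 ∧ 0 < (d.ys i - muY (L n) (d.zs i)) ^ 2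

/-- Consistency of the learned variances of `X_i` given `Z_i`. -/
def VarianceConsistent : Prop :=
  TendstoZeroInProb (fun n => sampleLaw n (L n)) (fun n d => varDiscrepancy (A n) (L n) d)

/-- The Lyapunov condition. -/
def LyapunovCondition : Prop :=
  ∃ δ : ℝ, 0 < δ ∧
    TendstoZeroInProbENN (fun n => sampleLaw n (L n)) (fun n d => lyapunovSum (A n) (L n) δ d)

end Assumptions

end CITest

end

namespace CITest

/-! ### Sums of independent variables -/

section Product

variable {ι : Type*} [Fintype ι] {Ω : ι → Type*} {mΩ : ∀ i, MeasurableSpace (Ω i)}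
  {μ : ∀ i, Measure (Ω i)} [∀ i, IsProbabilityMeasure (μ i)]

/-! Write `ε_i ξ_i` for the product of the true residuals, `σ_n²` for its second moment
(`noiseVar`), and `z` for the standard normal quantile. Both tests compare the same statistic `T_n`
with a critical value: the dCRT uses the quantile of the resampling law, the GCM test uses `Ŝ_n z`.
Under the null laws both critical values are `σ_n z + o_P(1)`, so the tests can disagree only if
`T_n` falls in a shrinking window around `σ_n z`. Since `T_n / σ_n` is asymptotically normal, such a
window has vanishing probability. Contiguity carries this over to `L'`. The sequence `σ_n` need not
converge; it is only bounded and bounded away from zero.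

Three facts carry the argument. First, `T_n = n^{-1/2} ∑ ε_i ξ_i + o_P(1)` (`tendsto_dcrtStat_sub`):
one cross term is small by Cauchy–Schwarz, the other two because, conditionally on the data used for
one regression, they are sums of independent centered variables. Second, `Ŝ_n² - σ_n²` tends to zero
(`tendsto_gcmVar_sub`). Third, the resampling distribution function at `σ_n u` tends in probability
to the normal one at `u` (`tendsto_resamplingLaw_cdf`). This needs the conditional variance of the
resampled statistic to be close to `σ_n²` (`tendsto_resampledVar_sub`) and its Lindeberg sum to be
small (`tendsto_resampled_lindeberg`).

Two devices replace conditional expectations and conditional weak convergence. Under the null,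
redrawing `Y` (or `X`) from its law given `Z` leaves the sample law unchanged, so Markov's
inequality can be applied after integrating over the redrawn coordinates only
(`TendstoZeroInProbENN.of_bind`). And the central limit theorem is proved with a tolerance uniform
over all finite families (`exists_lindeberg_bound_pi`), so it can be applied separately to each
realisation of the data. -/

theorem memLp_comp_eval_pi {q : ℝ≥0∞} {i : ι} {g : Ω i → ℝ} (hg : MemLp g q (μ i)) :
    MemLp (fun b : ∀ i, Ω i => g (b i)) q (Measure.pi μ) :=
  hg.comp_measurePreserving (measurePreserving_eval μ i)

/-- The second moment of a sum of independent centered variables. -/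
theorem integral_sq_sum_pi {g : ∀ i, Ω i → ℝ} (hg : ∀ i, MemLp (g i) 2 (μ i))
    (h0 : ∀ i, ∫ x, g i x ∂μ i = 0) :
    ∫ b, (∑ i, g i (b i)) ^ 2 ∂Measure.pi μ = ∑ i, ∫ x, g i x ^ 2 ∂μ i := by
  have hL : ∀ i, MemLp (fun b : ∀ i, Ω i => g i (b i)) 2 (Measure.pi μ) :=
    fun i => memLp_comp_eval_pi (hg i)
  have hmean : ∫ b, (∑ i, fun b : ∀ i, Ω i => g i (b i)) b ∂Measure.pi μ = 0 := by
    simp only [Finset.sum_apply]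
    rw [integral_finsetSum _ fun i _ => (hL i).integrable one_le_two]
    refine Finset.sum_eq_zero fun i _ => ?_
    rw [integral_comp_eval (hg i).aestronglyMeasurable, h0 i]
  have h := variance_sum_pi hg
  rw [variance_of_integral_eq_zero (memLp_finsetSum' _ fun i _ => hL i).aemeasurable hmean] at h
  simp only [Finset.sum_apply] at h
  rw [h]
  exact Finset.sum_congr rfl fun i _ =>
    variance_of_integral_eq_zero (hg i).aestronglyMeasurable.aemeasurable (h0 i)

theorem integral_abs_le_sqrt {Ω' : Type*} {_ : MeasurableSpace Ω'} {P : Measure Ω'}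
    [IsProbabilityMeasure P] {f : Ω' → ℝ} (hf : MemLp f 2 P) :
    ∫ x, |f x| ∂P ≤ √(∫ x, f x ^ 2 ∂P) := by
  refine Real.le_sqrt_of_sq_le ?_
  have h := variance_nonneg (fun x => |f x|) P
  have hf' : MemLp (fun x => |f x|) 2 P := hf.abs
  rw [variance_eq_sub hf'] at h
  simp only [Pi.pow_apply, sq_abs] at h
  linarith

/-- An `L¹` weak law of large numbers for nonnegative independent variables, by truncation. -/
theorem integral_abs_sum_sub_le {f : ∀ i, Ω i → ℝ} (hm : ∀ i, Measurable (f i))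
    (h0 : ∀ i x, 0 ≤ f i x) (hf : ∀ i, Integrable (f i) (μ i)) {κ : ℝ} (hκ : 0 < κ) :
    ∫ b, |∑ i, f i (b i) - ∑ i, ∫ x, f i x ∂μ i| ∂Measure.pi μ ≤
      2 * (∑ i, ∫ x in {x | κ < f i x}, f i x ∂μ i) + √(κ * ∑ i, ∫ x, f i x ∂μ i) := by
  have hS : ∀ i, MeasurableSet {x | κ < f i x} := fun i => measurableSet_lt measurable_const (hm i)
  -- The excess `r` above level `κ` is paid for in `L¹`, once for itself and once for its mean. The
  -- truncated part `h` is bounded by `κ`, so its variance is at most `κ ∫ f`.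
  let r : ∀ i, Ω i → ℝ := fun i => Set.indicator {x | κ < f i x} (f i)
  let h : ∀ i, Ω i → ℝ := fun i x => f i x - r i x
  have hr0 : ∀ i x, 0 ≤ r i x := fun i x => Set.indicator_nonneg (fun x _ => h0 i x) x
  have hrf : ∀ i x, r i x ≤ f i x := fun i x => Set.indicator_le_self' (fun x _ => h0 i x) x
  have hrm : ∀ i, Measurable (r i) := fun i => (hm i).indicator (hS i)
  have hhm : ∀ i, Measurable (h i) := fun i => (hm i).sub (hrm i)
  have hri : ∀ i, Integrable (r i) (μ i) := fun i => (hf i).indicator (hS i)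
  have hh0 : ∀ i x, 0 ≤ h i x := fun i x => sub_nonneg.2 (hrf i x)
  have hhκ : ∀ i x, h i x ≤ κ := by
    intro i x
    by_cases hx : κ < f i x
    · simp [h, r, hx, hκ.le]
    · have hr : r i x = 0 := Set.indicator_of_notMem (s := {x | κ < f i x}) hx _
      simpa [h, hr] using not_lt.1 hx
  have hhi : ∀ i, Integrable (h i) (μ i) := fun i => (hf i).sub (hri i)
  have hh2 : ∀ i, MemLp (h i) 2 (μ i) := fun i =>
    MemLp.of_bound (hhm i).aestronglyMeasurable κ
      (ae_of_all _ fun x => by rw [Real.norm_of_nonneg (hh0 i x)]; exact hhκ i x)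
  let c : ∀ i, Ω i → ℝ := fun i x => h i x - ∫ x, h i x ∂μ i
  have hc2 : ∀ i, MemLp (c i) 2 (μ i) := fun i => (hh2 i).sub (memLp_const _)
  have hc0 : ∀ i, ∫ x, c i x ∂μ i = 0 := fun i => by
    simp only [c]
    rw [integral_sub (hhi i) (integrable_const _)]
    simp
  have hcsq : ∀ i, ∫ x, c i x ^ 2 ∂μ i ≤ κ * ∫ x, f i x ∂μ i := by
    intro i
    have h1 : ∫ x, c i x ^ 2 ∂μ i = variance (h i) (μ i) :=
      (variance_eq_integral (hhm i).aemeasurable).symm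
    rw [h1, variance_eq_sub (hh2 i)]
    have h2 : ∫ x, (h i ^ 2) x ∂μ i ≤ ∫ x, κ * f i x ∂μ i := by
      refine integral_mono (hh2 i).integrable_sq ((hf i).const_mul κ) fun x => ?_
      simp only [Pi.pow_apply]
      have hhf : h i x ≤ f i x := sub_le_self _ (hr0 i x)
      nlinarith [hh0 i x, hhκ i x, hr0 i x]
    rw [integral_const_mul] at h2
    nlinarith [sq_nonneg (∫ x, h i x ∂μ i)]
  have hC2 : MemLp (fun b : ∀ i, Ω i => ∑ i, c i (b i)) 2 (Measure.pi μ) :=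
    memLp_finsetSum _ fun i _ => memLp_comp_eval_pi (hc2 i)
  have hRi : Integrable (fun b : ∀ i, Ω i => ∑ i, r i (b i)) (Measure.pi μ) :=
    integrable_finsetSum _ fun i _ => integrable_comp_eval (hri i)
  have hRint : ∫ b, ∑ i, r i (b i) ∂Measure.pi μ = ∑ i, ∫ x, r i x ∂μ i := by
    rw [integral_finsetSum _ fun i _ => integrable_comp_eval (hri i)]
    exact Finset.sum_congr rfl fun i _ => integral_comp_eval (hri i).aestronglyMeasurable
  have hReq : ∑ i, ∫ x, r i x ∂μ i = ∑ i, ∫ x in {x | κ < f i x}, f i x ∂μ i :=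
    Finset.sum_congr rfl fun i _ => integral_indicator (hS i)
  have hpt : ∀ b : ∀ i, Ω i, |∑ i, f i (b i) - ∑ i, ∫ x, f i x ∂μ i| ≤
      |∑ i, c i (b i)| + (∑ i, r i (b i) + ∑ i, ∫ x, r i x ∂μ i) := by
    intro b
    have e : ∑ i, f i (b i) - ∑ i, ∫ x, f i x ∂μ i =
        ∑ i, c i (b i) + (∑ i, r i (b i) - ∑ i, ∫ x, r i x ∂μ i) := by
      rw [← Finset.sum_sub_distrib, ← Finset.sum_sub_distrib, ← Finset.sum_add_distrib]
      refine Finset.sum_congr rfl fun i _ => ?_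
      have : ∫ x, h i x ∂μ i = ∫ x, f i x ∂μ i - ∫ x, r i x ∂μ i := integral_sub (hf i) (hri i)
      simp only [c, this, h]
      ring
    rw [e]
    refine (abs_add_le _ _).trans (add_le_add le_rfl ((abs_sub _ _).trans ?_))
    rw [abs_of_nonneg (Finset.sum_nonneg fun i _ => hr0 i _),
      abs_of_nonneg (Finset.sum_nonneg fun i _ => integral_nonneg (hr0 i))]
  have hfi : Integrable (fun b : ∀ i, Ω i => ∑ i, f i (b i)) (Measure.pi μ) :=
    integrable_finsetSum _ fun i _ => integrable_comp_eval (hf i)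
  calc ∫ b, |∑ i, f i (b i) - ∑ i, ∫ x, f i x ∂μ i| ∂Measure.pi μ
      ≤ ∫ b, (|∑ i, c i (b i)| + (∑ i, r i (b i) + ∑ i, ∫ x, r i x ∂μ i)) ∂Measure.pi μ :=
        integral_mono (hfi.sub (integrable_const _)).abs
          ((hC2.integrable one_le_two).abs.add (hRi.add (integrable_const _))) hpt
    _ = ∫ b, |∑ i, c i (b i)| ∂Measure.pi μ + 2 * ∑ i, ∫ x, r i x ∂μ i := by
        have h1 := integral_add (hC2.integrable one_le_two).abs
          (hRi.add (integrable_const (∑ i, ∫ x, r i x ∂μ i)))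
        have h2 := integral_add hRi (integrable_const (∑ i, ∫ x, r i x ∂μ i))
        simp only [Pi.add_apply] at h1
        rw [h1, h2, hRint]
        simp
        ring
    _ ≤ √(κ * ∑ i, ∫ x, f i x ∂μ i) + 2 * ∑ i, ∫ x, r i x ∂μ i := by
        gcongr
        refine (integral_abs_le_sqrt hC2).trans (Real.sqrt_le_sqrt ?_)
        rw [integral_sq_sum_pi hc2 hc0, Finset.mul_sum]
        exact Finset.sum_le_sum fun i _ => hcsq i
    _ = _ := by rw [hReq, add_comm]

end Product

/-! ### A Lindeberg central limit theorem -/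

/-- Where `|x| ≤ κ` the remainder is cubic and one factor `|x|` is traded for `κ`. Elsewhere a
quadratic bound suffices, since the Lindeberg condition makes that contribution small. -/
theorem norm_cexp_taylor_two_le {t κ x : ℝ} (hκ : 0 ≤ κ) (hκt : |t| * κ ≤ 1) :
    ‖Complex.exp (t * x * Complex.I) - (1 + t * x * Complex.I - ((t ^ 2 * x ^ 2 / 2 : ℝ) : ℂ))‖ ≤
      |t| ^ 3 * κ * x ^ 2 + 4 * t ^ 2 * Set.indicator {x : ℝ | κ < |x|} (fun x => x ^ 2) x := by
  set y : ℂ := t * x * Complex.I with hy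
  have hyn : ‖y‖ = |t| * |x| := by simp [hy]
  have hsum : ∑ m ∈ Finset.range 3, y ^ m / (m.factorial : ℂ) =
      1 + y - ((t ^ 2 * x ^ 2 / 2 : ℝ) : ℂ) := by
    simp only [Finset.sum_range_succ, Finset.sum_range_zero, Nat.factorial, hy]
    push_cast
    have := Complex.I_sq
    linear_combination (t ^ 2 * x ^ 2 / 2 : ℂ) * this
  rw [← hsum]
  have hsmall : ‖y‖ ≤ 1 →
      ‖Complex.exp y - ∑ m ∈ Finset.range 3, y ^ m / (m.factorial : ℂ)‖ ≤ ‖y‖ ^ 3 := by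
    intro h
    refine (Complex.exp_bound h (by norm_num)).trans ?_
    have : (((Nat.succ 3 : ℕ) : ℝ) * ((Nat.factorial 3 : ℕ) * (3 : ℕ) : ℝ)⁻¹) ≤ 1 := by
      norm_num [Nat.factorial]
    exact mul_le_of_le_one_right (by positivity) this
  have hyx : ‖y‖ ^ 2 = t ^ 2 * x ^ 2 := by rw [hyn, mul_pow, sq_abs, sq_abs]
  by_cases hx : κ < |x|
  · rw [Set.indicator_of_mem (show x ∈ {x : ℝ | κ < |x|} from hx)]
    have hmain : ‖Complex.exp y - ∑ m ∈ Finset.range 3, y ^ m / (m.factorial : ℂ)‖ ≤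
        4 * ‖y‖ ^ 2 := by
      rcases le_or_gt ‖y‖ 1 with h | h
      · refine (hsmall h).trans ?_
        nlinarith [norm_nonneg y, sq_nonneg ‖y‖]
      -- For `‖y‖ > 1` no cancellation is needed: the terms add up to at most `2 + ‖y‖ + ‖y‖² / 2 ≤
      -- 4 ‖y‖²`.
      · rw [hsum]
        have he : ‖Complex.exp y‖ = 1 := by
          rw [hy, ← Complex.ofReal_mul, Complex.norm_exp_ofReal_mul_I]
        have h2 : ‖((t ^ 2 * x ^ 2 / 2 : ℝ) : ℂ)‖ = ‖y‖ ^ 2 / 2 := by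
          rw [hyx, Complex.norm_real, Real.norm_of_nonneg (by positivity)]
        have := norm_sub_le (Complex.exp y) (1 + y - ((t ^ 2 * x ^ 2 / 2 : ℝ) : ℂ))
        have h3 := norm_sub_le (1 + y) ((t ^ 2 * x ^ 2 / 2 : ℝ) : ℂ)
        have h4 := norm_add_le 1 y
        rw [norm_one] at h4
        nlinarith
    rw [hyx] at hmain
    have : 0 ≤ |t| ^ 3 * κ * x ^ 2 := by positivity
    linarith
  · rw [Set.indicator_of_notMem (show x ∉ {x : ℝ | κ < |x|} from hx)]
    have hx' : |x| ≤ κ := not_lt.1 hx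
    have h1 : ‖y‖ ≤ 1 := by
      rw [hyn]; exact (mul_le_mul_of_nonneg_left hx' (abs_nonneg t)).trans hκt
    refine (hsmall h1).trans ?_
    rw [hyn, mul_pow]
    have : |x| ^ 3 ≤ κ * x ^ 2 := by
      rw [← sq_abs x]; nlinarith [sq_nonneg |x|]
    have := mul_le_mul_of_nonneg_left this (pow_nonneg (abs_nonneg t) 3)
    linarith

theorem norm_prod_sub_prod_le_sum {ι : Type*} (s : Finset ι) (a b : ι → ℂ)
    (ha : ∀ i ∈ s, ‖a i‖ ≤ 1) (hb : ∀ i ∈ s, ‖b i‖ ≤ 1) :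
    ‖∏ i ∈ s, a i - ∏ i ∈ s, b i‖ ≤ ∑ i ∈ s, ‖a i - b i‖ := by
  classical
  induction s using Finset.induction_on with
  | empty => simp
  | insert j s hj ih =>
    rw [Finset.prod_insert hj, Finset.prod_insert hj, Finset.sum_insert hj]
    have e : a j * ∏ i ∈ s, a i - b j * ∏ i ∈ s, b i =
        (a j - b j) * ∏ i ∈ s, a i + b j * (∏ i ∈ s, a i - ∏ i ∈ s, b i) := by ring
    rw [e]
    refine (norm_add_le _ _).trans (add_le_add ?_ ?_)
    · rw [norm_mul, norm_prod]
      exact mul_le_of_le_one_right (norm_nonneg _)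
        (Finset.prod_le_one (fun i _ => norm_nonneg _)
          fun i hi => ha i (Finset.mem_insert_of_mem hi))
    · rw [norm_mul]
      refine (mul_le_of_le_one_left (norm_nonneg _) (hb j (Finset.mem_insert_self _ _))).trans ?_
      exact ih (fun i hi => ha i (Finset.mem_insert_of_mem hi))
        fun i hi => hb i (Finset.mem_insert_of_mem hi)

section CharFun

variable {ν : Measure ℝ} [IsProbabilityMeasure ν]

theorem norm_charFun_taylor_two_le (h2 : MemLp id 2 ν) (h0 : ∫ x, x ∂ν = 0) {t κ : ℝ}
    (hκ : 0 ≤ κ) (hκt : |t| * κ ≤ 1) :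
    ‖charFun ν t - ((1 - t ^ 2 / 2 * ∫ x, x ^ 2 ∂ν : ℝ) : ℂ)‖ ≤
      |t| ^ 3 * κ * (∫ x, x ^ 2 ∂ν) + 4 * t ^ 2 * ∫ x in {x : ℝ | κ < |x|}, x ^ 2 ∂ν := by
  have hsq : Integrable (fun x : ℝ => x ^ 2) ν := h2.integrable_sq
  have hid : Integrable (fun x : ℝ => x) ν := h2.integrable one_le_two
  have hS : MeasurableSet {x : ℝ | κ < |x|} := measurableSet_lt measurable_const measurable_abs
  have he : Integrable (fun x : ℝ => Complex.exp (t * x * Complex.I)) ν := by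
    refine (integrable_const (1 : ℝ)).mono' (by fun_prop) (ae_of_all _ fun x => ?_)
    rw [← Complex.ofReal_mul, Complex.norm_exp_ofReal_mul_I]
  have hq : Integrable (fun x : ℝ =>
      (1 + t * x * Complex.I - ((t ^ 2 * x ^ 2 / 2 : ℝ) : ℂ))) ν := by
    refine ((integrable_const _).add ((hid.ofReal.const_mul (t : ℂ)).mul_const _)).sub ?_
    exact ((hsq.const_mul (t ^ 2)).div_const 2).ofReal
  have hqi : ∫ x : ℝ, (1 + t * x * Complex.I - ((t ^ 2 * x ^ 2 / 2 : ℝ) : ℂ)) ∂ν =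
      ((1 - t ^ 2 / 2 * ∫ x, x ^ 2 ∂ν : ℝ) : ℂ) := by
    have i1 : Integrable (fun x : ℝ => (t * x * Complex.I : ℂ)) ν :=
      (hid.ofReal.const_mul (t : ℂ)).mul_const _
    have i2 : Integrable (fun x : ℝ => ((t ^ 2 * x ^ 2 / 2 : ℝ) : ℂ)) ν :=
      ((hsq.const_mul (t ^ 2)).div_const 2).ofReal
    have e1 : ∫ x : ℝ, (1 + t * x * Complex.I : ℂ) ∂ν = 1 := by
      rw [integral_add (integrable_const _) i1, integral_mul_const, integral_const_mul,
        integral_complex_ofReal, h0]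
      simp
    have e2 := integral_sub ((integrable_const (1 : ℂ)).add i1) i2
    simp only [Pi.add_apply] at e2
    rw [e2, e1, integral_complex_ofReal, integral_div, integral_const_mul]
    push_cast
    ring
  rw [charFun_apply_real, ← hqi, ← integral_sub he hq]
  refine (norm_integral_le_of_norm_le
    (((hsq.const_mul (|t| ^ 3 * κ))).add ((hsq.indicator hS).const_mul (4 * t ^ 2)))
    (ae_of_all _ fun x => norm_cexp_taylor_two_le hκ hκt)).trans ?_
  have h1 := integral_add ((hsq.const_mul (|t| ^ 3 * κ)))
    ((hsq.indicator hS).const_mul (4 * t ^ 2))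
  simp only [Pi.add_apply] at h1 ⊢
  rw [h1, integral_const_mul, integral_const_mul, integral_indicator hS]

/-- Splitting at `κ` shows that the Lindeberg condition makes each single variance small. This
allows `1 - t² σ / 2` to be replaced by an exponential, factor by factor. -/
theorem integral_sq_le_of_lindeberg (h2 : MemLp id 2 ν) {κ : ℝ} :
    ∫ x, x ^ 2 ∂ν ≤ κ ^ 2 + ∫ x in {x : ℝ | κ < |x|}, x ^ 2 ∂ν := by
  have hsq : Integrable (fun x : ℝ => x ^ 2) ν := h2.integrable_sq
  have hS : MeasurableSet {x : ℝ | κ < |x|} := measurableSet_lt measurable_const measurable_abs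
  have h := integral_mono hsq ((integrable_const (κ ^ 2)).add (hsq.indicator hS)) fun x => by
    simp only [Pi.add_apply]
    by_cases hx : κ < |x|
    · rw [Set.indicator_of_mem (show x ∈ {x : ℝ | κ < |x|} from hx)]
      nlinarith [sq_nonneg κ]
    · rw [Set.indicator_of_notMem (show x ∉ {x : ℝ | κ < |x|} from hx), add_zero, ← sq_abs x]
      exact pow_le_pow_left₀ (abs_nonneg x) (not_lt.1 hx) 2
  have h1 := integral_add (integrable_const (μ := ν) (κ ^ 2)) (hsq.indicator hS)
  simp only [Pi.add_apply] at h1 h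
  rw [h1, integral_indicator hS] at h
  simpa using h

end CharFun

/-- The exponential factors over the summands, so the two products are compared factor by factor,
each time passing through `1 - t² σ_i / 2`. The three terms of the bound come from the small values
of `x`, the Lindeberg sum and the remainder of the exponential; the total variance is at most `2`.
-/
theorem norm_prod_charFun_sub_le {ι : Type*} [Fintype ι] {ν : ι → Measure ℝ}
    [∀ i, IsProbabilityMeasure (ν i)] (h2 : ∀ i, MemLp id 2 (ν i)) (h0 : ∀ i, ∫ x, x ∂ν i = 0)
    {t κ : ℝ} (hκ : 0 ≤ κ) (hκ1 : κ ≤ 1) (hκt : |t| * κ ≤ 1) (hκt2 : t ^ 2 * κ ≤ 1)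
    (hS : |∑ i, ∫ x, x ^ 2 ∂ν i - 1| ≤ κ)
    (hL : ∑ i, ∫ x in {x : ℝ | κ < |x|}, x ^ 2 ∂ν i ≤ κ) :
    ‖∏ i, charFun (ν i) t - ((Real.exp (-(t ^ 2 / 2) * ∑ i, ∫ x, x ^ 2 ∂ν i) : ℝ) : ℂ)‖ ≤
      κ * (2 * |t| ^ 3 + 4 * t ^ 2 + t ^ 4) := by
  set σ : ι → ℝ := fun i => ∫ x, x ^ 2 ∂ν i with hσ
  set l : ι → ℝ := fun i => ∫ x in {x : ℝ | κ < |x|}, x ^ 2 ∂ν i with hl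
  have hσ0 : ∀ i, 0 ≤ σ i := fun i => integral_nonneg fun x => sq_nonneg x
  have hl0 : ∀ i, 0 ≤ l i := fun i => integral_nonneg fun x => sq_nonneg x
  have hlκ : ∀ i, l i ≤ κ := fun i =>
    (Finset.single_le_sum (fun i _ => hl0 i) (Finset.mem_univ i)).trans hL
  have hσκ : ∀ i, σ i ≤ 2 * κ := fun i => by
    have := integral_sq_le_of_lindeberg (h2 i) (κ := κ)
    have h3 : σ i ≤ κ ^ 2 + l i := this
    nlinarith [hlκ i]
  have hS2 : ∑ i, σ i ≤ 2 := by have := (abs_le.1 hS).2; linarith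
  have hexp : ((Real.exp (-(t ^ 2 / 2) * ∑ i, σ i) : ℝ) : ℂ) =
      ∏ i, ((Real.exp (-(t ^ 2 / 2) * σ i) : ℝ) : ℂ) := by
    rw [Finset.mul_sum, Real.exp_sum, Complex.ofReal_prod]
  rw [hexp]
  refine (norm_prod_sub_prod_le_sum _ _ _ (fun i _ => norm_charFun_le_one t) fun i _ => ?_).trans ?_
  · rw [Complex.norm_real, Real.norm_of_nonneg (Real.exp_nonneg _), Real.exp_le_one_iff]
    have := hσ0 i
    have : 0 ≤ t ^ 2 / 2 * σ i := by positivity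
    linarith
  have hterm : ∀ i, ‖charFun (ν i) t - ((Real.exp (-(t ^ 2 / 2) * σ i) : ℝ) : ℂ)‖ ≤
      |t| ^ 3 * κ * σ i + 4 * t ^ 2 * l i + κ * t ^ 4 / 2 * σ i := by
    intro i
    have h1 : ‖charFun (ν i) t - ((1 - t ^ 2 / 2 * σ i : ℝ) : ℂ)‖ ≤
        |t| ^ 3 * κ * σ i + 4 * t ^ 2 * l i := norm_charFun_taylor_two_le (h2 i) (h0 i) hκ hκt
    have hu0 : 0 ≤ t ^ 2 / 2 * σ i := mul_nonneg (by positivity) (hσ0 i)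
    have hu1 : t ^ 2 / 2 * σ i ≤ κ * t ^ 2 := by nlinarith [hσκ i, sq_nonneg t]
    have h3 : ‖((1 - t ^ 2 / 2 * σ i : ℝ) : ℂ) - ((Real.exp (-(t ^ 2 / 2) * σ i) : ℝ) : ℂ)‖ ≤
        κ * t ^ 4 / 2 * σ i := by
      rw [← Complex.ofReal_sub, Complex.norm_real]
      have hx : ‖-(t ^ 2 / 2) * σ i‖ = t ^ 2 / 2 * σ i := by
        rw [neg_mul, norm_neg, Real.norm_of_nonneg hu0]
      have h4 := Real.norm_exp_sub_one_sub_id_le (x := -(t ^ 2 / 2) * σ i) (by rw [hx]; linarith)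
      rw [hx] at h4
      rw [norm_sub_rev]
      have e : Real.exp (-(t ^ 2 / 2) * σ i) - (1 - t ^ 2 / 2 * σ i) =
          Real.exp (-(t ^ 2 / 2) * σ i) - 1 - -(t ^ 2 / 2) * σ i := by ring
      rw [e]
      refine h4.trans ?_
      have := mul_le_mul_of_nonneg_right hu1 hu0
      nlinarith
    refine (norm_sub_le_norm_sub_add_norm_sub _ ((1 - t ^ 2 / 2 * σ i : ℝ) : ℂ) _).trans ?_
    linarith
  refine (Finset.sum_le_sum fun i _ => hterm i).trans ?_
  rw [Finset.sum_add_distrib, Finset.sum_add_distrib, ← Finset.mul_sum, ← Finset.mul_sum,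
    ← Finset.mul_sum]
  have a1 : |t| ^ 3 * κ * ∑ i, σ i ≤ |t| ^ 3 * κ * 2 :=
    mul_le_mul_of_nonneg_left hS2 (by positivity)
  have a2 : 4 * t ^ 2 * ∑ i, l i ≤ 4 * t ^ 2 * κ := mul_le_mul_of_nonneg_left hL (by positivity)
  have a3 : κ * t ^ 4 / 2 * ∑ i, σ i ≤ κ * t ^ 4 / 2 * 2 :=
    mul_le_mul_of_nonneg_left hS2 (by positivity)
  linarith

/-- **Lindeberg's central limit theorem** along a sequence of finite families. -/
theorem tendsto_map_sum_of_lindeberg {N : ℕ → ℕ} (ν : ∀ k, Fin (N k) → Measure ℝ)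
    [∀ k i, IsProbabilityMeasure (ν k i)] (h2 : ∀ k i, MemLp id 2 (ν k i))
    (h0 : ∀ k i, ∫ x, x ∂ν k i = 0) {κ : ℕ → ℝ} (hκ0 : ∀ k, 0 ≤ κ k)
    (hκ : Tendsto κ atTop (𝓝 0)) (hS : ∀ k, |∑ i, ∫ x, x ^ 2 ∂ν k i - 1| ≤ κ k)
    (hL : ∀ k, ∑ i, ∫ x in {x : ℝ | κ k < |x|}, x ^ 2 ∂ν k i ≤ κ k) (u : ℝ) :
    Tendsto (fun k => ((Measure.pi (ν k)).map fun b => ∑ i, b i).real (Set.Iic u)) atTop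
      (𝓝 ((gaussianReal 0 1).real (Set.Iic u))) := by
  have hm : ∀ k, IsProbabilityMeasure ((Measure.pi (ν k)).map fun b => ∑ i, b i) := fun k =>
    Measure.isProbabilityMeasure_map (by fun_prop)
  let M : ℕ → ProbabilityMeasure ℝ := fun k => ⟨(Measure.pi (ν k)).map fun b => ∑ i, b i, hm k⟩
  let G : ProbabilityMeasure ℝ := ⟨gaussianReal 0 1, inferInstance⟩
  have hSlim : Tendsto (fun k => ∑ i, ∫ x, x ^ 2 ∂ν k i) atTop (𝓝 1) := by
    rw [tendsto_iff_norm_sub_tendsto_zero]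
    exact squeeze_zero (fun _ => norm_nonneg _) hS hκ
  have hconv : Tendsto M atTop (𝓝 G) := by
    refine ProbabilityMeasure.tendsto_of_tendsto_charFun fun t => ?_
    have e : ∀ k, charFun (M k : Measure ℝ) t = ∏ i, charFun (ν k i) t := fun k => by
      have := congrFun (charFun_map_sum_pi_eq_prod (ν k)) t
      rw [Finset.prod_apply] at this
      exact this
    simp_rw [e]
    have hg : charFun (G : Measure ℝ) t = ((Real.exp (-(t ^ 2 / 2) * 1) : ℝ) : ℂ) := by
      change charFun (gaussianReal 0 1) t = _
      rw [charFun_gaussianReal]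
      push_cast
      congr 1
      simp
    have hlim : Tendsto (fun k => ((Real.exp (-(t ^ 2 / 2) * ∑ i, ∫ x, x ^ 2 ∂ν k i) : ℝ) : ℂ))
        atTop (𝓝 (charFun (G : Measure ℝ) t)) := by
      rw [hg]
      exact (Complex.continuous_ofReal.tendsto _).comp
        ((Real.continuous_exp.tendsto _).comp (hSlim.const_mul _))
    have hdiff : Tendsto (fun k => ∏ i, charFun (ν k i) t -
        ((Real.exp (-(t ^ 2 / 2) * ∑ i, ∫ x, x ^ 2 ∂ν k i) : ℝ) : ℂ)) atTop (𝓝 0) := by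
      rw [tendsto_zero_iff_norm_tendsto_zero]
      have hb : Tendsto (fun k => κ k * (2 * |t| ^ 3 + 4 * t ^ 2 + t ^ 4)) atTop (𝓝 0) := by
        simpa using hκ.mul_const (2 * |t| ^ 3 + 4 * t ^ 2 + t ^ 4)
      refine squeeze_zero' (Eventually.of_forall fun _ => norm_nonneg _) ?_ hb
      have c1 : ∀ᶠ k in atTop, κ k ≤ 1 := hκ.eventually_le_const one_pos
      have c2 : ∀ᶠ k in atTop, |t| * κ k ≤ 1 := by
        have := hκ.const_mul |t|
        rw [mul_zero] at this
        exact this.eventually_le_const one_pos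
      have c3 : ∀ᶠ k in atTop, t ^ 2 * κ k ≤ 1 := by
        have := hκ.const_mul (t ^ 2)
        rw [mul_zero] at this
        exact this.eventually_le_const one_pos
      filter_upwards [c1, c2, c3] with k h1 h3 h4
      exact norm_prod_charFun_sub_le (h2 k) (h0 k) (hκ0 k) h1 h3 h4 (hS k) (hL k)
    simpa using hdiff.add hlim
  have hfr : (G : Measure ℝ) (frontier (Set.Iic u)) = 0 := by
    rw [frontier_Iic]
    have := nullSingletonClass_gaussianReal (μ := 0) (v := 1) one_ne_zero
    exact measure_singleton (μ := gaussianReal 0 1) u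
  have := ProbabilityMeasure.tendsto_measure_of_null_frontier_of_tendsto' hconv hfr
  exact (ENNReal.tendsto_toReal (measure_ne_top _ _)).comp this

/-- **Lindeberg's central limit theorem**, uniformly over all finite families. -/
theorem exists_lindeberg_bound (u : ℝ) {η : ℝ} (hη : 0 < η) :
    ∃ κ : ℝ, 0 < κ ∧ ∀ (n : ℕ) (ν : Fin n → Measure ℝ) [∀ i, IsProbabilityMeasure (ν i)],
      (∀ i, MemLp id 2 (ν i)) → (∀ i, ∫ x, x ∂ν i = 0) → |∑ i, ∫ x, x ^ 2 ∂ν i - 1| ≤ κ →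
      ∑ i, ∫ x in {x : ℝ | κ < |x|}, x ^ 2 ∂ν i ≤ κ →
      |((Measure.pi ν).map fun b => ∑ i, b i).real (Set.Iic u) -
        (gaussianReal 0 1).real (Set.Iic u)| < η := by
  -- Counterexamples to the tolerances `1 / (k + 1)` would form a triangular array that contradicts
  -- the sequential theorem.
  by_contra! H
  choose N ν hν h2 h0 hS hL hfar using fun k : ℕ => H (1 / ((k : ℝ) + 1)) Nat.one_div_pos_of_nat
  have hlim := tendsto_map_sum_of_lindeberg ν h2 h0 (fun k => Nat.one_div_pos_of_nat.le)
    tendsto_one_div_add_atTop_nhds_zero_nat hS hL u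
  rw [tendsto_iff_norm_sub_tendsto_zero] at hlim
  obtain ⟨k, hk⟩ := (hlim.eventually_lt_const hη).exists
  exact absurd (hfar k) (not_le.2 hk)

/-- Lindeberg's central limit theorem for sums of functions of independent variables, uniformly
over all finite families and with an arbitrary scale `s`. -/
theorem exists_lindeberg_bound_pi (u : ℝ) {η : ℝ} (hη : 0 < η) :
    ∃ κ : ℝ, 0 < κ ∧ ∀ (n : ℕ) (Ω : Type) [MeasurableSpace Ω] (μ : Fin n → Measure Ω)
      [∀ i, IsProbabilityMeasure (μ i)] (g : Fin n → Ω → ℝ) (s : ℝ), 0 < s →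
      (∀ i, Measurable (g i)) → (∀ i, MemLp (g i) 2 (μ i)) → (∀ i, ∫ x, g i x ∂μ i = 0) →
      |∑ i, ∫ x, g i x ^ 2 ∂μ i - s ^ 2| ≤ κ * s ^ 2 →
      ∑ i, ∫ x in {x | κ * s < |g i x|}, g i x ^ 2 ∂μ i ≤ κ * s ^ 2 →
      |(Measure.pi μ).real {b | ∑ i, g i (b i) ≤ s * u} -
        (gaussianReal 0 1).real (Set.Iic u)| < η := by
  obtain ⟨κ, hκ, H⟩ := exists_lindeberg_bound u hη
  refine ⟨κ, hκ, fun n Ω _ μ _ g s hs hm h2 h0 hS hL => ?_⟩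
  let f : Fin n → Ω → ℝ := fun i x => g i x / s
  have hf : ∀ i, Measurable (f i) := fun i => (hm i).div_const s
  have hp : ∀ i, IsProbabilityMeasure ((μ i).map (f i)) := fun i =>
    Measure.isProbabilityMeasure_map (hf i).aemeasurable
  have hsq : ∀ i x, f i x ^ 2 = g i x ^ 2 / s ^ 2 := fun i x => div_pow _ _ _
  have e2 : ∀ i, ∫ x, x ^ 2 ∂(μ i).map (f i) = (∫ x, g i x ^ 2 ∂μ i) / s ^ 2 := fun i => by
    rw [integral_map (hf i).aemeasurable (by fun_prop)]
    simp_rw [hsq]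
    exact integral_div _ _
  have eL : ∀ i, ∫ x in {x : ℝ | κ < |x|}, x ^ 2 ∂(μ i).map (f i) =
      (∫ x in {x | κ * s < |g i x|}, g i x ^ 2 ∂μ i) / s ^ 2 := fun i => by
    rw [setIntegral_map (measurableSet_lt measurable_const measurable_abs) (by fun_prop)
      (hf i).aemeasurable]
    have hset : f i ⁻¹' {x : ℝ | κ < |x|} = {x | κ * s < |g i x|} := by
      ext x
      simp only [Set.mem_preimage, Set.mem_ofPred_eq, f, abs_div, abs_of_pos hs]
      exact lt_div_iff₀ hs
    simp_rw [hset, hsq]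
    exact integral_div _ _
  have hs2 : 0 < s ^ 2 := by positivity
  have key := H n (fun i => (μ i).map (f i)) (fun i => ?_) (fun i => ?_) ?_ ?_
  · rw [← Measure.pi_map_pi (fun i => (hf i).aemeasurable),
      Measure.map_map (by fun_prop) (by fun_prop), map_measureReal_apply (by fun_prop)
      measurableSet_Iic] at key
    convert key using 4
    ext b
    simp only [Set.mem_ofPred_eq, Set.mem_preimage, Function.comp, Set.mem_Iic, f]
    rw [← Finset.sum_div, div_le_iff₀ hs, mul_comm]
  · rw [memLp_map_measure_iff aestronglyMeasurable_id (hf i).aemeasurable]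
    simpa [f, div_eq_mul_inv] using (h2 i).mul_const s⁻¹
  · rw [integral_map (hf i).aemeasurable (by fun_prop)]
    simp only [f]
    rw [integral_div, h0 i, zero_div]
  · simp_rw [e2]
    rw [← Finset.sum_div, div_sub_one hs2.ne', abs_div, abs_of_pos hs2, div_le_iff₀ hs2]
    exact hS
  · simp_rw [eL]
    rw [← Finset.sum_div, div_le_iff₀ hs2]
    exact hL

/-! ### Quantiles -/

/-- Right-continuity of the distribution function makes the infimum attained, and `0 < q < 1` makes
the set nonempty and bounded below. This yields measurability of the dCRT critical value, and
localises that value from the distribution function at two points. -/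
theorem quantile_le_iff (ν : Measure ℝ) [IsProbabilityMeasure ν] {q : ℝ} (hq0 : 0 < q)
    (hq1 : q < 1) (t : ℝ) : quantile ν q ≤ t ↔ q ≤ ν.real (Set.Iic t) := by
  have hne : {t : ℝ | q ≤ ν.real (Set.Iic t)}.Nonempty := by
    obtain ⟨s, hs⟩ := ((tendsto_cdf_atTop ν).eventually_const_lt hq1).exists
    exact ⟨s, by rw [Set.mem_ofPred_eq, ← cdf_eq_real]; exact hs.le⟩
  have hbdd : BddBelow {t : ℝ | q ≤ ν.real (Set.Iic t)} := by
    obtain ⟨s, hs⟩ := ((tendsto_cdf_atBot ν).eventually_lt_const hq0).exists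
    refine ⟨s, fun r hr => ?_⟩
    rw [Set.mem_ofPred_eq, ← cdf_eq_real] at hr
    by_contra! h
    exact absurd (hr.trans (monotone_cdf ν h.le)) (not_le.2 hs)
  refine ⟨fun h => ?_, fun h => csInf_le hbdd h⟩
  have hright := ((cdf ν).right_continuous t).tendsto.mono_left
    (nhdsWithin_mono t Set.Ioi_subset_Ici_self)
  rw [← cdf_eq_real]
  refine ge_of_tendsto hright ?_
  filter_upwards [self_mem_nhdsWithin] with s hs
  obtain ⟨r, hr, hrs⟩ := exists_lt_of_csInf_lt hne (lt_of_le_of_lt h hs)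
  rw [Set.mem_ofPred_eq, ← cdf_eq_real] at hr
  exact hr.trans (monotone_cdf ν hrs.le)

/-- The density is at most `1 / √(2π) ≤ 1`. This bounds the probability of a narrow window around
the critical value. -/
theorem gaussianReal_Iic_sub_le {a b : ℝ} (hab : a ≤ b) :
    (gaussianReal 0 1).real (Set.Iic b) - (gaussianReal 0 1).real (Set.Iic a) ≤ b - a := by
  have hdiff : (gaussianReal 0 1).real (Set.Ioc a b) =
      (gaussianReal 0 1).real (Set.Iic b) - (gaussianReal 0 1).real (Set.Iic a) := by
    rw [← Set.Iic_sdiff_Iic, measureReal_sdiff (Set.Iic_subset_Iic.2 hab) measurableSet_Iic]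
  rw [← hdiff]
  have h : gaussianReal 0 1 (Set.Ioc a b) ≤ ENNReal.ofReal (b - a) := by
    rw [gaussianReal_apply 0 one_ne_zero, ← Real.volume_Ioc]
    refine (setLIntegral_mono measurable_const (g := fun _ => 1) fun x _ => ?_).trans (by simp)
    rw [gaussianPDF, ← ENNReal.ofReal_one]
    refine ENNReal.ofReal_le_ofReal ?_
    rw [gaussianPDFReal]
    have h1 : (1 : ℝ) ≤ √(2 * Real.pi * (1 : NNReal)) := by
      rw [Real.one_le_sqrt]
      simp only [NNReal.coe_one]
      nlinarith [Real.pi_gt_three]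
    refine mul_le_one₀ (inv_le_one_of_one_le₀ h1) (Real.exp_nonneg _) ?_
    rw [Real.exp_le_one_iff]
    have : 0 ≤ (x - 0) ^ 2 / (2 * ((1 : NNReal) : ℝ)) := by positivity
    rw [neg_div]
    linarith
  have := ENNReal.toReal_mono ENNReal.ofReal_ne_top h
  rwa [ENNReal.toReal_ofReal (by linarith)] at this

/-- The Gaussian charges every interval of positive length, so its quantile is isolated: a
distribution function close to the normal one has a nearby quantile. -/
theorem gaussianReal_Iic_lt {a b : ℝ} (hab : a < b) :
    (gaussianReal 0 1).real (Set.Iic a) < (gaussianReal 0 1).real (Set.Iic b) := by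
  have hdiff : (gaussianReal 0 1).real (Set.Ioc a b) =
      (gaussianReal 0 1).real (Set.Iic b) - (gaussianReal 0 1).real (Set.Iic a) := by
    rw [← Set.Iic_sdiff_Iic, measureReal_sdiff (Set.Iic_subset_Iic.2 hab.le) measurableSet_Iic]
  have hpos : 0 < (gaussianReal 0 1).real (Set.Ioc a b) := by
    refine ENNReal.toReal_pos (fun h => ?_) (measure_ne_top _ _)
    have := gaussianReal_absolutelyContinuous' 0 (one_ne_zero (α := NNReal)) h
    rw [Real.volume_Ioc, ENNReal.ofReal_eq_zero] at this
    linarith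
  linarith

/-! ### Convergence in probability -/

section InProb

variable {Ω : ℕ → Type} [∀ n, MeasurableSpace (Ω n)] {P : ∀ n, Measure (Ω n)}

/-- A union bound. Only an almost sure implication between smallness statements has to be checked,
and subadditivity of the outer measure makes measurability irrelevant. -/
theorem TendstoZeroInProbENN.comp₂ {U V W : ∀ n, Ω n → ℝ≥0∞} (hU : TendstoZeroInProbENN P U)
    (hV : TendstoZeroInProbENN P V)
    (h : ∀ ε : ℝ, 0 < ε → ∃ δ : ℝ, 0 < δ ∧ ∀ᶠ n in atTop, ∀ᵐ ω ∂P n,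
      U n ω < ENNReal.ofReal δ → V n ω < ENNReal.ofReal δ → W n ω < ENNReal.ofReal ε) :
    TendstoZeroInProbENN P W := by
  intro ε hε
  obtain ⟨e, he0, he⟩ : ∃ e : ℝ, 0 < e ∧ ENNReal.ofReal e ≤ ε := by
    obtain ⟨e, he0, he⟩ := ENNReal.lt_iff_exists_real_btwn.1 hε
    exact ⟨e, ENNReal.ofReal_pos.1 he.1, he.2.le⟩
  obtain ⟨δ, hδ, H⟩ := h e he0
  have hlim := (hU _ (ENNReal.ofReal_pos.2 hδ)).add (hV _ (ENNReal.ofReal_pos.2 hδ))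
  rw [add_zero] at hlim
  refine tendsto_of_tendsto_of_tendsto_of_le_of_le' tendsto_const_nhds hlim
    (Eventually.of_forall fun _ => zero_le) ?_
  filter_upwards [H] with n hn
  refine (measure_mono_ae ?_).trans (measure_union_le _ _)
  filter_upwards [hn] with ω hω (hW : ε ≤ W n ω)
  change ENNReal.ofReal δ ≤ U n ω ∨ ENNReal.ofReal δ ≤ V n ω
  by_contra hc'
  push Not at hc'
  exact absurd (hω hc'.1 hc'.2) (not_lt.2 (he.trans hW))

theorem tendstoZeroInProb_iff_enorm {W : ∀ n, Ω n → ℝ} :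
    TendstoZeroInProb P W ↔ TendstoZeroInProbENN P fun n ω => ‖W n ω‖ₑ := by
  have hset : ∀ ε : ℝ, ∀ n, {ω | ε ≤ |W n ω|} = {ω | ENNReal.ofReal ε ≤ ‖W n ω‖ₑ} := by
    intro ε n
    ext ω
    simp only [Set.mem_ofPred_eq, Real.enorm_eq_ofReal_abs]
    exact (ENNReal.ofReal_le_ofReal_iff (abs_nonneg _)).symm
  constructor
  · intro h ε hε
    obtain ⟨e, he0, he⟩ := ENNReal.lt_iff_exists_real_btwn.1 hε
    have := h e (ENNReal.ofReal_pos.1 he.1)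
    simp_rw [hset] at this
    exact tendsto_of_tendsto_of_tendsto_of_le_of_le tendsto_const_nhds this
      (fun _ => zero_le) fun n => measure_mono fun ω (hω : ε ≤ _) => he.2.le.trans hω
  · intro h ε hε
    simp_rw [hset]
    exact h _ (ENNReal.ofReal_pos.2 hε)

theorem enorm_lt_ofReal_iff {x δ : ℝ} : ‖x‖ₑ < ENNReal.ofReal δ ↔ |x| < δ := by
  rw [Real.enorm_eq_ofReal_abs, ENNReal.ofReal_lt_ofReal_iff_of_nonneg (abs_nonneg x)]

theorem TendstoZeroInProb.comp₂ {U V W : ∀ n, Ω n → ℝ} (hU : TendstoZeroInProb P U)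
    (hV : TendstoZeroInProb P V)
    (h : ∀ ε : ℝ, 0 < ε → ∃ δ : ℝ, 0 < δ ∧ ∀ᶠ n in atTop, ∀ᵐ ω ∂P n,
      |U n ω| < δ → |V n ω| < δ → |W n ω| < ε) :
    TendstoZeroInProb P W := by
  rw [tendstoZeroInProb_iff_enorm] at *
  refine hU.comp₂ hV ?_
  simpa only [enorm_lt_ofReal_iff] using h

theorem TendstoZeroInProb.add {U V : ∀ n, Ω n → ℝ} (hU : TendstoZeroInProb P U)
    (hV : TendstoZeroInProb P V) : TendstoZeroInProb P fun n ω => U n ω + V n ω := by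
  refine hU.comp₂ hV fun ε hε => ⟨ε / 2, by positivity, ?_⟩
  refine Eventually.of_forall fun n => ae_of_all _ fun ω h1 h2 => ?_
  exact (abs_add_le _ _).trans_lt (by linarith)

theorem TendstoZeroInProb.comp {U W : ∀ n, Ω n → ℝ} (hU : TendstoZeroInProb P U)
    (h : ∀ ε : ℝ, 0 < ε → ∃ δ : ℝ, 0 < δ ∧ ∀ᶠ n in atTop, ∀ᵐ ω ∂P n,
      |U n ω| < δ → |W n ω| < ε) :
    TendstoZeroInProb P W := by
  refine hU.comp₂ hU fun ε hε => ?_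
  obtain ⟨δ, hδ, H⟩ := h ε hε
  exact ⟨δ, hδ, H.mono fun _ hn => hn.mono fun _ hω h1 _ => hω h1⟩

theorem TendstoZeroInProb.of_abs_le {U W : ∀ n, Ω n → ℝ} (hU : TendstoZeroInProb P U)
    (h : ∀ᶠ n in atTop, ∀ᵐ ω ∂P n, |W n ω| ≤ |U n ω|) : TendstoZeroInProb P W :=
  hU.comp fun ε hε => ⟨ε, hε, h.mono fun _ hn => hn.mono fun _ hω h1 => hω.trans_lt h1⟩

theorem TendstoZeroInProb.neg {U : ∀ n, Ω n → ℝ} (hU : TendstoZeroInProb P U) :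
    TendstoZeroInProb P fun n ω => -U n ω :=
  hU.of_abs_le (Eventually.of_forall fun _ => ae_of_all _ fun _ => (abs_neg _).le)

theorem TendstoZeroInProb.sub {U V : ∀ n, Ω n → ℝ} (hU : TendstoZeroInProb P U)
    (hV : TendstoZeroInProb P V) : TendstoZeroInProb P fun n ω => U n ω - V n ω := by
  simpa only [sub_eq_add_neg] using hU.add hV.neg

theorem TendstoZeroInProb.congr {U W : ∀ n, Ω n → ℝ} (hU : TendstoZeroInProb P U)
    (h : ∀ᶠ n in atTop, ∀ᵐ ω ∂P n, W n ω = U n ω) : TendstoZeroInProb P W :=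
  hU.of_abs_le (h.mono fun _ hn => hn.mono fun _ hω => by rw [hω])

theorem TendstoZeroInProb.sq {U : ∀ n, Ω n → ℝ} (hU : TendstoZeroInProb P U) :
    TendstoZeroInProb P fun n ω => U n ω ^ 2 := by
  refine hU.comp fun ε hε => ⟨min ε 1, lt_min hε one_pos, ?_⟩
  refine Eventually.of_forall fun n => ae_of_all _ fun ω h1 => ?_
  rw [abs_pow]
  have h2 := h1.trans_le (min_le_left _ _)
  have h3 := h1.trans_le (min_le_right _ _)
  nlinarith [abs_nonneg (U n ω)]

theorem TendstoZeroInProb.of_sq {U : ∀ n, Ω n → ℝ}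
    (hU : TendstoZeroInProb P fun n ω => U n ω ^ 2) : TendstoZeroInProb P U := by
  refine hU.comp fun ε hε => ⟨ε ^ 2, by positivity, ?_⟩
  refine Eventually.of_forall fun n => ae_of_all _ fun ω h1 => ?_
  rw [abs_pow] at h1
  exact lt_of_pow_lt_pow_left₀ 2 hε.le h1

/-- Markov's inequality, conditionally on the information that a transition `Q n` preserving `P n`
leaves unchanged. -/
theorem TendstoZeroInProbENN.of_bind [∀ n, IsProbabilityMeasure (P n)]
    {Q : ∀ n, Ω n → Measure (Ω n)} (hQm : ∀ᶠ n in atTop, Measurable (Q n))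
    (hQ : ∀ᶠ n in atTop, (P n).bind (Q n) = P n)
    (hQ1 : ∀ n ω, IsProbabilityMeasure (Q n ω)) {W : ∀ n, Ω n → ℝ≥0∞}
    (hW : ∀ᶠ n in atTop, Measurable (W n))
    (h : TendstoZeroInProbENN P fun n ω => ∫⁻ ω', W n ω' ∂Q n ω) :
    TendstoZeroInProbENN P W := by
  intro ε' hε'
  obtain ⟨ε, hε0, hε⟩ : ∃ ε : ℝ, 0 < ε ∧ ENNReal.ofReal ε ≤ ε' := by
    obtain ⟨e, _, he⟩ := ENNReal.lt_iff_exists_real_btwn.1 hε'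
    exact ⟨e, ENNReal.ofReal_pos.1 he.1, he.2.le⟩
  rw [ENNReal.tendsto_nhds_zero]
  intro c hc
  obtain ⟨e, -, he⟩ := ENNReal.lt_iff_exists_real_btwn.1 hc
  have he0 : 0 < e := ENNReal.ofReal_pos.1 he.1
  -- Markov's inequality divides by `ε` and leaves `e / 2`; the exceptional set contributes the
  -- other `e / 2`.
  have hη : 0 < ENNReal.ofReal (ε * (e / 2)) := ENNReal.ofReal_pos.2 (by positivity)
  have hlim := (h _ hη).eventually_lt_const (ENNReal.ofReal_pos.2 (half_pos he0))
  filter_upwards [hQm, hQ, hW, hlim] with n h1 h2 h3 h4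
  have hS : MeasurableSet {ω | ENNReal.ofReal ε ≤ W n ω} := measurableSet_le measurable_const h3
  have hεp : ENNReal.ofReal ε ≠ 0 := (ENNReal.ofReal_pos.2 hε0).ne'
  -- The exceptional set is replaced by a measurable hull of the same measure, so that its indicator
  -- can be integrated.
  set B := toMeasurable (P n) {ω | ENNReal.ofReal (ε * (e / 2)) ≤ ∫⁻ ω', W n ω' ∂Q n ω}
  have hpt : ∀ ω, Q n ω {ω | ENNReal.ofReal ε ≤ W n ω} ≤
      B.indicator 1 ω + ENNReal.ofReal (e / 2) := by
    intro ω
    by_cases hω : ω ∈ B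
    · rw [Set.indicator_of_mem hω, Pi.one_apply]
      exact (prob_le_one).trans le_self_add
    · rw [Set.indicator_of_notMem hω, zero_add]
      have hlt : ∫⁻ ω', W n ω' ∂Q n ω < ENNReal.ofReal (ε * (e / 2)) := by
        by_contra hc
        exact hω (subset_toMeasurable _ _ (not_lt.1 hc))
      have hM := (mul_meas_ge_le_lintegral (μ := Q n ω) h3 (ENNReal.ofReal ε)).trans hlt.le
      rw [ENNReal.ofReal_mul hε0.le] at hM
      exact (ENNReal.mul_le_mul_iff_right hεp ENNReal.ofReal_ne_top).1 hM
  calc P n {ω | ε' ≤ W n ω} ≤ P n {ω | ENNReal.ofReal ε ≤ W n ω} :=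
        measure_mono fun ω (hω : ε' ≤ W n ω) => hε.trans hω
    _ = (P n).bind (Q n) {ω | ENNReal.ofReal ε ≤ W n ω} := by rw [h2]
    _ = ∫⁻ ω, Q n ω {ω | ENNReal.ofReal ε ≤ W n ω} ∂P n := Measure.bind_apply hS h1.aemeasurable
    _ ≤ ∫⁻ ω, (B.indicator 1 ω + ENNReal.ofReal (e / 2)) ∂P n := lintegral_mono hpt
    _ = P n B + ENNReal.ofReal (e / 2) := by
        rw [lintegral_add_right _ measurable_const,
          lintegral_indicator_one (measurableSet_toMeasurable _ _), lintegral_const,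
          measure_univ, mul_one]
    _ ≤ ENNReal.ofReal (e / 2) + ENNReal.ofReal (e / 2) :=
        add_le_add ((measure_toMeasurable _).trans_le h4.le) le_rfl
    _ = ENNReal.ofReal e := by rw [← ENNReal.ofReal_add (by linarith) (by linarith)]; ring_nf
    _ ≤ c := he.2.le

/-- Markov's inequality. -/
theorem TendstoZeroInProb.of_lintegral {W : ∀ n, Ω n → ℝ}
    (hW : ∀ᶠ n in atTop, Measurable (W n))
    (h : Tendsto (fun n => ∫⁻ ω, ‖W n ω‖ₑ ∂P n) atTop (𝓝 0)) : TendstoZeroInProb P W := by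
  rw [tendstoZeroInProb_iff_enorm]
  intro ε hε
  obtain ⟨e, -, he⟩ := ENNReal.lt_iff_exists_real_btwn.1 hε
  have he0 := he.1.ne'
  have hlim := ENNReal.Tendsto.div_const h (.inr he0)
  rw [ENNReal.zero_div] at hlim
  refine tendsto_of_tendsto_of_tendsto_of_le_of_le' tendsto_const_nhds hlim
    (Eventually.of_forall fun _ => zero_le) ?_
  filter_upwards [hW] with n hn
  exact (measure_mono fun ω (hω : ε ≤ ‖W n ω‖ₑ) => he.2.le.trans hω).trans
    (meas_ge_le_lintegral_div hn.enorm.aemeasurable he0 ENNReal.ofReal_ne_top)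

theorem TendstoZeroInProbENN.of_le_ofReal {U : ∀ n, Ω n → ℝ} {W : ∀ n, Ω n → ℝ≥0∞}
    (hU : TendstoZeroInProb P U) (h : ∀ᶠ n in atTop, ∀ᵐ ω ∂P n, W n ω ≤ ENNReal.ofReal (U n ω)) :
    TendstoZeroInProbENN P W := by
  rw [tendstoZeroInProb_iff_enorm] at hU
  refine hU.comp₂ hU fun ε hε => ⟨ε, hε, h.mono fun n hn => hn.mono fun ω hω h1 _ => ?_⟩
  refine (hω.trans ?_).trans_lt h1
  rw [Real.enorm_eq_ofReal_abs]
  exact ENNReal.ofReal_le_ofReal (le_abs_self _)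

end InProb

/-! ### Product measures depending on a parameter -/

section Pi

variable {ι α β : Type*} [Fintype ι] [MeasurableSpace α] [MeasurableSpace β]

theorem lintegral_prod_pi {μ : ι → Measure α} [∀ i, IsProbabilityMeasure (μ i)]
    {f : ι → α → ℝ≥0∞} (hf : ∀ i, Measurable (f i)) :
    ∫⁻ b, ∏ i, f i (b i) ∂Measure.pi μ = ∏ i, ∫⁻ x, f i x ∂μ i := by
  have hind : iIndepFun (fun i (b : ι → α) => f i (b i)) (Measure.pi μ) :=
    iIndepFun_pi fun i => (hf i).aemeasurable
  rw [lintegral_prod_eq_prod_lintegral_of_indepFun Finset.univ _ hind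
    fun i => (hf i).comp (measurable_pi_apply i)]
  exact Finset.prod_congr rfl fun i _ => (measurePreserving_eval μ i).lintegral_comp (hf i)

/-- Boxes form a generating π-system, and the measure of a box is a finite product of measurable
functions of the parameter. -/
theorem measurable_measure_pi {μ : α → ι → Measure β} [∀ a i, IsProbabilityMeasure (μ a i)]
    (hμ : ∀ i, Measurable fun a => μ a i) : Measurable fun a => Measure.pi (μ a) := by
  refine Measurable.measure_of_isPiSystem_of_isProbabilityMeasure generateFrom_pi.symm
    isPiSystem_pi ?_
  rintro _ ⟨s, hs, rfl⟩
  simp only [Measure.pi_pi]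
  exact Finset.measurable_prod _ fun i _ =>
    (Measure.measurable_coe (hs i (Set.mem_univ i))).comp (hμ i)

/-- If a transition preserves a law, then the product transition preserves the product law. -/
theorem pi_bind_pi {L : Measure α} [IsProbabilityMeasure L] {Q : α → Measure α}
    [∀ a, IsProbabilityMeasure (Q a)] (hQ : Measurable Q) (hL : L.bind Q = L) :
    (Measure.pi fun _ : ι => L).bind (fun d => Measure.pi fun i => Q (d i)) =
      Measure.pi fun _ : ι => L := by
  refine (Measure.pi_eq fun s hs => ?_).symm
  have hm : Measurable fun d : ι → α => Measure.pi fun i => Q (d i) :=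
    measurable_measure_pi fun i => hQ.comp (measurable_pi_apply i)
  rw [Measure.bind_apply (MeasurableSet.univ_pi hs) hm.aemeasurable]
  simp only [Measure.pi_pi]
  rw [lintegral_prod_pi (f := fun i a => Q a (s i)) fun i => (Measure.measurable_coe (hs i)).comp hQ]
  refine Finset.prod_congr rfl fun i _ => ?_
  rw [← Measure.bind_apply (hs i) hQ.aemeasurable, hL]

end Pi

/-! ### Measurability of conditional means and variances -/

section Kernel

variable {α β : Type*} [MeasurableSpace α] [MeasurableSpace β]

theorem measurable_integral_id_kernel (κ : Kernel α ℝ) [IsSFiniteKernel κ] :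
    Measurable fun a => ∫ u, u ∂κ a :=
  (StronglyMeasurable.integral_kernel_prod_right' (κ := κ) (f := fun q : α × ℝ => q.2)
    measurable_snd.stronglyMeasurable).measurable

theorem measurable_variance_id_kernel (κ : Kernel α ℝ) [IsSFiniteKernel κ] :
    Measurable fun a => variance id (κ a) := by
  have h : Measurable fun a => ∫⁻ u, ‖u - ∫ v, v ∂κ a‖ₑ ^ 2 ∂κ a :=
    Measurable.lintegral_kernel_prod_right' (κ := κ)
      (f := fun q : α × ℝ => ‖q.2 - ∫ v, v ∂κ q.1‖ₑ ^ 2)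
      (((measurable_snd.sub ((measurable_integral_id_kernel κ).comp measurable_fst)).enorm).pow_const
        2)
  exact h.ennreal_toReal

/-- Monotonicity of `L^p` norms on a probability space. Stated with `∫⁻`, it holds whether or not
the higher moment is finite. -/
theorem lintegral_sq_rpow_le (ν : Measure β) [IsProbabilityMeasure ν] {h : β → ℝ}
    (hh : Measurable h) {δ : ℝ} (hδ : 0 ≤ δ) :
    (∫⁻ x, ‖h x‖ₑ ^ (2 : ℝ) ∂ν) ^ (1 + δ / 2) ≤ ∫⁻ x, ‖h x‖ₑ ^ (2 + δ) ∂ν := by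
  have h1 := eLpNorm_le_eLpNorm_of_exponent_le (μ := ν) (f := h) (p := ENNReal.ofReal 2)
    (q := ENNReal.ofReal (2 + δ)) (ENNReal.ofReal_le_ofReal (by linarith))
    hh.aestronglyMeasurable
  rw [eLpNorm_eq_lintegral_rpow_enorm_toReal (by simp) (by simp),
    eLpNorm_eq_lintegral_rpow_enorm_toReal (by simp; linarith) (by simp),
    ENNReal.toReal_ofReal (by norm_num), ENNReal.toReal_ofReal (by linarith)] at h1
  have h2 := ENNReal.rpow_le_rpow h1 (show (0 : ℝ) ≤ 2 + δ by linarith)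
  rw [← ENNReal.rpow_mul, ← ENNReal.rpow_mul, one_div_mul_cancel (by linarith), ENNReal.rpow_one]
    at h2
  convert h2 using 2
  ring

theorem ofReal_variance_id {ν : Measure ℝ} [IsProbabilityMeasure ν] (h : MemLp id 2 ν) :
    ENNReal.ofReal (variance id ν) = ∫⁻ x, ‖x - ∫ u, u ∂ν‖ₑ ^ (2 : ℝ) ∂ν := by
  rw [h.ofReal_variance_eq, evariance]
  simp

end Kernel

/-! ### One observation under the null -/

section OneObservation

variable {p : ℕ}

@[fun_prop]
theorem measurable_obs_x : Measurable (Obs.x (p := p)) := measurable_fst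

@[fun_prop]
theorem measurable_obs_y : Measurable (Obs.y (p := p)) := measurable_fst.comp measurable_snd

@[fun_prop]
theorem measurable_obs_z : Measurable (Obs.z (p := p)) := measurable_snd.comp measurable_snd

variable (L : Measure (Obs p)) [IsProbabilityMeasure L]

instance : IsProbabilityMeasure (lawZ L) :=
  Measure.isProbabilityMeasure_map measurable_obs_z.aemeasurable

instance : IsMarkovKernel (lawXZ L) := by unfold lawXZ; infer_instance

instance : IsMarkovKernel (lawYZ L) := by unfold lawYZ; infer_instance

instance : IsMarkovKernel (lawXYZ L) := by unfold lawXYZ; infer_instance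

@[fun_prop]
theorem measurable_muX : Measurable (muX L) := measurable_integral_id_kernel _

@[fun_prop]
theorem measurable_muY : Measurable (muY L) := measurable_integral_id_kernel _

@[fun_prop]
theorem measurable_varX : Measurable (varX L) := measurable_variance_id_kernel _

@[fun_prop]
theorem measurable_varY : Measurable (varY L) := measurable_variance_id_kernel _

theorem varX_nonneg (z : Fin p → ℝ) : 0 ≤ varX L z := variance_nonneg _ _

theorem varY_nonneg (z : Fin p → ℝ) : 0 ≤ varY L z := variance_nonneg _ _

variable {L}

theorem IsNull.map_eq_compProd (h : IsNull L) :
    L.map (fun o => (o.z, (o.x, o.y))) = lawZ L ⊗ₘ (lawXZ L ×ₖ lawYZ L) := by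
  have h1 := compProd_map_condDistrib (mβ := MeasurableSpace.pi) (X := Obs.z (p := p))
    (μ := L) (Y := fun o : Obs p => (o.x, o.y)) (by fun_prop)
  rw [← h1]
  refine Measure.compProd_congr ?_
  filter_upwards [h] with z hz
  rw [Kernel.prod_apply]
  exact hz

theorem IsNull.lintegral_eq (h : IsNull L) {f : Obs p → ℝ≥0∞} (hf : Measurable f) :
    ∫⁻ o, f o ∂L = ∫⁻ z, ∫⁻ x, ∫⁻ y, f (x, y, z) ∂lawYZ L z ∂lawXZ L z ∂lawZ L := by
  let g : (Fin p → ℝ) × (ℝ × ℝ) → ℝ≥0∞ := fun w => f (w.2.1, w.2.2, w.1)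
  have hg : Measurable g := by fun_prop
  calc ∫⁻ o, f o ∂L = ∫⁻ w, g w ∂L.map (fun o => (o.z, (o.x, o.y))) :=
        (lintegral_map (g := fun o : Obs p => (o.z, (o.x, o.y))) hg (by fun_prop)).symm
    _ = ∫⁻ z, ∫⁻ w, g (z, w) ∂(lawXZ L ×ₖ lawYZ L) z ∂lawZ L := by
        rw [h.map_eq_compProd, Measure.lintegral_compProd hg]
    _ = _ := by
        refine lintegral_congr fun z => ?_
        rw [Kernel.prod_apply, lintegral_prod (fun w => g (z, w))
          (hg.comp measurable_prodMk_left).aemeasurable]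

theorem IsNull.lintegral_eq_swap (h : IsNull L) {f : Obs p → ℝ≥0∞} (hf : Measurable f) :
    ∫⁻ o, f o ∂L = ∫⁻ z, ∫⁻ y, ∫⁻ x, f (x, y, z) ∂lawXZ L z ∂lawYZ L z ∂lawZ L := by
  rw [h.lintegral_eq hf]
  exact lintegral_congr fun z => lintegral_lintegral_swap (by fun_prop)

variable (L)

/-- Redraw `Y` from its conditional law given `Z`. -/
noncomputable def redrawY (o : Obs p) : Measure (Obs p) := (lawYZ L o.z).map fun y => (o.x, y, o.z)

/-- Redraw `X` from its conditional law given `Z`. -/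
noncomputable def redrawX (o : Obs p) : Measure (Obs p) := (lawXZ L o.z).map fun x => (x, o.y, o.z)

instance (o : Obs p) : IsProbabilityMeasure (redrawY L o) :=
  Measure.isProbabilityMeasure_map (by fun_prop)

instance (o : Obs p) : IsProbabilityMeasure (redrawX L o) :=
  Measure.isProbabilityMeasure_map (by fun_prop)

theorem measurable_redrawY : Measurable (redrawY L) := by
  refine Measure.measurable_of_measurable_coe _ fun s hs => ?_
  have h := Kernel.measurable_kernel_prodMk_left (κ := (lawYZ L).comap Obs.z measurable_obs_z)
    (t := (fun w : Obs p × ℝ => ((w.1.x, w.2, w.1.z) : Obs p)) ⁻¹' s)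
    (hs.preimage (by fun_prop))
  convert h using 2 with o
  rw [redrawY, Measure.map_apply (by fun_prop) hs, Kernel.comap_apply]
  rfl

theorem measurable_redrawX : Measurable (redrawX L) := by
  refine Measure.measurable_of_measurable_coe _ fun s hs => ?_
  have h := Kernel.measurable_kernel_prodMk_left (κ := (lawXZ L).comap Obs.z measurable_obs_z)
    (t := (fun w : Obs p × ℝ => ((w.2, w.1.y, w.1.z) : Obs p)) ⁻¹' s)
    (hs.preimage (by fun_prop))
  convert h using 2 with o
  rw [redrawX, Measure.map_apply (by fun_prop) hs, Kernel.comap_apply]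
  rfl

variable {L}

/-- Given `Z`, the response is independent of `X`, so a fresh copy has the same joint law with `(X,
Z)`. Integrating against this transition plays the role of conditioning on `(X, Z)`. -/
theorem IsNull.bind_redrawY (h : IsNull L) : L.bind (redrawY L) = L := by
  refine Measure.ext_of_lintegral _ fun f hf => ?_
  have hm := measurable_redrawY L
  rw [Measure.lintegral_bind hm.aemeasurable hf.aemeasurable,
    h.lintegral_eq (f := fun o => ∫⁻ o', f o' ∂redrawY L o)
      ((Measure.measurable_lintegral hf).comp hm), h.lintegral_eq hf]
  refine lintegral_congr fun z => lintegral_congr fun x => ?_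
  have : ∀ y, ∫⁻ o, f o ∂redrawY L (x, y, z) = ∫⁻ y', f (x, y', z) ∂lawYZ L z := fun y =>
    lintegral_map hf (by fun_prop)
  simp only [this, lintegral_const, measure_univ, mul_one]

theorem IsNull.bind_redrawX (h : IsNull L) : L.bind (redrawX L) = L := by
  refine Measure.ext_of_lintegral _ fun f hf => ?_
  have hm := measurable_redrawX L
  rw [Measure.lintegral_bind hm.aemeasurable hf.aemeasurable,
    h.lintegral_eq_swap (f := fun o => ∫⁻ o', f o' ∂redrawX L o)
      ((Measure.measurable_lintegral hf).comp hm), h.lintegral_eq_swap hf]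
  refine lintegral_congr fun z => lintegral_congr fun y => ?_
  have : ∀ x, ∫⁻ o, f o ∂redrawX L (x, y, z) = ∫⁻ x', f (x', y, z) ∂lawXZ L z := fun x =>
    lintegral_map hf (by fun_prop)
  simp only [this, lintegral_const, measure_univ, mul_one]

variable (L)

/-- The product of the true residuals `(X - μ_x(Z)) (Y - μ_y(Z))`. -/
noncomputable def noiseProd (o : Obs p) : ℝ := (o.x - muX L o.z) * (o.y - muY L o.z)

@[fun_prop]
theorem measurable_noiseProd : Measurable (noiseProd L) := by unfold noiseProd; fun_prop

variable {L}

theorem IsNull.lintegral_noiseProd_rpow (h : IsNull L) {q : ℝ} (hq : 0 ≤ q) :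
    ∫⁻ o, ‖noiseProd L o‖ₑ ^ q ∂L =
      ∫⁻ z, (∫⁻ x, ‖x - muX L z‖ₑ ^ q ∂lawXZ L z) * ∫⁻ y, ‖y - muY L z‖ₑ ^ q ∂lawYZ L z
        ∂lawZ L := by
  rw [h.lintegral_eq (by fun_prop)]
  refine lintegral_congr fun z => ?_
  rw [← lintegral_mul_const _ (by fun_prop)]
  refine lintegral_congr fun x => ?_
  rw [← lintegral_const_mul _ (by fun_prop)]
  refine lintegral_congr fun y => ?_
  change ‖(x - muX L z) * (y - muY L z)‖ₑ ^ q = _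
  rw [enorm_mul, ENNReal.mul_rpow_of_nonneg _ _ hq]

theorem HasCondVariances.lintegral_muX (hv : HasCondVariances L) :
    ∀ᵐ z ∂lawZ L, ENNReal.ofReal (varX L z) = ∫⁻ x, ‖x - muX L z‖ₑ ^ (2 : ℝ) ∂lawXZ L z :=
  hv.mono fun _ hz => ofReal_variance_id hz.1

theorem HasCondVariances.lintegral_muY (hv : HasCondVariances L) :
    ∀ᵐ z ∂lawZ L, ENNReal.ofReal (varY L z) = ∫⁻ y, ‖y - muY L z‖ₑ ^ (2 : ℝ) ∂lawYZ L z :=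
  hv.mono fun _ hz => ofReal_variance_id hz.2

/-- Conditional independence factors the inner integral. Hence the products of residuals and the
products of conditional variances obey weak laws with the same centering. -/
theorem lintegral_noiseProd_sq (h : IsNull L) (hv : HasCondVariances L) :
    ∫⁻ o, ‖noiseProd L o‖ₑ ^ (2 : ℝ) ∂L =
      ∫⁻ o, ENNReal.ofReal (varX L o.z * varY L o.z) ∂L := by
  have e : ∫⁻ o, ENNReal.ofReal (varX L o.z * varY L o.z) ∂L =
      ∫⁻ z, ENNReal.ofReal (varX L z * varY L z) ∂lawZ L :=
    (lintegral_map (f := fun z => ENNReal.ofReal (varX L z * varY L z)) (by fun_prop)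
      measurable_obs_z).symm
  rw [e, h.lintegral_noiseProd_rpow (by norm_num)]
  refine lintegral_congr_ae ?_
  filter_upwards [hv.lintegral_muX, hv.lintegral_muY] with z h1 h2
  rw [← h1, ← h2, ← ENNReal.ofReal_mul (varX_nonneg L z)]

/-- Jensen's inequality inside each conditional law: the moment assumption on the residuals passes
to the conditional variances, as their weak law requires. -/
theorem lintegral_varX_mul_varY_rpow_le (h : IsNull L) (hv : HasCondVariances L) {δ : ℝ}
    (hδ : 0 ≤ δ) :
    ∫⁻ o, ENNReal.ofReal (varX L o.z * varY L o.z) ^ (1 + δ / 2) ∂L ≤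
      ∫⁻ o, ‖noiseProd L o‖ₑ ^ (2 + δ) ∂L := by
  have e : ∫⁻ o, ENNReal.ofReal (varX L o.z * varY L o.z) ^ (1 + δ / 2) ∂L =
      ∫⁻ z, ENNReal.ofReal (varX L z * varY L z) ^ (1 + δ / 2) ∂lawZ L :=
    (lintegral_map (f := fun z => ENNReal.ofReal (varX L z * varY L z) ^ (1 + δ / 2))
      (by fun_prop) measurable_obs_z).symm
  rw [e, h.lintegral_noiseProd_rpow (by linarith)]
  refine lintegral_mono_ae ?_
  filter_upwards [hv.lintegral_muX, hv.lintegral_muY] with z h1 h2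
  rw [ENNReal.ofReal_mul (varX_nonneg L z), ENNReal.mul_rpow_of_nonneg _ _ (by linarith), h1, h2]
  exact mul_le_mul' (lintegral_sq_rpow_le _ (by fun_prop) hδ)
    (lintegral_sq_rpow_le _ (by fun_prop) hδ)

theorem integral_sub_muX {z : Fin p → ℝ} (hz : MemLp id 2 (lawXZ L z)) :
    ∫ x, (x - muX L z) ∂lawXZ L z = 0 := by
  have hi : Integrable (fun x : ℝ => x) (lawXZ L z) := hz.integrable one_le_two
  rw [integral_sub hi (integrable_const _)]
  simp [muX]

theorem integral_noiseProd (h : IsNull L) (hv : HasCondVariances L)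
    (hi : Integrable (noiseProd L) L) : ∫ o, noiseProd L o ∂L = 0 := by
  let g : (Fin p → ℝ) × (ℝ × ℝ) → ℝ := fun w => (w.2.1 - muX L w.1) * (w.2.2 - muY L w.1)
  have hg : Measurable g := by fun_prop
  have hT : Measurable fun o : Obs p => (o.z, (o.x, o.y)) := by fun_prop
  have hgi : Integrable g (L.map fun o => (o.z, (o.x, o.y))) :=
    (integrable_map_measure hg.aestronglyMeasurable hT.aemeasurable).2 hi
  have e : ∫ o, noiseProd L o ∂L = ∫ w, g w ∂L.map (fun o => (o.z, (o.x, o.y))) :=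
    (integral_map hT.aemeasurable hg.aestronglyMeasurable).symm
  rw [h.map_eq_compProd] at e hgi
  rw [e, Measure.integral_compProd hgi]
  refine integral_eq_zero_of_ae ?_
  filter_upwards [hv] with z hz
  rw [Kernel.prod_apply, integral_prod_mul (fun x => x - muX L z) (fun y => y - muY L z),
    integral_sub_muX hz.1, zero_mul, Pi.zero_apply]

end OneObservation

/-! ### Truncated moments and moments of linear combinations -/

section Moments

variable {β : Type*} [MeasurableSpace β]

theorem enorm_sq_eq_ofReal (x : ℝ) : ‖x‖ₑ ^ (2 : ℝ) = ENNReal.ofReal (x ^ 2) := by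
  rw [Real.enorm_eq_ofReal_abs, ENNReal.ofReal_rpow_of_nonneg (abs_nonneg x) (by norm_num),
    Real.rpow_two, sq_abs]

/-- Truncated moments are bounded by higher moments. -/
theorem setLIntegral_ofReal_le {ν : Measure β} {f : β → ℝ} (hf : Measurable f) {κ η : ℝ}
    (hκ : 0 < κ) (hη : 0 ≤ η) :
    ∫⁻ x in {x | κ < f x}, ENNReal.ofReal (f x) ∂ν ≤
      ENNReal.ofReal (κ ^ (-η)) * ∫⁻ x, ENNReal.ofReal (f x) ^ (1 + η) ∂ν := by
  have hS : MeasurableSet {x | κ < f x} := measurableSet_lt measurable_const hf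
  rw [← lintegral_const_mul _ (by fun_prop)]
  refine (setLIntegral_mono (g := fun x => ENNReal.ofReal (κ ^ (-η)) *
    ENNReal.ofReal (f x) ^ (1 + η)) (by fun_prop) fun x (hx : κ < f x) => ?_).trans
    (setLIntegral_le_lintegral _ _)
  have hfx : 0 < f x := hκ.trans hx
  rw [ENNReal.ofReal_rpow_of_pos hfx, ← ENNReal.ofReal_mul (by positivity)]
  refine ENNReal.ofReal_le_ofReal ?_
  rw [Real.rpow_add hfx, Real.rpow_one, Real.rpow_neg hκ.le]
  have h1 : κ ^ η ≤ f x ^ η := Real.rpow_le_rpow hκ.le hx.le hη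
  have h2 : 0 < κ ^ η := Real.rpow_pos_of_pos hκ η
  rw [inv_mul_eq_div, le_div_iff₀ h2]
  exact mul_le_mul_of_nonneg_left h1 hfx.le

/-- The truncation bound with the tails estimated by moments of order `1 + η`, which may be
infinite. It serves both the unconditional weak law and the one given `X` and `Z`. -/
theorem lintegral_enorm_sum_sub_le {ι : Type*} [Fintype ι] {μ : ι → Measure β}
    [∀ i, IsProbabilityMeasure (μ i)] {f : ι → β → ℝ} (hm : ∀ i, Measurable (f i))
    (h0 : ∀ i x, 0 ≤ f i x) (hf : ∀ i, Integrable (f i) (μ i)) {κ η : ℝ} (hκ : 0 < κ)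
    (hη : 0 ≤ η) :
    ∫⁻ b, ‖∑ i, f i (b i) - ∑ i, ∫ x, f i x ∂μ i‖ₑ ∂Measure.pi μ ≤
      2 * (ENNReal.ofReal (κ ^ (-η)) * ∑ i, ∫⁻ x, ENNReal.ofReal (f i x) ^ (1 + η) ∂μ i) +
        ENNReal.ofReal √(κ * ∑ i, ∫ x, f i x ∂μ i) := by
  have hfi : Integrable (fun b : ι → β => ∑ i, f i (b i) - ∑ i, ∫ x, f i x ∂μ i)
      (Measure.pi μ) :=
    (integrable_finsetSum _ fun i _ => integrable_comp_eval (hf i)).sub (integrable_const _)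
  have e : ∫⁻ b, ‖∑ i, f i (b i) - ∑ i, ∫ x, f i x ∂μ i‖ₑ ∂Measure.pi μ =
      ENNReal.ofReal (∫ b, |∑ i, f i (b i) - ∑ i, ∫ x, f i x ∂μ i| ∂Measure.pi μ) := by
    rw [ofReal_integral_eq_lintegral_ofReal hfi.abs (ae_of_all _ fun _ => abs_nonneg _)]
    simp_rw [Real.enorm_eq_ofReal_abs]
  rw [e]
  refine (ENNReal.ofReal_le_ofReal (integral_abs_sum_sub_le hm h0 hf hκ)).trans ?_
  rw [ENNReal.ofReal_add (mul_nonneg zero_le_two (Finset.sum_nonneg fun i _ =>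
      integral_nonneg (h0 i))) (Real.sqrt_nonneg _), ENNReal.ofReal_mul zero_le_two,
    ENNReal.ofReal_sum_of_nonneg fun i _ => integral_nonneg (h0 i), ENNReal.ofReal_ofNat]
  gcongr
  rw [Finset.mul_sum]
  gcongr with i
  rw [ofReal_integral_eq_lintegral_ofReal (hf i).integrableOn (ae_of_all _ (h0 i))]
  exact setLIntegral_ofReal_le (hm i) hκ hη

variable {n : ℕ} {ν : Fin n → Measure ℝ} [∀ i, IsProbabilityMeasure (ν i)]

theorem lintegral_sq_linear_pi (h2 : ∀ i, MemLp id 2 (ν i)) (c : Fin n → ℝ) :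
    ∫⁻ b, ‖(∑ i, c i * (b i - ∫ u, u ∂ν i)) ^ 2‖ₑ ∂Measure.pi ν =
      ENNReal.ofReal (∑ i, c i ^ 2 * variance id (ν i)) := by
  have hg : ∀ i, MemLp (fun x => c i * (x - ∫ u, u ∂ν i)) 2 (ν i) := fun i =>
    ((h2 i).sub (memLp_const _)).const_mul (c i)
  have h0 : ∀ i, ∫ x, c i * (x - ∫ u, u ∂ν i) ∂ν i = 0 := fun i => by
    have hi : Integrable (fun x : ℝ => x) (ν i) := (h2 i).integrable one_le_two
    rw [integral_const_mul, integral_sub hi (integrable_const _)]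
    simp
  have hp : ∀ i, MemLp (fun b : Fin n → ℝ => c i * (b i - ∫ u, u ∂ν i)) 2 (Measure.pi ν) :=
    fun i => (hg i).comp_measurePreserving (measurePreserving_eval ν i)
  have hL : MemLp (fun b : Fin n → ℝ => ∑ i, c i * (b i - ∫ u, u ∂ν i)) 2 (Measure.pi ν) :=
    memLp_finsetSum _ fun i _ => hp i
  have e : ∀ b : Fin n → ℝ, ‖(∑ i, c i * (b i - ∫ u, u ∂ν i)) ^ 2‖ₑ =
      ENNReal.ofReal ((∑ i, c i * (b i - ∫ u, u ∂ν i)) ^ 2) := fun b =>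
    Real.enorm_of_nonneg (sq_nonneg _)
  simp_rw [e]
  rw [← ofReal_integral_eq_lintegral_ofReal hL.integrable_sq (ae_of_all _ fun _ => sq_nonneg _),
    integral_sq_sum_pi hg h0]
  congr 1
  refine Finset.sum_congr rfl fun i _ => ?_
  simp_rw [mul_pow]
  rw [integral_const_mul, variance_eq_integral aemeasurable_id]
  rfl

/-- The value agrees with that for the square of the sum, because independent centered variables
have no mixed terms. So the same weighted error controls a cross term in the statistic and its
effect on the empirical variance. -/
theorem lintegral_sum_sq_pi (h2 : ∀ i, MemLp id 2 (ν i)) (c : Fin n → ℝ) :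
    ∫⁻ b, ‖∑ i, (c i * (b i - ∫ u, u ∂ν i)) ^ 2‖ₑ ∂Measure.pi ν =
      ENNReal.ofReal (∑ i, c i ^ 2 * variance id (ν i)) := by
  have hg : ∀ i, MemLp (fun x => c i * (x - ∫ u, u ∂ν i)) 2 (ν i) := fun i =>
    ((h2 i).sub (memLp_const _)).const_mul (c i)
  have hp : ∀ i, MemLp (fun b : Fin n → ℝ => c i * (b i - ∫ u, u ∂ν i)) 2 (Measure.pi ν) :=
    fun i => (hg i).comp_measurePreserving (measurePreserving_eval ν i)
  have e : ∀ b : Fin n → ℝ, ‖∑ i, (c i * (b i - ∫ u, u ∂ν i)) ^ 2‖ₑ =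
      ENNReal.ofReal (∑ i, (c i * (b i - ∫ u, u ∂ν i)) ^ 2) := fun b =>
    Real.enorm_of_nonneg (Finset.sum_nonneg fun i _ => sq_nonneg _)
  simp_rw [e]
  rw [← ofReal_integral_eq_lintegral_ofReal (integrable_finsetSum _ fun i _ =>
      (hp i).integrable_sq)
    (ae_of_all _ fun _ => Finset.sum_nonneg fun i _ => sq_nonneg _),
    integral_finsetSum _ fun i _ => (hp i).integrable_sq]
  congr 1
  refine Finset.sum_congr rfl fun i _ => ?_
  have hev : ∫ b : Fin n → ℝ, (c i * (b i - ∫ u, u ∂ν i)) ^ 2 ∂Measure.pi ν =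
      ∫ x, (c i * (x - ∫ u, u ∂ν i)) ^ 2 ∂ν i :=
    integral_comp_eval (μ := ν) (i := i) (f := fun x => (c i * (x - ∫ u, u ∂ν i)) ^ 2)
      (by fun_prop)
  rw [hev]
  simp_rw [mul_pow]
  rw [integral_const_mul, variance_eq_integral aemeasurable_id]
  rfl

end Moments

/-! ### Redrawing `Y` or `X` in a sample -/

section Redraw

variable {n p : ℕ}

/-- The sample in which the responses are replaced by `b`. -/
def Sample.setY (d : Sample n p) (b : Fin n → ℝ) : Sample n p := fun i => ((d i).x, b i, (d i).z)

/-- The sample in which the predictors are replaced by `b`. -/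
def Sample.setX (d : Sample n p) (b : Fin n → ℝ) : Sample n p := fun i => (b i, (d i).y, (d i).z)

@[fun_prop]
theorem measurable_xs : Measurable (Sample.xs (n := n) (p := p)) :=
  measurable_pi_lambda _ fun i => measurable_obs_x.comp (measurable_pi_apply i)

@[fun_prop]
theorem measurable_ys : Measurable (Sample.ys (n := n) (p := p)) :=
  measurable_pi_lambda _ fun i => measurable_obs_y.comp (measurable_pi_apply i)

@[fun_prop]
theorem measurable_zs : Measurable (Sample.zs (n := n) (p := p)) :=
  measurable_pi_lambda _ fun i => measurable_obs_z.comp (measurable_pi_apply i)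

@[fun_prop]
theorem measurable_xs_apply (i : Fin n) : Measurable fun d : Sample n p => d.xs i :=
  (measurable_pi_apply i).comp measurable_xs

@[fun_prop]
theorem measurable_ys_apply (i : Fin n) : Measurable fun d : Sample n p => d.ys i :=
  (measurable_pi_apply i).comp measurable_ys

@[fun_prop]
theorem measurable_zs_apply (i : Fin n) : Measurable fun d : Sample n p => d.zs i :=
  (measurable_pi_apply i).comp measurable_zs

theorem measurable_setY (d : Sample n p) : Measurable d.setY :=
  measurable_pi_lambda _ fun i =>
    measurable_const.prodMk ((measurable_pi_apply i).prodMk measurable_const)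

theorem measurable_setX (d : Sample n p) : Measurable d.setX :=
  measurable_pi_lambda _ fun i => (measurable_pi_apply i).prodMk measurable_const

variable (L : Measure (Obs p)) [IsProbabilityMeasure L]

instance : IsProbabilityMeasure (sampleLaw n L) := by unfold sampleLaw; infer_instance

theorem pi_redrawY (d : Sample n p) :
    (Measure.pi fun i => redrawY L (d i)) = (Measure.pi fun i => lawYZ L (d.zs i)).map d.setY :=
  (Measure.pi_map_pi (f := fun i (y : ℝ) => (((d i).x, y, (d i).z) : Obs p))
    (hμ := fun i => inferInstanceAs (SigmaFinite (redrawY L (d i)))) fun i => by fun_prop).symm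

theorem pi_redrawX (d : Sample n p) :
    (Measure.pi fun i => redrawX L (d i)) = (Measure.pi fun i => lawXZ L (d.zs i)).map d.setX :=
  (Measure.pi_map_pi (f := fun i (x : ℝ) => ((x, (d i).y, (d i).z) : Obs p))
    (hμ := fun i => inferInstanceAs (SigmaFinite (redrawX L (d i)))) fun i => by fun_prop).symm

theorem ae_sampleLaw_of_ae_lawZ {Q : (Fin p → ℝ) → Prop} (h : ∀ᵐ z ∂lawZ L, Q z) :
    ∀ᵐ d ∂sampleLaw n L, ∀ i, Q (d.zs i) := by
  rw [ae_all_iff]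
  intro i
  have h1 : ∀ᵐ o ∂L, Q o.z := ae_of_ae_map measurable_obs_z.aemeasurable h
  exact (Measure.tendsto_eval_ae_ae (μ := fun _ : Fin n => L) (i := i)).eventually h1

end Redraw

section RedrawInProb

variable {p : ℕ → ℕ} {L : ∀ n, Measure (Obs (p n))} [∀ n, IsProbabilityMeasure (L n)]

/-- Markov's inequality given `X` and `Z`. Everything learned from `X` and `Z` is unchanged by
`setY` and acts as a constant inside the integral. -/
theorem TendstoZeroInProbENN.of_redrawY (hnull : ∀ n, 1 ≤ n → IsNull (L n))
    {W : ∀ n, Sample n (p n) → ℝ≥0∞} (hW : ∀ n, Measurable (W n))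
    (h : TendstoZeroInProbENN (fun n => sampleLaw n (L n)) fun n d =>
      ∫⁻ b, W n (d.setY b) ∂Measure.pi fun i => lawYZ (L n) (d.zs i)) :
    TendstoZeroInProbENN (fun n => sampleLaw n (L n)) W := by
  refine TendstoZeroInProbENN.of_bind
    (Q := fun n d => Measure.pi fun i => redrawY (L n) (d i)) ?_ ?_ (fun _ _ => inferInstance)
    (Eventually.of_forall hW) ?_
  · exact Eventually.of_forall fun n => measurable_measure_pi fun i =>
      (measurable_redrawY (L n)).comp (measurable_pi_apply i)
  · filter_upwards [eventually_ge_atTop 1] with n hn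
    exact pi_bind_pi (measurable_redrawY (L n)) (hnull n hn).bind_redrawY
  · simp_rw [pi_redrawY]
    convert h using 3 with n d
    exact lintegral_map (hW n) (measurable_setY d)

theorem TendstoZeroInProbENN.of_redrawX (hnull : ∀ n, 1 ≤ n → IsNull (L n))
    {W : ∀ n, Sample n (p n) → ℝ≥0∞} (hW : ∀ n, Measurable (W n))
    (h : TendstoZeroInProbENN (fun n => sampleLaw n (L n)) fun n d =>
      ∫⁻ b, W n (d.setX b) ∂Measure.pi fun i => lawXZ (L n) (d.zs i)) :
    TendstoZeroInProbENN (fun n => sampleLaw n (L n)) W := by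
  refine TendstoZeroInProbENN.of_bind
    (Q := fun n d => Measure.pi fun i => redrawX (L n) (d i)) ?_ ?_ (fun _ _ => inferInstance)
    (Eventually.of_forall hW) ?_
  · exact Eventually.of_forall fun n => measurable_measure_pi fun i =>
      (measurable_redrawX (L n)).comp (measurable_pi_apply i)
  · filter_upwards [eventually_ge_atTop 1] with n hn
    exact pi_bind_pi (measurable_redrawX (L n)) (hnull n hn).bind_redrawX
  · simp_rw [pi_redrawX]
    convert h using 3 with n d
    exact lintegral_map (hW n) (measurable_setX d)

theorem TendstoZeroInProb.of_redrawY (hnull : ∀ n, 1 ≤ n → IsNull (L n))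
    {W : ∀ n, Sample n (p n) → ℝ} (hW : ∀ n, Measurable (W n))
    (h : TendstoZeroInProbENN (fun n => sampleLaw n (L n)) fun n d =>
      ∫⁻ b, ‖W n (d.setY b)‖ₑ ∂Measure.pi fun i => lawYZ (L n) (d.zs i)) :
    TendstoZeroInProb (fun n => sampleLaw n (L n)) W :=
  tendstoZeroInProb_iff_enorm.2 (.of_redrawY hnull (fun n => (hW n).enorm) h)

theorem TendstoZeroInProb.of_redrawX (hnull : ∀ n, 1 ≤ n → IsNull (L n))
    {W : ∀ n, Sample n (p n) → ℝ} (hW : ∀ n, Measurable (W n))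
    (h : TendstoZeroInProbENN (fun n => sampleLaw n (L n)) fun n d =>
      ∫⁻ b, ‖W n (d.setX b)‖ₑ ∂Measure.pi fun i => lawXZ (L n) (d.zs i)) :
    TendstoZeroInProb (fun n => sampleLaw n (L n)) W :=
  tendstoZeroInProb_iff_enorm.2 (.of_redrawX hnull (fun n => (hW n).enorm) h)

end RedrawInProb

/-! ### Measurability of the learned quantities -/

section Learner

variable {n p : ℕ} (A : Learner n p)

instance (i : Fin n) : IsMarkovKernel (A.lawHat i) := A.isMarkovKernel_lawHat i

instance (d : Sample n p) (i : Fin n) : IsProbabilityMeasure (lawHatAt A d i) := by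
  unfold lawHatAt; infer_instance

/-- The learned conditional law of `X_i` as a kernel in the data. -/
noncomputable def lawHatKernel (i : Fin n) : Kernel (Sample n p) ℝ :=
  (A.lawHat i).comap (fun d : Sample n p => ((d.xs, d.zs), d.zs i)) (by fun_prop)

instance (i : Fin n) : IsMarkovKernel (lawHatKernel A i) := by
  unfold lawHatKernel; infer_instance

@[fun_prop]
theorem measurable_muHatXAt (i : Fin n) : Measurable fun d => muHatXAt A d i :=
  measurable_integral_id_kernel (lawHatKernel A i)

@[fun_prop]
theorem measurable_varHatXAt (i : Fin n) : Measurable fun d => varHatXAt A d i :=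
  measurable_variance_id_kernel (lawHatKernel A i)

@[fun_prop]
theorem measurable_muHatYAt (i : Fin n) : Measurable fun d => muHatYAt A d i :=
  A.measurable_muHatY.comp (by fun_prop)

theorem varHatXAt_nonneg (d : Sample n p) (i : Fin n) : 0 ≤ varHatXAt A d i := variance_nonneg _ _

/-- The resampled predictors as a kernel in the data. -/
noncomputable def resampleKernel : Kernel (Sample n p) (Fin n → ℝ) where
  toFun d := Measure.pi (lawHatAt A d)
  measurable' := measurable_measure_pi fun i => (lawHatKernel A i).measurable

instance : IsMarkovKernel (resampleKernel A) :=
  ⟨fun d => inferInstanceAs (IsProbabilityMeasure (Measure.pi (lawHatAt A d)))⟩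

theorem measurable_resampledStat :
    Measurable fun w : Sample n p × (Fin n → ℝ) => resampledStat A w.2 w.1 := by
  have h1 : ∀ i, Measurable fun w : Sample n p × (Fin n → ℝ) => muHatXAt A w.1 i := fun i =>
    (measurable_muHatXAt A i).comp measurable_fst
  have h2 : ∀ i, Measurable fun w : Sample n p × (Fin n → ℝ) => muHatYAt A w.1 i := fun i =>
    (measurable_muHatYAt A i).comp measurable_fst
  have h3 : ∀ i, Measurable fun w : Sample n p × (Fin n → ℝ) => w.1.ys i := fun i =>
    (measurable_ys_apply i).comp measurable_fst
  unfold resampledStat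
  fun_prop

instance (d : Sample n p) : IsProbabilityMeasure (resamplingLaw A d) :=
  Measure.isProbabilityMeasure_map
    ((measurable_resampledStat A).comp measurable_prodMk_left).aemeasurable

theorem resamplingLaw_Iic (d : Sample n p) (t : ℝ) :
    resamplingLaw A d (Set.Iic t) = Measure.pi (lawHatAt A d) {xt | resampledStat A xt d ≤ t} :=
  Measure.map_apply ((measurable_resampledStat A).comp measurable_prodMk_left) measurableSet_Iic

theorem measurable_resamplingLaw_Iic (t : ℝ) :
    Measurable fun d => (resamplingLaw A d).real (Set.Iic t) := by
  have h := Kernel.measurable_kernel_prodMk_left (κ := resampleKernel A)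
    (t := {w : Sample n p × (Fin n → ℝ) | resampledStat A w.2 w.1 ≤ t})
    (measurableSet_le (measurable_resampledStat A) measurable_const)
  refine Measurable.ennreal_toReal ?_
  convert h using 2 with d
  exact resamplingLaw_Iic A d t

@[fun_prop]
theorem measurable_dcrtStat : Measurable (dcrtStat A) :=
  (measurable_resampledStat A).comp (measurable_id.prodMk measurable_xs)

theorem measurable_dcrtTest {α : ℝ} (hα0 : 0 < α) (hα1 : α < 1) : Measurable (dcrtTest A α) := by
  have hq : Measurable fun d => quantile (resamplingLaw A d) (1 - α) := by
    refine measurable_of_Iic fun t => ?_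
    have : (fun d => quantile (resamplingLaw A d) (1 - α)) ⁻¹' Set.Iic t =
        {d | 1 - α ≤ (resamplingLaw A d).real (Set.Iic t)} := by
      ext d
      exact quantile_le_iff _ (by linarith) (by linarith) t
    rw [this]
    exact measurableSet_le measurable_const (measurable_resamplingLaw_Iic A t)
  exact Measurable.ite (measurableSet_lt hq (measurable_dcrtStat A)) measurable_const
    measurable_const

@[fun_prop]
theorem measurable_residProd (i : Fin n) : Measurable fun d => residProd A d i := by
  unfold residProd; fun_prop

@[fun_prop]
theorem measurable_gcmVar : Measurable (gcmVar A) := by unfold gcmVar; fun_prop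

theorem measurable_gcmTest (α : ℝ) : Measurable (gcmTest A α) := by
  have h : Measurable (gcmStat A) := by unfold gcmStat; fun_prop
  exact Measurable.ite (measurableSet_lt measurable_const h) measurable_const measurable_const

end Learner

/-- Young's inequality `2 |a e| ≤ θ a² + θ⁻¹ e²`, summed: an `ℓ²`-small perturbation of a vector of
bounded norm does not move its squared norm. The centering only has to be bounded above. -/
theorem TendstoZeroInProb.sum_sq_perturb {Ω : ℕ → Type} [∀ n, MeasurableSpace (Ω n)]
    {P : ∀ n, Measure (Ω n)} {u r : ∀ n, Ω n → Fin n → ℝ} {s : ℕ → ℝ}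
    {C : ℝ} (hC : 0 ≤ C) (hs : ∀ n, 1 ≤ n → s n ≤ C)
    (hu : TendstoZeroInProb P fun n d => ∑ i, u n d i ^ 2 - s n)
    (hr : TendstoZeroInProb P fun n d => ∑ i, (r n d i - u n d i) ^ 2) :
    TendstoZeroInProb P fun n d => ∑ i, r n d i ^ 2 - s n := by
  refine hu.comp₂ hr fun ε hε => ?_
  -- Chosen so that `θ (C + 1) = ε / 4`. The remaining three error terms each get less than `ε / 4`.
  set θ : ℝ := ε / (4 * (C + 1)) with hθ
  have hθ0 : 0 < θ := by positivity
  refine ⟨min (min 1 (ε / 4)) (min (ε / 4) (θ * (ε / 4))), by positivity, ?_⟩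
  filter_upwards [eventually_ge_atTop 1] with n hn
  refine ae_of_all _ fun d h1 h2 => ?_
  set U := ∑ i, u n d i ^ 2
  set V := ∑ i, (r n d i - u n d i) ^ 2
  have hV0 : 0 ≤ V := Finset.sum_nonneg fun i _ => sq_nonneg _
  rw [abs_of_nonneg hV0] at h2
  have k1 : |U - s n| < 1 := h1.trans_le ((min_le_left _ _).trans (min_le_left _ _))
  have k2 : |U - s n| < ε / 4 := h1.trans_le ((min_le_left _ _).trans (min_le_right _ _))
  have k3 : V < ε / 4 := h2.trans_le ((min_le_right _ _).trans (min_le_left _ _))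
  have k4 : V < θ * (ε / 4) := h2.trans_le ((min_le_right _ _).trans (min_le_right _ _))
  have hUC : U ≤ C + 1 := by have := (abs_lt.1 k1).2; linarith [hs n hn]
  have hmain : |∑ i, r n d i ^ 2 - U| ≤ θ * U + θ⁻¹ * V + V := by
    rw [← Finset.sum_sub_distrib]
    refine (Finset.abs_sum_le_sum_abs _ _).trans ?_
    rw [Finset.mul_sum, Finset.mul_sum, ← Finset.sum_add_distrib, ← Finset.sum_add_distrib]
    refine Finset.sum_le_sum fun i _ => ?_
    set a := u n d i
    set e := r n d i - u n d i with he
    have e1 : r n d i ^ 2 - a ^ 2 = 2 * a * e + e ^ 2 := by rw [he]; ring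
    rw [e1]
    have hsq : |2 * a * e| ≤ θ * a ^ 2 + θ⁻¹ * e ^ 2 := by
      have h3 : θ * a ^ 2 + θ⁻¹ * e ^ 2 - 2 * a * e = θ⁻¹ * (θ * a - e) ^ 2 := by
        field_simp
        ring
      have h4 : θ * a ^ 2 + θ⁻¹ * e ^ 2 + 2 * a * e = θ⁻¹ * (θ * a + e) ^ 2 := by
        field_simp
        ring
      have h5 : 0 ≤ θ⁻¹ * (θ * a - e) ^ 2 := by positivity
      have h6 : 0 ≤ θ⁻¹ * (θ * a + e) ^ 2 := by positivity
      exact abs_le.2 ⟨by linarith, by linarith⟩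
    refine (abs_add_le _ _).trans ?_
    rw [abs_of_nonneg (sq_nonneg e)]
    linarith
  have m1 : θ * U ≤ ε / 4 := by
    calc θ * U ≤ θ * (C + 1) := mul_le_mul_of_nonneg_left hUC hθ0.le
      _ = ε / 4 := by rw [hθ]; field_simp
  have m2 : θ⁻¹ * V < ε / 4 := by
    rw [inv_mul_eq_div, div_lt_iff₀ hθ0]
    linarith
  have : ∑ i, r n d i ^ 2 - s n = (∑ i, r n d i ^ 2 - U) + (U - s n) := by ring
  rw [this]
  refine (abs_add_le _ _).trans_lt ?_
  linarith

/-! ### Weak law of large numbers for the rows of a triangular array -/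

section WeakLaw

variable {p : ℕ → ℕ} {L : ∀ n, Measure (Obs (p n))} [∀ n, IsProbabilityMeasure (L n)]

theorem sqrt_mul_sq_div_le {e C : ℝ} (he : 0 < e) (hC : 0 ≤ C) :
    √(e ^ 2 / (C + 1) * C) ≤ e := by
  rw [← Real.sqrt_sq he.le]
  refine Real.sqrt_le_sqrt ?_
  rw [Real.sqrt_sq he.le, div_mul_eq_mul_div, div_le_iff₀ (by linarith)]
  nlinarith [sq_nonneg e]

/-- Moments of order `1 + η` suffice, by truncating `h` at `κ n`. The law may change with `n`,
provided the bounds are uniform. -/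
theorem weak_law {h : ∀ n, Obs (p n) → ℝ} (hm : ∀ n, Measurable (h n)) (h0 : ∀ n o, 0 ≤ h n o)
    {C M η : ℝ} (hη : 0 < η) (hC : 0 ≤ C) (hM : 0 ≤ M)
    (hi : ∀ n, 1 ≤ n → Integrable (h n) (L n)) (hle : ∀ n, 1 ≤ n → ∫ o, h n o ∂L n ≤ C)
    (hmom : ∀ n, 1 ≤ n → ∫⁻ o, ENNReal.ofReal (h n o) ^ (1 + η) ∂L n ≤ ENNReal.ofReal M) :
    TendstoZeroInProb (fun n => sampleLaw n (L n)) fun n d =>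
      ∑ i, 1 / (n : ℝ) * h n (d i) - ∫ o, h n o ∂L n := by
  refine TendstoZeroInProb.of_lintegral (Eventually.of_forall fun n => ?_) ?_
  · have := hm n
    fun_prop
  have hbound : ∀ κ : ℝ, 0 < κ → ∀ n : ℕ, 1 ≤ n →
      ∫⁻ d, ‖∑ i, 1 / (n : ℝ) * h n (d i) - ∫ o, h n o ∂L n‖ₑ ∂sampleLaw n (L n) ≤
        ENNReal.ofReal (2 * κ ^ (-η) * M * (n : ℝ) ^ (-η) + √(κ * C)) := by
    intro κ hκ n hn
    have hn0 : (0 : ℝ) < n := by exact_mod_cast hn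
    have hsum : ∑ _i : Fin n, ∫ o, 1 / (n : ℝ) * h n o ∂L n = ∫ o, h n o ∂L n := by
      rw [integral_const_mul, Finset.sum_const, Finset.card_univ, Fintype.card_fin, nsmul_eq_mul]
      field_simp
    have key := lintegral_enorm_sum_sub_le (μ := fun _ : Fin n => L n)
      (f := fun _ o => 1 / (n : ℝ) * h n o) (fun _ => (hm n).const_mul _)
      (fun _ o => mul_nonneg (by positivity) (h0 n o)) (fun _ => (hi n hn).const_mul _) hκ hη.le
    rw [hsum] at key
    refine key.trans ?_
    have hterm : ∫⁻ o, ENNReal.ofReal (1 / (n : ℝ) * h n o) ^ (1 + η) ∂L n ≤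
        ENNReal.ofReal ((1 / (n : ℝ)) ^ (1 + η) * M) := by
      have e : ∀ o, ENNReal.ofReal (1 / (n : ℝ) * h n o) ^ (1 + η) =
          ENNReal.ofReal ((1 / (n : ℝ)) ^ (1 + η)) * ENNReal.ofReal (h n o) ^ (1 + η) := by
        intro o
        rw [ENNReal.ofReal_mul (by positivity), ENNReal.mul_rpow_of_nonneg _ _ (by linarith),
          ENNReal.ofReal_rpow_of_pos (by positivity)]
      simp_rw [e]
      have := hm n
      rw [lintegral_const_mul _ (by fun_prop), ENNReal.ofReal_mul (by positivity)]
      gcongr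
      exact hmom n hn
    have hsum2 : ∑ _i : Fin n, ∫⁻ o, ENNReal.ofReal (1 / (n : ℝ) * h n o) ^ (1 + η) ∂L n ≤
        ENNReal.ofReal ((n : ℝ) ^ (-η) * M) := by
      rw [Finset.sum_const, Finset.card_univ, Fintype.card_fin, nsmul_eq_mul]
      refine (mul_le_mul_right hterm _).trans_eq ?_
      rw [← ENNReal.ofReal_natCast, ← ENNReal.ofReal_mul hn0.le]
      congr 1
      rw [one_div, Real.inv_rpow hn0.le, Real.rpow_add hn0, Real.rpow_one, Real.rpow_neg hn0.le]
      field_simp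
    rw [ENNReal.ofReal_add (by positivity) (Real.sqrt_nonneg _)]
    refine add_le_add ?_ (ENNReal.ofReal_le_ofReal (Real.sqrt_le_sqrt
      (mul_le_mul_of_nonneg_left (hle n hn) hκ.le)))
    refine (mul_le_mul_right (mul_le_mul_right hsum2 _) _).trans_eq ?_
    rw [← ENNReal.ofReal_mul (by positivity), ← ENNReal.ofReal_ofNat,
      ← ENNReal.ofReal_mul (by norm_num)]
    congr 1
    ring
  rw [ENNReal.tendsto_nhds_zero]
  intro ε hε
  obtain ⟨e, -, he⟩ := ENNReal.lt_iff_exists_real_btwn.1 hε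
  have he0 : 0 < e := ENNReal.ofReal_pos.1 he.1
  -- First `κ` makes the truncated part at most `e / 2` for every `n`; then `n` is taken large to
  -- control the tails. The `+ 1` avoids dividing by zero.
  set κ : ℝ := (e / 2) ^ 2 / (C + 1) with hκ
  have hκ0 : 0 < κ := by positivity
  have hlim : Tendsto (fun n : ℕ => 2 * κ ^ (-η) * M * (n : ℝ) ^ (-η)) atTop (𝓝 0) := by
    have := ((tendsto_rpow_neg_atTop hη).comp tendsto_natCast_atTop_atTop).const_mul
      (2 * κ ^ (-η) * M)
    simpa using this
  filter_upwards [hlim.eventually_le_const (half_pos he0), eventually_ge_atTop 1] with n h1 h2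
  refine (hbound κ hκ0 n h2).trans ((ENNReal.ofReal_le_ofReal ?_).trans he.2.le)
  have := sqrt_mul_sq_div_le (half_pos he0) hC
  rw [← hκ] at this
  linarith

end WeakLaw

/-! ### Moments of the product of the true residuals -/

/-- The second moment of the product of the true residuals. -/
noncomputable def noiseVar {p : ℕ} (L : Measure (Obs p)) [IsFiniteMeasure L] : ℝ :=
  ∫ o, ((o.x - muX L o.z) * (o.y - muY L o.z)) ^ 2 ∂L

theorem noiseVar_nonneg {p : ℕ} (L : Measure (Obs p)) [IsFiniteMeasure L] : 0 ≤ noiseVar L :=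
  integral_nonneg fun _ => sq_nonneg _

theorem BoundedMoments.exists_bounds {p : ℕ → ℕ} {L : ∀ n, Measure (Obs (p n))}
    [∀ n, IsProbabilityMeasure (L n)] (h : BoundedMoments L) :
    ∃ c C M δ : ℝ, 0 < c ∧ 0 < C ∧ 0 < M ∧ 0 < δ ∧ ∀ n, 1 ≤ n →
      MemLp (noiseProd (L n)) 2 (L n) ∧ c ≤ noiseVar (L n) ∧ noiseVar (L n) ≤ C ∧
      ∫⁻ o, ‖noiseProd (L n) o‖ₑ ^ (2 + δ) ∂L n ≤ ENNReal.ofReal M := by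
  obtain ⟨c₁, c₂, δ, hc1, hc2, hδ, H⟩ := h
  -- The upper bound `1 + c₂` comes from `x² ≤ 1 + |x|^{2+δ}`.
  refine ⟨c₁, 1 + c₂, c₂, δ, hc1, by linarith, hc2, hδ, fun n hn => ?_⟩
  have h1 : ENNReal.ofReal c₁ < ∫⁻ o, ‖noiseProd (L n) o‖ₑ ^ (2 : ℝ) ∂L n := (H n hn).1
  have h2 : ∫⁻ o, ‖noiseProd (L n) o‖ₑ ^ (2 + δ) ∂L n < ENNReal.ofReal c₂ := (H n hn).2
  have hle : ∫⁻ o, ‖noiseProd (L n) o‖ₑ ^ (2 : ℝ) ∂L n ≤ ENNReal.ofReal (1 + c₂) := by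
    have hpt : ∀ o, ‖noiseProd (L n) o‖ₑ ^ (2 : ℝ) ≤ 1 + ‖noiseProd (L n) o‖ₑ ^ (2 + δ) := by
      intro o
      rcases le_total ‖noiseProd (L n) o‖ₑ 1 with h | h
      · exact (ENNReal.rpow_le_one h (by norm_num)).trans le_self_add
      · exact (ENNReal.rpow_le_rpow_of_exponent_le h (by linarith)).trans le_add_self
    refine (lintegral_mono hpt).trans ?_
    rw [lintegral_add_left measurable_const, ENNReal.ofReal_add zero_le_one hc2.le]
    simpa using h2.le
  have hmem : MemLp (noiseProd (L n)) 2 (L n) := by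
    refine ⟨(measurable_noiseProd (L n)).aestronglyMeasurable, ?_⟩
    rw [eLpNorm_lt_top_iff_lintegral_rpow_enorm_lt_top (by norm_num) (by norm_num)]
    simpa using hle.trans_lt ENNReal.ofReal_lt_top
  have heq : ENNReal.ofReal (noiseVar (L n)) = ∫⁻ o, ‖noiseProd (L n) o‖ₑ ^ (2 : ℝ) ∂L n := by
    simp_rw [enorm_sq_eq_ofReal]
    exact ofReal_integral_eq_lintegral_ofReal hmem.integrable_sq (ae_of_all _ fun _ => sq_nonneg _)
  rw [← heq] at h1 hle
  exact ⟨hmem, ((ENNReal.ofReal_lt_ofReal_iff_of_nonneg hc1.le).1 h1).le,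
    (ENNReal.ofReal_le_ofReal_iff (by linarith)).1 hle, h2.le⟩

/-! ### Residuals and estimation errors in the sample -/

section Residuals

variable {n p : ℕ} (A : Learner n p) (L : Measure (Obs p)) [IsProbabilityMeasure L]

/-- The true residual `X_i - μ_x(Z_i)`. -/
noncomputable def noiseX (d : Sample n p) (i : Fin n) : ℝ := d.xs i - muX L (d.zs i)

/-- The true residual `Y_i - μ_y(Z_i)`. -/
noncomputable def noiseY (d : Sample n p) (i : Fin n) : ℝ := d.ys i - muY L (d.zs i)

/-- The estimation error `μ̂_x(Z_i) - μ_x(Z_i)`. -/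
noncomputable def devX (d : Sample n p) (i : Fin n) : ℝ := muHatXAt A d i - muX L (d.zs i)

/-- The estimation error `μ̂_y(Z_i) - μ_y(Z_i)`. -/
noncomputable def devY (d : Sample n p) (i : Fin n) : ℝ := muHatYAt A d i - muY L (d.zs i)

@[fun_prop]
theorem measurable_noiseX (i : Fin n) : Measurable fun d : Sample n p => noiseX L d i := by
  unfold noiseX
  exact (measurable_xs_apply i).sub ((measurable_muX L).comp (measurable_zs_apply i))

@[fun_prop]
theorem measurable_noiseY (i : Fin n) : Measurable fun d : Sample n p => noiseY L d i := by
  unfold noiseY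
  exact (measurable_ys_apply i).sub ((measurable_muY L).comp (measurable_zs_apply i))

@[fun_prop]
theorem measurable_devX (i : Fin n) : Measurable fun d : Sample n p => devX A L d i := by
  unfold devX
  exact (measurable_muHatXAt A i).sub ((measurable_muX L).comp (measurable_zs_apply i))

@[fun_prop]
theorem measurable_devY (i : Fin n) : Measurable fun d : Sample n p => devY A L d i := by
  unfold devY
  exact (measurable_muHatYAt A i).sub ((measurable_muY L).comp (measurable_zs_apply i))

theorem residProd_eq (d : Sample n p) (i : Fin n) :
    residProd A d i = (noiseX L d i - devX A L d i) * (noiseY L d i - devY A L d i) := by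
  simp only [residProd, noiseX, devX, noiseY, devY]
  ring

theorem one_div_sqrt_mul_sq (n : ℕ) (a : ℝ) : (1 / √(n : ℝ) * a) ^ 2 = 1 / (n : ℝ) * a ^ 2 := by
  rw [mul_pow, div_pow, one_pow, Real.sq_sqrt (Nat.cast_nonneg n)]

theorem sq_sqrt_mean {f : Fin n → ℝ} (hf : ∀ i, 0 ≤ f i) :
    √(1 / (n : ℝ) * ∑ i, f i) ^ 2 = 1 / (n : ℝ) * ∑ i, f i :=
  Real.sq_sqrt (mul_nonneg (by positivity) (Finset.sum_nonneg fun i _ => hf i))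

theorem errX'_sq (d : Sample n p) :
    errX' A L d ^ 2 = ∑ i, (1 / √(n : ℝ) * devX A L d i) ^ 2 * varY L (d.zs i) := by
  rw [errX', sq_sqrt_mean fun i => mul_nonneg (sq_nonneg _) (varY_nonneg L _), Finset.mul_sum]
  exact Finset.sum_congr rfl fun i _ => by rw [one_div_sqrt_mul_sq, devX]; ring

theorem errY'_sq (d : Sample n p) :
    errY' A L d ^ 2 = ∑ i, (1 / √(n : ℝ) * devY A L d i) ^ 2 * varX L (d.zs i) := by
  rw [errY', sq_sqrt_mean fun i => mul_nonneg (sq_nonneg _) (varX_nonneg L _), Finset.mul_sum]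
  exact Finset.sum_congr rfl fun i _ => by rw [one_div_sqrt_mul_sq, devY]; ring

theorem errHatY'_sq (d : Sample n p) :
    errHatY' A L d ^ 2 = ∑ i, (1 / √(n : ℝ) * devY A L d i) ^ 2 * varHatXAt A d i := by
  rw [errHatY', sq_sqrt_mean fun i => mul_nonneg (sq_nonneg _) (varHatXAt_nonneg A d i),
    Finset.mul_sum]
  exact Finset.sum_congr rfl fun i _ => by rw [one_div_sqrt_mul_sq, devY]; ring

theorem sqrt_mul_errX_mul_errY (d : Sample n p) :
    √(n : ℝ) * (errX A L d * errY A L d) =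
      1 / √(n : ℝ) * (√(∑ i, devX A L d i ^ 2) * √(∑ i, devY A L d i ^ 2)) := by
  simp only [errX, errY, devX, devY]
  rcases Nat.eq_zero_or_pos n with rfl | hn
  · simp
  have hn0 : (0 : ℝ) < n := by exact_mod_cast hn
  rw [Real.sqrt_mul (by positivity), Real.sqrt_mul (by positivity), Real.sqrt_div zero_le_one,
    Real.sqrt_one]
  have : √(n : ℝ) ≠ 0 := (Real.sqrt_pos.2 hn0).ne'
  field_simp

end Residuals

/-! ### Asymptotics of the test statistic and of the empirical variance -/

section Asymptotics

variable {p : ℕ → ℕ} {A : ∀ n, Learner n (p n)} {L : ∀ n, Measure (Obs (p n))}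
  [∀ n, IsProbabilityMeasure (L n)]

theorem ae_memLp_lawYZ (hvar : ∀ n, 1 ≤ n → HasCondVariances (L n)) :
    ∀ᶠ n in atTop, ∀ᵐ d ∂sampleLaw n (L n), ∀ i, MemLp id 2 (lawYZ (L n) (d.zs i)) := by
  filter_upwards [eventually_ge_atTop 1] with n hn
  exact ae_sampleLaw_of_ae_lawZ (L n) ((hvar n hn).mono fun _ hz => hz.2)

theorem ae_memLp_lawXZ (hvar : ∀ n, 1 ≤ n → HasCondVariances (L n)) :
    ∀ᶠ n in atTop, ∀ᵐ d ∂sampleLaw n (L n), ∀ i, MemLp id 2 (lawXZ (L n) (d.zs i)) := by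
  filter_upwards [eventually_ge_atTop 1] with n hn
  exact ae_sampleLaw_of_ae_lawZ (L n) ((hvar n hn).mono fun _ hz => hz.1)

theorem ae_memLp_lawHatAt (hNDG : Nondegenerate A L) :
    ∀ᶠ n in atTop, ∀ᵐ d ∂sampleLaw n (L n), ∀ i, MemLp id 2 (lawHatAt (A n) d i) := by
  filter_upwards [eventually_ge_atTop 1] with n hn
  filter_upwards [hNDG n hn] with d hd i
  exact (evariance_lt_top_iff_memLp aestronglyMeasurable_id).1 (hd i).1.2

/-! ### The cross terms between residuals and estimation errors -/

/-- Given `X` and `Z`, the errors of `μ̂_x` are constants and the true residuals of `Y` are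
independent and centered, so the conditional second moment is exactly `errX'` squared. -/
theorem tendsto_sum_devX_mul_noiseY (hnull : ∀ n, 1 ≤ n → IsNull (L n))
    (hvar : ∀ n, 1 ≤ n → HasCondVariances (L n))
    (hE : TendstoZeroInProb (fun n => sampleLaw n (L n)) fun n d => errX' (A n) (L n) d) :
    TendstoZeroInProb (fun n => sampleLaw n (L n)) fun n d =>
      ∑ i, 1 / √(n : ℝ) * devX (A n) (L n) d i * noiseY (L n) d i := by
  refine TendstoZeroInProb.of_sq (TendstoZeroInProb.of_redrawY hnull (fun n => by fun_prop)
    (TendstoZeroInProbENN.of_le_ofReal hE.sq ?_))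
  filter_upwards [ae_memLp_lawYZ hvar] with n hn
  filter_upwards [hn] with d hd
  rw [errX'_sq]
  exact (lintegral_sq_linear_pi hd fun i => 1 / √(n : ℝ) * devX (A n) (L n) d i).le

theorem tendsto_sum_devY_mul_noiseX (hnull : ∀ n, 1 ≤ n → IsNull (L n))
    (hvar : ∀ n, 1 ≤ n → HasCondVariances (L n))
    (hE : TendstoZeroInProb (fun n => sampleLaw n (L n)) fun n d => errY' (A n) (L n) d) :
    TendstoZeroInProb (fun n => sampleLaw n (L n)) fun n d =>
      ∑ i, 1 / √(n : ℝ) * devY (A n) (L n) d i * noiseX (L n) d i := by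
  refine TendstoZeroInProb.of_sq (TendstoZeroInProb.of_redrawX hnull (fun n => by fun_prop)
    (TendstoZeroInProbENN.of_le_ofReal hE.sq ?_))
  filter_upwards [ae_memLp_lawXZ hvar] with n hn
  filter_upwards [hn] with d hd
  rw [errY'_sq]
  exact (lintegral_sq_linear_pi hd fun i => 1 / √(n : ℝ) * devY (A n) (L n) d i).le

theorem tendsto_sum_sq_devX_mul_noiseY (hnull : ∀ n, 1 ≤ n → IsNull (L n))
    (hvar : ∀ n, 1 ≤ n → HasCondVariances (L n))
    (hE : TendstoZeroInProb (fun n => sampleLaw n (L n)) fun n d => errX' (A n) (L n) d) :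
    TendstoZeroInProb (fun n => sampleLaw n (L n)) fun n d =>
      ∑ i, (1 / √(n : ℝ) * devX (A n) (L n) d i * noiseY (L n) d i) ^ 2 := by
  refine TendstoZeroInProb.of_redrawY hnull (fun n => by fun_prop)
    (TendstoZeroInProbENN.of_le_ofReal hE.sq ?_)
  filter_upwards [ae_memLp_lawYZ hvar] with n hn
  filter_upwards [hn] with d hd
  rw [errX'_sq]
  exact (lintegral_sum_sq_pi hd fun i => 1 / √(n : ℝ) * devX (A n) (L n) d i).le

theorem tendsto_sum_sq_devY_mul_noiseX (hnull : ∀ n, 1 ≤ n → IsNull (L n))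
    (hvar : ∀ n, 1 ≤ n → HasCondVariances (L n))
    (hE : TendstoZeroInProb (fun n => sampleLaw n (L n)) fun n d => errY' (A n) (L n) d) :
    TendstoZeroInProb (fun n => sampleLaw n (L n)) fun n d =>
      ∑ i, (1 / √(n : ℝ) * devY (A n) (L n) d i * noiseX (L n) d i) ^ 2 := by
  refine TendstoZeroInProb.of_redrawX hnull (fun n => by fun_prop)
    (TendstoZeroInProbENN.of_le_ofReal hE.sq ?_)
  filter_upwards [ae_memLp_lawXZ hvar] with n hn
  filter_upwards [hn] with d hd
  rw [errY'_sq]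
  exact (lintegral_sum_sq_pi hd fun i => 1 / √(n : ℝ) * devY (A n) (L n) d i).le

/-- Cauchy–Schwarz. This is the only term that uses the product rate of the two regressions in full.
-/
theorem tendsto_sum_devX_mul_devY
    (hE : TendstoZeroInProb (fun n => sampleLaw n (L n))
      fun n d => √(n : ℝ) * (errX (A n) (L n) d * errY (A n) (L n) d)) :
    TendstoZeroInProb (fun n => sampleLaw n (L n)) fun n d =>
      ∑ i, 1 / √(n : ℝ) * (devX (A n) (L n) d i * devY (A n) (L n) d i) := by
  refine hE.of_abs_le (Eventually.of_forall fun n => ae_of_all _ fun d => ?_)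
  rw [sqrt_mul_errX_mul_errY, ← Finset.mul_sum, abs_mul, abs_mul]
  refine mul_le_mul_of_nonneg_left ?_ (abs_nonneg _)
  rw [abs_of_nonneg (show 0 ≤ √(∑ i, devX (A n) (L n) d i ^ 2) * √(∑ i, devY (A n) (L n) d i ^ 2)
    by positivity), ← Real.sqrt_mul (Finset.sum_nonneg fun i _ => sq_nonneg _)]
  exact Real.abs_le_sqrt (Finset.sum_mul_sq_le_sq_mul_sq _ _ _)

theorem tendsto_sum_sq_devX_mul_devY
    (hE : TendstoZeroInProb (fun n => sampleLaw n (L n))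
      fun n d => √(n : ℝ) * (errX (A n) (L n) d * errY (A n) (L n) d)) :
    TendstoZeroInProb (fun n => sampleLaw n (L n)) fun n d =>
      ∑ i, (1 / √(n : ℝ) * (devX (A n) (L n) d i * devY (A n) (L n) d i)) ^ 2 := by
  refine hE.sq.of_abs_le (Eventually.of_forall fun n => ae_of_all _ fun d => ?_)
  rw [sqrt_mul_errX_mul_errY, abs_of_nonneg (Finset.sum_nonneg fun i _ => sq_nonneg _),
    abs_of_nonneg (sq_nonneg _), mul_pow, mul_pow,
    Real.sq_sqrt (Finset.sum_nonneg fun i _ => sq_nonneg _),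
    Real.sq_sqrt (Finset.sum_nonneg fun i _ => sq_nonneg _)]
  simp_rw [mul_pow]
  rw [← Finset.mul_sum, Finset.sum_mul]
  refine mul_le_mul_of_nonneg_left (Finset.sum_le_sum fun i hi => ?_) (sq_nonneg _)
  exact mul_le_mul_of_nonneg_left
    (Finset.single_le_sum (f := fun i => devY (A n) (L n) d i ^ 2) (fun i _ => sq_nonneg _) hi)
    (sq_nonneg _)

/-- The test statistic is asymptotically the normalized sum of the products of true residuals. -/
theorem tendsto_dcrtStat_sub (hnull : ∀ n, 1 ≤ n → IsNull (L n))
    (hvar : ∀ n, 1 ≤ n → HasCondVariances (L n)) (hSP1 : SmallErrors A L) :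
    TendstoZeroInProb (fun n => sampleLaw n (L n)) fun n d =>
      dcrtStat (A n) d - ∑ i, 1 / √(n : ℝ) * noiseProd (L n) (d i) := by
  have h := ((tendsto_sum_devX_mul_devY hSP1.1).sub
    (tendsto_sum_devX_mul_noiseY hnull hvar hSP1.2.1)).sub
    (tendsto_sum_devY_mul_noiseX hnull hvar hSP1.2.2.1)
  refine h.congr (Eventually.of_forall fun n => ae_of_all _ fun d => ?_)
  have e : dcrtStat (A n) d = ∑ i, 1 / √(n : ℝ) * residProd (A n) d i := Finset.mul_sum _ _ _
  rw [e, ← Finset.sum_sub_distrib, ← Finset.sum_sub_distrib, ← Finset.sum_sub_distrib]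
  refine Finset.sum_congr rfl fun i _ => ?_
  have e2 : noiseProd (L n) (d i) = noiseX (L n) d i * noiseY (L n) d i := rfl
  rw [residProd_eq (A n) (L n), e2]
  ring

/-! ### Consistency of the variance estimates -/

theorem weak_law_noiseProd_sq (hSP2 : BoundedMoments L) :
    TendstoZeroInProb (fun n => sampleLaw n (L n)) fun n d =>
      ∑ i, (1 / √(n : ℝ) * noiseProd (L n) (d i)) ^ 2 - noiseVar (L n) := by
  obtain ⟨c, C, M, δ, -, hC, hM, hδ, H⟩ := hSP2.exists_bounds
  have h := weak_law (L := L) (h := fun n o => noiseProd (L n) o ^ 2) (fun n => by fun_prop)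
    (fun n o => sq_nonneg _) (η := δ / 2) (by positivity) hC.le hM.le
    (fun n hn => (H n hn).1.integrable_sq) (fun n hn => (H n hn).2.2.1) fun n hn => ?_
  · refine h.congr (Eventually.of_forall fun n => ae_of_all _ fun d => ?_)
    congr 1
    exact Finset.sum_congr rfl fun i _ => one_div_sqrt_mul_sq n _
  · refine le_of_eq_of_le (lintegral_congr fun o => ?_) (H n hn).2.2.2
    rw [← enorm_sq_eq_ofReal, ← ENNReal.rpow_mul]
    congr 1
    ring

/-- The mean of the summands is `noiseVar` by conditional independence, and their moments of order
`1 + δ / 2` are bounded by conditional Jensen. -/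
theorem weak_law_varX_mul_varY (hnull : ∀ n, 1 ≤ n → IsNull (L n))
    (hvar : ∀ n, 1 ≤ n → HasCondVariances (L n)) (hSP2 : BoundedMoments L) :
    TendstoZeroInProb (fun n => sampleLaw n (L n)) fun n d =>
      ∑ i, 1 / (n : ℝ) * (varX (L n) (d.zs i) * varY (L n) (d.zs i)) - noiseVar (L n) := by
  obtain ⟨c, C, M, δ, -, hC, hM, hδ, H⟩ := hSP2.exists_bounds
  have hm : ∀ n, Measurable fun o : Obs (p n) => varX (L n) o.z * varY (L n) o.z := fun n => by
    fun_prop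
  have h0 : ∀ n (o : Obs (p n)), 0 ≤ varX (L n) o.z * varY (L n) o.z := fun n o =>
    mul_nonneg (varX_nonneg _ _) (varY_nonneg _ _)
  have heq : ∀ n, 1 ≤ n → ∫⁻ o, ENNReal.ofReal (varX (L n) o.z * varY (L n) o.z) ∂L n =
      ENNReal.ofReal (noiseVar (L n)) := fun n hn => by
    rw [← lintegral_noiseProd_sq (hnull n hn) (hvar n hn)]
    simp_rw [enorm_sq_eq_ofReal]
    exact (ofReal_integral_eq_lintegral_ofReal (H n hn).1.integrable_sq
      (ae_of_all _ fun _ => sq_nonneg _)).symm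
  have hi : ∀ n, 1 ≤ n → Integrable (fun o : Obs (p n) => varX (L n) o.z * varY (L n) o.z) (L n) :=
    fun n hn => by
      refine (lintegral_ofReal_ne_top_iff_integrable (hm n).aestronglyMeasurable
        (ae_of_all _ (h0 n))).1 ?_
      rw [heq n hn]
      exact ENNReal.ofReal_ne_top
  have hint : ∀ n, 1 ≤ n → ∫ o, varX (L n) o.z * varY (L n) o.z ∂L n = noiseVar (L n) :=
    fun n hn => by
      rw [integral_eq_lintegral_of_nonneg_ae (ae_of_all _ (h0 n)) (hm n).aestronglyMeasurable,
        heq n hn, ENNReal.toReal_ofReal (noiseVar_nonneg _)]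
  have h := weak_law (L := L) hm h0 (η := δ / 2) (by positivity) hC.le hM.le hi
    (fun n hn => by rw [hint n hn]; exact (H n hn).2.2.1)
    fun n hn => (lintegral_varX_mul_varY_rpow_le (hnull n hn) (hvar n hn) hδ.le).trans
      (H n hn).2.2.2
  refine h.congr ?_
  filter_upwards [eventually_ge_atTop 1] with n hn
  refine ae_of_all _ fun d => ?_
  rw [hint n hn]
  rfl

/-- The mean of squares is an `ℓ²` perturbation of the one with true residuals, which obeys the weak
law. The subtracted square of the mean is negligible. -/
theorem tendsto_gcmVar_sub (hnull : ∀ n, 1 ≤ n → IsNull (L n))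
    (hvar : ∀ n, 1 ≤ n → HasCondVariances (L n)) (hSP1 : SmallErrors A L)
    (hSP2 : BoundedMoments L) :
    TendstoZeroInProb (fun n => sampleLaw n (L n)) fun n d =>
      gcmVar (A n) d - noiseVar (L n) := by
  obtain ⟨c, C, M, δ, -, hC, hM, hδ, H⟩ := hSP2.exists_bounds
  have h1 : TendstoZeroInProb (fun n => sampleLaw n (L n)) fun n d =>
      ∑ i, (1 / √(n : ℝ) * residProd (A n) d i) ^ 2 - noiseVar (L n) := by
    refine TendstoZeroInProb.sum_sq_perturb hC.le (fun n hn => (H n hn).2.2.1)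
      (weak_law_noiseProd_sq hSP2) ?_
    have hs := ((tendsto_sum_sq_devX_mul_devY hSP1.1).add
      (tendsto_sum_sq_devX_mul_noiseY hnull hvar hSP1.2.1)).add
      (tendsto_sum_sq_devY_mul_noiseX hnull hvar hSP1.2.2.1)
    -- Three copies, because `(x - y - z)² ≤ 3 (x² + y² + z²)`.
    refine ((hs.add hs).add hs).of_abs_le (Eventually.of_forall fun n => ae_of_all _ fun d => ?_)
    rw [abs_of_nonneg (Finset.sum_nonneg fun i _ => sq_nonneg _)]
    refine le_trans ?_ (le_abs_self _)
    simp only [← Finset.sum_add_distrib]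
    refine Finset.sum_le_sum fun i _ => ?_
    have e2 : noiseProd (L n) (d i) = noiseX (L n) d i * noiseY (L n) d i := rfl
    rw [residProd_eq (A n) (L n), e2]
    set x := 1 / √(n : ℝ) * (devX (A n) (L n) d i * devY (A n) (L n) d i)
    set y := 1 / √(n : ℝ) * devX (A n) (L n) d i * noiseY (L n) d i
    set z := 1 / √(n : ℝ) * devY (A n) (L n) d i * noiseX (L n) d i
    have e3 : 1 / √(n : ℝ) * ((noiseX (L n) d i - devX (A n) (L n) d i) *
        (noiseY (L n) d i - devY (A n) (L n) d i)) -
        1 / √(n : ℝ) * (noiseX (L n) d i * noiseY (L n) d i) = x - y - z := by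
      simp only [x, y, z]
      ring
    rw [e3]
    nlinarith [sq_nonneg (x + y), sq_nonneg (x + z), sq_nonneg (y - z)]
  -- The mean of the true residual products has second moment `noiseVar / n ≤ C / n`.
  have h2 : TendstoZeroInProb (fun n => sampleLaw n (L n)) fun n d =>
      1 / √(n : ℝ) * ∑ i, 1 / √(n : ℝ) * noiseProd (L n) (d i) := by
    refine TendstoZeroInProb.of_sq (TendstoZeroInProb.of_lintegral
      (Eventually.of_forall fun n => by fun_prop) ?_)
    have hlim : Tendsto (fun n : ℕ => ENNReal.ofReal (C * (1 / (n : ℝ)))) atTop (𝓝 0) := by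
      have := (tendsto_one_div_atTop_nhds_zero_nat (𝕜 := ℝ)).const_mul C
      rw [mul_zero] at this
      simpa using ENNReal.tendsto_ofReal this
    refine tendsto_of_tendsto_of_tendsto_of_le_of_le' tendsto_const_nhds hlim
      (Eventually.of_forall fun _ => zero_le) ?_
    filter_upwards [eventually_ge_atTop 1] with n hn
    have hn0 : (0 : ℝ) < n := by exact_mod_cast hn
    obtain ⟨hmem, -, hle, -⟩ := H n hn
    have hg : ∀ _ : Fin n, MemLp (fun o => 1 / √(n : ℝ) * (1 / √(n : ℝ) * noiseProd (L n) o)) 2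
        (L n) := fun _ => (hmem.const_mul _).const_mul _
    have hz : ∀ _ : Fin n, ∫ o, 1 / √(n : ℝ) * (1 / √(n : ℝ) * noiseProd (L n) o) ∂L n = 0 :=
      fun _ => by
        rw [integral_const_mul, integral_const_mul,
          integral_noiseProd (hnull n hn) (hvar n hn) (hmem.integrable one_le_two)]
        simp
    have hsq := integral_sq_sum_pi (μ := fun _ : Fin n => L n) hg hz
    have hL2 : MemLp (fun d : Sample n (p n) =>
        ∑ i, 1 / √(n : ℝ) * (1 / √(n : ℝ) * noiseProd (L n) (d i))) 2 (sampleLaw n (L n)) :=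
      memLp_finsetSum _ fun i _ => memLp_comp_eval_pi (μ := fun _ : Fin n => L n) (i := i) (hg i)
    simp_rw [Finset.mul_sum]
    rw [lintegral_congr fun d => Real.enorm_of_nonneg (sq_nonneg _),
      ← ofReal_integral_eq_lintegral_ofReal hL2.integrable_sq (ae_of_all _ fun _ => sq_nonneg _)]
    refine ENNReal.ofReal_le_ofReal (hsq.le.trans ?_)
    simp_rw [one_div_sqrt_mul_sq]
    rw [integral_const_mul, integral_const_mul, Finset.sum_const, Finset.card_univ,
      Fintype.card_fin, nsmul_eq_mul]
    change (n : ℝ) * (1 / (n : ℝ) * (1 / (n : ℝ) * noiseVar (L n))) ≤ C * (1 / (n : ℝ))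
    have : (n : ℝ) * (1 / (n : ℝ) * (1 / (n : ℝ) * noiseVar (L n))) =
        noiseVar (L n) * (1 / (n : ℝ)) := by field_simp
    rw [this]
    exact mul_le_mul_of_nonneg_right hle (by positivity)
  have h3 : TendstoZeroInProb (fun n => sampleLaw n (L n)) fun n d =>
      1 / √(n : ℝ) * (dcrtStat (A n) d - ∑ i, 1 / √(n : ℝ) * noiseProd (L n) (d i)) := by
    refine (tendsto_dcrtStat_sub hnull hvar hSP1).of_abs_le ?_
    filter_upwards [eventually_ge_atTop 1] with n hn
    refine ae_of_all _ fun d => ?_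
    rw [abs_mul]
    refine mul_le_of_le_one_left (abs_nonneg _) ?_
    rw [abs_of_nonneg (by positivity), div_le_one (Real.sqrt_pos.2 (by exact_mod_cast hn)),
      Real.one_le_sqrt]
    exact_mod_cast hn
  refine (h1.sub (h2.add h3).sq).congr (Eventually.of_forall fun n => ae_of_all _ fun d => ?_)
  have e1 : ∑ i, (1 / √(n : ℝ) * residProd (A n) d i) ^ 2 =
      1 / (n : ℝ) * ∑ i, residProd (A n) d i ^ 2 := by
    simp_rw [one_div_sqrt_mul_sq]
    rw [Finset.mul_sum]
  have e2 : (1 / √(n : ℝ) * ∑ i, 1 / √(n : ℝ) * noiseProd (L n) (d i) +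
      1 / √(n : ℝ) * (dcrtStat (A n) d - ∑ i, 1 / √(n : ℝ) * noiseProd (L n) (d i))) =
      1 / (n : ℝ) * ∑ i, residProd (A n) d i := by
    have e3 : dcrtStat (A n) d = 1 / √(n : ℝ) * ∑ i, residProd (A n) d i := rfl
    rw [e3, ← mul_add, add_sub_cancel, ← mul_assoc, ← sq, div_pow, one_pow,
      Real.sq_sqrt (Nat.cast_nonneg n)]
  rw [e1, e2, gcmVar]
  ring

end Asymptotics

/-! ### Conditional variance and Lindeberg condition of the resampled statistic -/

section Resampling

variable {p : ℕ → ℕ} {A : ∀ n, Learner n (p n)} {L : ∀ n, Measure (Obs (p n))}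
  [∀ n, IsProbabilityMeasure (L n)]

theorem ofReal_varHatXAt_rpow_le {n q : ℕ} (B : Learner n q) (d : Sample n q) (i : Fin n)
    (h : MemLp id 2 (lawHatAt B d i)) {δ : ℝ} (hδ : 0 ≤ δ) :
    ENNReal.ofReal (varHatXAt B d i) ^ (1 + δ / 2) ≤
      ∫⁻ u, ‖u - muHatXAt B d i‖ₑ ^ (2 + δ) ∂lawHatAt B d i := by
  have e : ENNReal.ofReal (varHatXAt B d i) =
      ∫⁻ u, ‖u - muHatXAt B d i‖ₑ ^ (2 : ℝ) ∂lawHatAt B d i := ofReal_variance_id h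
  rw [e]
  exact lintegral_sq_rpow_le _ (by fun_prop) hδ

theorem tendsto_sum_varHat_mul_varY (hnull : ∀ n, 1 ≤ n → IsNull (L n))
    (hvar : ∀ n, 1 ≤ n → HasCondVariances (L n)) (hSP2 : BoundedMoments L)
    (hcons : VarianceConsistent A L) :
    TendstoZeroInProb (fun n => sampleLaw n (L n)) fun n d =>
      ∑ i, 1 / (n : ℝ) * (varHatXAt (A n) d i * varY (L n) (d.zs i)) - noiseVar (L n) := by
  refine (hcons.add (weak_law_varX_mul_varY hnull hvar hSP2)).congr
    (Eventually.of_forall fun n => ae_of_all _ fun d => ?_)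
  rw [varDiscrepancy, Finset.mul_sum, ← add_sub_assoc, ← Finset.sum_add_distrib]
  congr 1
  exact Finset.sum_congr rfl fun i _ => by ring

/-- A weak law of large numbers conditionally on `X` and `Z`. -/
theorem tendsto_sum_varHat_mul_noiseY_sq (hnull : ∀ n, 1 ≤ n → IsNull (L n))
    (hvar : ∀ n, 1 ≤ n → HasCondVariances (L n)) (hSP2 : BoundedMoments L)
    (hNDG : Nondegenerate A L) (hcons : VarianceConsistent A L) (hLyap : LyapunovCondition A L) :
    TendstoZeroInProb (fun n => sampleLaw n (L n)) fun n d =>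
      ∑ i, 1 / (n : ℝ) * varHatXAt (A n) d i * noiseY (L n) d i ^ 2 -
        ∑ i, 1 / (n : ℝ) * (varHatXAt (A n) d i * varY (L n) (d.zs i)) := by
  obtain ⟨_, C, _, _, -, hC, -, -, H⟩ := hSP2.exists_bounds
  obtain ⟨δ, hδ, hLy⟩ := hLyap
  refine TendstoZeroInProb.of_redrawY hnull (fun n => ?_) ?_
  · have h1 := measurable_varY (L n)
    have h2 : ∀ i, Measurable fun d : Sample n (p n) => varY (L n) (d.zs i) := fun i =>
      h1.comp (measurable_zs_apply i)
    fun_prop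
  refine hLy.comp₂ (tendstoZeroInProb_iff_enorm.1
    (tendsto_sum_varHat_mul_varY hnull hvar hSP2 hcons)) fun ε hε => ?_
  -- The weighted conditional variances sum to at most `C + 1`, so this `κ` keeps the square root
  -- below `ε / 4`. The Lyapunov sum is then required to be small relative to `κ`, leaving at most
  -- `ε / 2` for the tails.
  set κ : ℝ := (ε / 4) ^ 2 / (C + 1 + 1) with hκ
  have hκ0 : 0 < κ := by positivity
  have hκη : 0 < κ ^ (-(δ / 2)) := Real.rpow_pos_of_pos hκ0 _
  refine ⟨min 1 (ε / 4 / κ ^ (-(δ / 2))), by positivity, ?_⟩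
  filter_upwards [eventually_ge_atTop 1, ae_memLp_lawYZ hvar, ae_memLp_lawHatAt hNDG] with
    n hn hY hX
  filter_upwards [hY, hX] with d hYd hXd h1 h2
  have hn0 : (0 : ℝ) < n := by exact_mod_cast hn
  rw [enorm_lt_ofReal_iff] at h2
  have hB : ∑ i, 1 / (n : ℝ) * (varHatXAt (A n) d i * varY (L n) (d.zs i)) ≤ C + 1 := by
    have := (abs_lt.1 (h2.trans_le (min_le_left _ _))).2
    have := (H n hn).2.2.1
    linarith
  let f : Fin n → ℝ → ℝ := fun i y =>
    1 / (n : ℝ) * varHatXAt (A n) d i * (y - muY (L n) (d.zs i)) ^ 2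
  have hfm : ∀ i, Measurable (f i) := fun i => by fun_prop
  have hf0 : ∀ i y, 0 ≤ f i y := fun i y =>
    mul_nonneg (mul_nonneg (by positivity) (varHatXAt_nonneg _ _ _)) (sq_nonneg _)
  have hfi : ∀ i, Integrable (f i) (lawYZ (L n) (d.zs i)) := fun i =>
    (((hYd i).sub (memLp_const (muY (L n) (d.zs i)))).integrable_sq).const_mul _
  have hint : ∀ i, ∫ y, f i y ∂lawYZ (L n) (d.zs i) =
      1 / (n : ℝ) * (varHatXAt (A n) d i * varY (L n) (d.zs i)) := fun i => by
    have hv : varY (L n) (d.zs i) =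
        ∫ y, (y - muY (L n) (d.zs i)) ^ 2 ∂lawYZ (L n) (d.zs i) :=
      variance_eq_integral aemeasurable_id
    rw [integral_const_mul, ← hv, mul_assoc]
  have key := lintegral_enorm_sum_sub_le (μ := fun i => lawYZ (L n) (d.zs i)) hfm hf0 hfi
    (η := δ / 2) hκ0 (by positivity)
  simp_rw [hint] at key
  have hmom : ∑ i, ∫⁻ y, ENNReal.ofReal (f i y) ^ (1 + δ / 2) ∂lawYZ (L n) (d.zs i) ≤
      lyapunovSum (A n) (L n) δ d := by
    rw [lyapunovSum, Finset.mul_sum]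
    refine Finset.sum_le_sum fun i _ => ?_
    -- The factor with the learned variance is bounded by its `2 + δ` moment through Jensen, which
    -- turns the sum into the Lyapunov sum.
    have e : ∀ y, ENNReal.ofReal (f i y) ^ (1 + δ / 2) =
        ENNReal.ofReal (1 / (n : ℝ) ^ (1 + δ / 2)) *
          ENNReal.ofReal (varHatXAt (A n) d i) ^ (1 + δ / 2) *
            ‖y - muY (L n) (d.zs i)‖ₑ ^ (2 + δ) := by
      intro y
      have hpos : 0 ≤ 1 + δ / 2 := by positivity
      simp only [f]
      rw [ENNReal.ofReal_mul (mul_nonneg (by positivity) (varHatXAt_nonneg _ _ _)),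
        ENNReal.ofReal_mul (by positivity), ENNReal.mul_rpow_of_nonneg _ _ hpos,
        ENNReal.mul_rpow_of_nonneg _ _ hpos, ENNReal.ofReal_rpow_of_pos (by positivity),
        ← enorm_sq_eq_ofReal, ← ENNReal.rpow_mul, Real.div_rpow zero_le_one hn0.le,
        Real.one_rpow]
      congr 2
      ring
    simp_rw [e]
    rw [lintegral_const_mul _ (by fun_prop), mul_assoc]
    refine mul_le_mul_right ?_ _
    rw [mul_comm]
    exact mul_le_mul_right (ofReal_varHatXAt_rpow_le (A n) d i (hXd i) hδ.le) _
  refine (key.trans (add_le_add (mul_le_mul_right (mul_le_mul_right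
    (hmom.trans h1.le) _) _) (ENNReal.ofReal_le_ofReal (Real.sqrt_le_sqrt
      (mul_le_mul_of_nonneg_left hB hκ0.le))))).trans_lt ?_
  rw [← ENNReal.ofReal_mul hκη.le, ← ENNReal.ofReal_ofNat, ← ENNReal.ofReal_mul (by norm_num),
    ← ENNReal.ofReal_add (by positivity) (Real.sqrt_nonneg _)]
  refine (ENNReal.ofReal_lt_ofReal_iff hε).2 ?_
  have hs := sqrt_mul_sq_div_le (show 0 < ε / 4 by positivity) (show 0 ≤ C + 1 by positivity)
  rw [← hκ] at hs
  have ht : κ ^ (-(δ / 2)) * min 1 (ε / 4 / κ ^ (-(δ / 2))) ≤ ε / 4 := by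
    calc κ ^ (-(δ / 2)) * min 1 (ε / 4 / κ ^ (-(δ / 2)))
        ≤ κ ^ (-(δ / 2)) * (ε / 4 / κ ^ (-(δ / 2))) :=
          mul_le_mul_of_nonneg_left (min_le_right _ _) hκη.le
      _ = ε / 4 := by field_simp
  linarith

/-- Consistency of the conditional variance of the resampled statistic. -/
theorem tendsto_resampledVar_sub (hnull : ∀ n, 1 ≤ n → IsNull (L n))
    (hvar : ∀ n, 1 ≤ n → HasCondVariances (L n)) (hSP1 : SmallErrors A L)
    (hSP2 : BoundedMoments L) (hNDG : Nondegenerate A L) (hcons : VarianceConsistent A L)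
    (hLyap : LyapunovCondition A L) :
    TendstoZeroInProb (fun n => sampleLaw n (L n)) fun n d =>
      ∑ i, (1 / √(n : ℝ) * √(varHatXAt (A n) d i) * (d.ys i - muHatYAt (A n) d i)) ^ 2 -
        noiseVar (L n) := by
  obtain ⟨_, C, _, _, -, hC, -, -, H⟩ := hSP2.exists_bounds
  refine TendstoZeroInProb.sum_sq_perturb hC.le (fun n hn => (H n hn).2.2.1)
    -- With square roots of the learned variances as weights, the squared distance between the two
    -- vectors is exactly `errHatY'` squared.
    (u := fun n d i => 1 / √(n : ℝ) * √(varHatXAt (A n) d i) * noiseY (L n) d i) ?_ ?_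
  · refine ((tendsto_sum_varHat_mul_noiseY_sq hnull hvar hSP2 hNDG hcons hLyap).add
      (tendsto_sum_varHat_mul_varY hnull hvar hSP2 hcons)).congr
      (Eventually.of_forall fun n => ae_of_all _ fun d => ?_)
    rw [sub_add_sub_cancel]
    congr 1
    refine Finset.sum_congr rfl fun i _ => ?_
    rw [mul_assoc, one_div_sqrt_mul_sq, mul_pow, Real.sq_sqrt (varHatXAt_nonneg _ _ _), mul_assoc]
  · refine hSP1.2.2.2.sq.congr (Eventually.of_forall fun n => ae_of_all _ fun d => ?_)
    rw [errHatY'_sq]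
    refine Finset.sum_congr rfl fun i _ => ?_
    have e : 1 / √(n : ℝ) * √(varHatXAt (A n) d i) * (d.ys i - muHatYAt (A n) d i) -
        1 / √(n : ℝ) * √(varHatXAt (A n) d i) * noiseY (L n) d i =
        √(varHatXAt (A n) d i) * -(1 / √(n : ℝ) * devY (A n) (L n) d i) := by
      simp only [noiseY, devY]
      ring
    rw [e, mul_pow, Real.sq_sqrt (varHatXAt_nonneg _ _ _), neg_sq]
    ring

/-- One summand of the resampled statistic as a function of the resampled predictor. -/
noncomputable def resampledTerm {n q : ℕ} (B : Learner n q) (d : Sample n q) (i : Fin n)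
    (u : ℝ) : ℝ :=
  1 / √(n : ℝ) * ((u - muHatXAt B d i) * (d.ys i - muHatYAt B d i))

theorem measurable_resampledTerm {n q : ℕ} (B : Learner n q) (d : Sample n q) (i : Fin n) :
    Measurable (resampledTerm B d i) := by
  unfold resampledTerm
  fun_prop

/-- Averaging over `Y` given `X` and `Z` turns this sum into `lyapunovSum`. The Lyapunov condition,
stated with conditional moments of `Y`, thereby controls the realised residuals. -/
theorem tendsto_lyapunov_noiseY (hnull : ∀ n, 1 ≤ n → IsNull (L n)) {δ : ℝ}
    (hδ : 0 < δ)
    (hLy : TendstoZeroInProbENN (fun n => sampleLaw n (L n))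
      fun n d => lyapunovSum (A n) (L n) δ d) :
    TendstoZeroInProbENN (fun n => sampleLaw n (L n)) fun n d =>
      ∑ i, ∫⁻ u, ‖1 / √(n : ℝ) * ((u - muHatXAt (A n) d i) * noiseY (L n) d i)‖ₑ ^ (2 + δ)
        ∂lawHatAt (A n) d i := by
  have hpos : 0 ≤ 2 + δ := by positivity
  have e : ∀ n (d : Sample n (p n)) i,
      ∫⁻ u, ‖1 / √(n : ℝ) * ((u - muHatXAt (A n) d i) * noiseY (L n) d i)‖ₑ ^ (2 + δ)
        ∂lawHatAt (A n) d i = ENNReal.ofReal (1 / (n : ℝ) ^ (1 + δ / 2)) *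
          (‖noiseY (L n) d i‖ₑ ^ (2 + δ) *
            ∫⁻ u, ‖u - muHatXAt (A n) d i‖ₑ ^ (2 + δ) ∂lawHatAt (A n) d i) := by
    intro n d i
    rw [← lintegral_const_mul _ (by fun_prop), ← lintegral_const_mul _ (by fun_prop)]
    refine lintegral_congr fun u => ?_
    rw [enorm_mul, enorm_mul, ENNReal.mul_rpow_of_nonneg _ _ hpos,
      ENNReal.mul_rpow_of_nonneg _ _ hpos, mul_comm (‖u - muHatXAt (A n) d i‖ₑ ^ (2 + δ))]
    congr 1
    rw [Real.enorm_of_nonneg (by positivity), ENNReal.ofReal_rpow_of_nonneg (by positivity) hpos]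
    congr 1
    rw [Real.div_rpow zero_le_one (Real.sqrt_nonneg _), Real.one_rpow, Real.sqrt_eq_rpow,
      ← Real.rpow_mul (Nat.cast_nonneg n)]
    congr 2
    ring
  simp_rw [e]
  have hmeas : ∀ n i, Measurable fun d : Sample n (p n) =>
      ∫⁻ u, ‖u - muHatXAt (A n) d i‖ₑ ^ (2 + δ) ∂lawHatAt (A n) d i := fun n i =>
    Measurable.lintegral_kernel_prod_right' (κ := lawHatKernel (A n) i)
      (f := fun w : Sample n (p n) × ℝ => ‖w.2 - muHatXAt (A n) w.1 i‖ₑ ^ (2 + δ))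
      (((measurable_snd.sub ((measurable_muHatXAt (A n) i).comp measurable_fst)).enorm).pow_const _)
  refine TendstoZeroInProbENN.of_redrawY hnull (fun n => ?_) ?_
  · have := hmeas n
    fun_prop
  · convert hLy using 3 with n d
    -- True by definition: the learned law of `X` reads only `X` and `Z`, which `setY` preserves.
    have e2 : ∀ b i, ENNReal.ofReal (1 / (n : ℝ) ^ (1 + δ / 2)) *
          (‖noiseY (L n) (d.setY b) i‖ₑ ^ (2 + δ) *
            ∫⁻ u, ‖u - muHatXAt (A n) (d.setY b) i‖ₑ ^ (2 + δ) ∂lawHatAt (A n) (d.setY b) i) =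
        ENNReal.ofReal (1 / (n : ℝ) ^ (1 + δ / 2)) *
          (‖b i - muY (L n) (d.zs i)‖ₑ ^ (2 + δ) *
            ∫⁻ u, ‖u - muHatXAt (A n) d i‖ₑ ^ (2 + δ) ∂lawHatAt (A n) d i) := fun _ _ => rfl
    simp_rw [e2]
    rw [lintegral_finsetSum _ fun i _ => by fun_prop, lyapunovSum, Finset.mul_sum]
    refine Finset.sum_congr rfl fun i _ => ?_
    rw [lintegral_const_mul _ (by fun_prop), lintegral_mul_const _ (by fun_prop)]
    congr 2
    exact (measurePreserving_eval (fun i => lawYZ (L n) (d.zs i)) i).lintegral_comp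
      (f := fun y => ‖y - muY (L n) (d.zs i)‖ₑ ^ (2 + δ)) (by fun_prop)

/-- The Lindeberg condition for the resampled statistic. -/
theorem tendsto_resampled_lindeberg (hnull : ∀ n, 1 ≤ n → IsNull (L n))
    (hSP1 : SmallErrors A L) (hNDG : Nondegenerate A L) (hLyap : LyapunovCondition A L)
    {κ : ℝ} (hκ : 0 < κ) :
    TendstoZeroInProbENN (fun n => sampleLaw n (L n)) fun n d =>
      ∑ i, ∫⁻ u in {u | κ < |resampledTerm (A n) d i u|},
        ‖resampledTerm (A n) d i u‖ₑ ^ (2 : ℝ) ∂lawHatAt (A n) d i := by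
  obtain ⟨δ, hδ, hLy⟩ := hLyap
  set K : ℝ := (κ / 2) ^ (-δ) with hK
  have hK0 : 0 < K := Real.rpow_pos_of_pos (half_pos hκ) _
  refine (tendsto_lyapunov_noiseY hnull hδ hLy).comp₂
    (tendstoZeroInProb_iff_enorm.1 hSP1.2.2.2.sq) fun ε hε => ?_
  refine ⟨min (ε / 16) (ε / (16 * K)), by positivity, ?_⟩
  filter_upwards [ae_memLp_lawHatAt hNDG] with n hX
  filter_upwards [hX] with d hXd h1 h2
  rw [enorm_lt_ofReal_iff] at h2
  -- The summand splits into a part `g` with the true residual, whose `2 + δ` moments are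
  -- controlled, and a part `e` with the error of `μ̂_y`, for which only second moments are.
  let g : Fin n → ℝ → ℝ := fun i u => 1 / √(n : ℝ) * ((u - muHatXAt (A n) d i) * noiseY (L n) d i)
  let e : Fin n → ℝ → ℝ := fun i u =>
    1 / √(n : ℝ) * ((u - muHatXAt (A n) d i) * devY (A n) (L n) d i)
  have hge : ∀ i u, resampledTerm (A n) d i u = g i u - e i u := fun i u => by
    simp only [resampledTerm, g, e, noiseY, devY]
    ring
  have hpt : ∀ i u, κ < |resampledTerm (A n) d i u| →
      ‖resampledTerm (A n) d i u‖ₑ ^ (2 : ℝ) ≤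
        4 * (ENNReal.ofReal K * ‖g i u‖ₑ ^ (2 + δ)) + 4 * ‖e i u‖ₑ ^ (2 : ℝ) := by
    intro i u hu
    rw [hge] at hu ⊢
    have hnorm := abs_sub (g i u) (e i u)
    have hof : ∀ x : ℝ, 4 * ‖x‖ₑ ^ (2 : ℝ) = ENNReal.ofReal ((2 * |x|) ^ 2) := fun x => by
      rw [enorm_sq_eq_ofReal, ← ENNReal.ofReal_ofNat, ← ENNReal.ofReal_mul (by norm_num), mul_pow,
        sq_abs]
      norm_num
    -- The larger part is at least half of the difference. If it is `e`, its second moment suffices.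
    -- If it is `g`, then `|g| > κ / 2`, and the extra power `δ` can be inserted at the cost of `K`.
    rcases le_total |g i u| |e i u| with hc | hc
    · refine le_trans ?_ le_add_self
      rw [hof, enorm_sq_eq_ofReal, ← sq_abs]
      exact ENNReal.ofReal_le_ofReal (pow_le_pow_left₀ (abs_nonneg _) (by linarith) 2)
    · have hgκ : κ / 2 < |g i u| := by linarith
      have hg0 : 0 < |g i u| := (half_pos hκ).trans hgκ
      refine le_trans ?_ le_self_add
      have h3 : ‖g i u‖ₑ ^ (2 : ℝ) ≤ ENNReal.ofReal K * ‖g i u‖ₑ ^ (2 + δ) := by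
        rw [Real.enorm_eq_ofReal_abs, ENNReal.ofReal_rpow_of_pos hg0,
          ENNReal.ofReal_rpow_of_pos hg0, ← ENNReal.ofReal_mul hK0.le, Real.rpow_add hg0, hK,
          Real.rpow_neg (half_pos hκ).le]
        refine ENNReal.ofReal_le_ofReal ?_
        have h4 : (κ / 2) ^ δ ≤ |g i u| ^ δ :=
          Real.rpow_le_rpow (half_pos hκ).le hgκ.le hδ.le
        have h5 : 0 < (κ / 2) ^ δ := Real.rpow_pos_of_pos (half_pos hκ) _
        rw [inv_mul_eq_div, le_div_iff₀ h5]
        exact mul_le_mul_of_nonneg_left h4 (by positivity)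
      refine le_trans ?_ (mul_le_mul_right h3 4)
      rw [hof, enorm_sq_eq_ofReal, ← sq_abs]
      exact ENNReal.ofReal_le_ofReal (pow_le_pow_left₀ (abs_nonneg _) (by linarith) 2)
  have hge_meas : ∀ i, Measurable (g i) := fun i => by fun_prop
  have he_meas : ∀ i, Measurable (e i) := fun i => by fun_prop
  have hint : ∀ i, ∫⁻ u, ‖e i u‖ₑ ^ (2 : ℝ) ∂lawHatAt (A n) d i =
      ENNReal.ofReal ((1 / √(n : ℝ) * devY (A n) (L n) d i) ^ 2 * varHatXAt (A n) d i) := by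
    intro i
    have hv : ENNReal.ofReal (varHatXAt (A n) d i) =
      ∫⁻ u, ‖u - muHatXAt (A n) d i‖ₑ ^ (2 : ℝ) ∂lawHatAt (A n) d i := ofReal_variance_id (hXd i)
    rw [ENNReal.ofReal_mul (sq_nonneg _), hv, ← lintegral_const_mul _ (by fun_prop)]
    refine lintegral_congr fun u => ?_
    simp only [enorm_sq_eq_ofReal, e]
    rw [← ENNReal.ofReal_mul (sq_nonneg _)]
    congr 1
    ring
  have hi : ∀ i, ∫⁻ u in {u | κ < |resampledTerm (A n) d i u|},
        ‖resampledTerm (A n) d i u‖ₑ ^ (2 : ℝ) ∂lawHatAt (A n) d i ≤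
      4 * (ENNReal.ofReal K * ∫⁻ u, ‖g i u‖ₑ ^ (2 + δ) ∂lawHatAt (A n) d i) +
        4 * ENNReal.ofReal ((1 / √(n : ℝ) * devY (A n) (L n) d i) ^ 2 * varHatXAt (A n) d i) := by
    intro i
    have hg := hge_meas i
    have he := he_meas i
    refine ((setLIntegral_mono (by fun_prop) fun u hu => hpt i u hu).trans
      (setLIntegral_le_lintegral _ _)).trans_eq ?_
    rw [lintegral_add_left (by fun_prop), lintegral_const_mul _ (by fun_prop),
      lintegral_const_mul _ (by fun_prop), lintegral_const_mul _ (by fun_prop), hint]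
  refine (Finset.sum_le_sum fun i _ => hi i).trans_lt ?_
  rw [Finset.sum_add_distrib, ← Finset.mul_sum, ← Finset.mul_sum, ← Finset.mul_sum,
    ← ENNReal.ofReal_sum_of_nonneg fun i _ => mul_nonneg (sq_nonneg _) (varHatXAt_nonneg _ _ _),
    ← errHatY'_sq]
  have h3 : errHatY' (A n) (L n) d ^ 2 ≤ ε / 16 :=
    ((le_abs_self _).trans h2.le).trans (min_le_left _ _)
  have h4 := h1.le.trans (ENNReal.ofReal_le_ofReal (min_le_right (ε / 16) (ε / (16 * K))))
  refine (add_le_add (mul_le_mul_right (mul_le_mul_right h4 _) _)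
    (mul_le_mul_right (ENNReal.ofReal_le_ofReal h3) _)).trans_lt ?_
  rw [← ENNReal.ofReal_ofNat, ← ENNReal.ofReal_mul hK0.le, ← ENNReal.ofReal_mul (by norm_num),
    ← ENNReal.ofReal_mul (by norm_num), ← ENNReal.ofReal_add (by positivity) (by positivity)]
  refine (ENNReal.ofReal_lt_ofReal_iff hε).2 ?_
  have : K * (ε / (16 * K)) = ε / 16 := by field_simp
  rw [this]
  linarith

end Resampling

/-! ### Central limit theorems and agreement of the two tests -/

section Comparison

variable {p : ℕ → ℕ} {A : ∀ n, Learner n (p n)} {L : ∀ n, Measure (Obs (p n))}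
  [∀ n, IsProbabilityMeasure (L n)]

theorem TendstoZeroInProb.eventually_real_lt {Ω : ℕ → Type} [∀ n, MeasurableSpace (Ω n)]
    {P : ∀ n, Measure (Ω n)} {W : ∀ n, Ω n → ℝ} (h : TendstoZeroInProb P W) {ε ρ : ℝ}
    (hε : 0 < ε) (hρ : 0 < ρ) : ∀ᶠ n in atTop, (P n).real {ω | ε ≤ |W n ω|} < ρ := by
  have := (ENNReal.tendsto_toReal ENNReal.zero_ne_top).comp (h ε hε)
  exact this.eventually_lt_const hρ

/-- Lyapunov's condition implies Lindeberg's: the tail bound is applied to the squares at level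
`κ²`, and the `n` terms of size `n^{-(1 + δ/2)}` leave `n^{-δ/2}`. -/
theorem lindeberg_noiseProd {n : ℕ} (hn : 1 ≤ n) {M δ κ : ℝ} (hM : 0 < M) (hδ : 0 < δ)
    (hκ : 0 < κ) {q : ℕ} {L : Measure (Obs q)} [IsProbabilityMeasure L]
    (hmem : MemLp (noiseProd L) 2 L)
    (hmom : ∫⁻ o, ‖noiseProd L o‖ₑ ^ (2 + δ) ∂L ≤ ENNReal.ofReal M) :
    ∑ _i : Fin n, ∫ o in {o | κ < |1 / √(n : ℝ) * noiseProd L o|},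
      (1 / √(n : ℝ) * noiseProd L o) ^ 2 ∂L ≤
        (κ ^ 2) ^ (-(δ / 2)) * M * (n : ℝ) ^ (-(δ / 2)) := by
  have hn0 : (0 : ℝ) < n := by exact_mod_cast hn
  have hg : Measurable fun o => 1 / √(n : ℝ) * noiseProd L o := by fun_prop
  have hset : {o | κ < |1 / √(n : ℝ) * noiseProd L o|} =
      {o | κ ^ 2 < (1 / √(n : ℝ) * noiseProd L o) ^ 2} := by
    ext o
    simp only [Set.mem_ofPred_eq]
    rw [← sq_abs (1 / √(n : ℝ) * noiseProd L o)]
    exact (pow_lt_pow_iff_left₀ hκ.le (abs_nonneg _) two_ne_zero).symm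
  have h1 : ENNReal.ofReal (∫ o in {o | κ < |1 / √(n : ℝ) * noiseProd L o|},
      (1 / √(n : ℝ) * noiseProd L o) ^ 2 ∂L) ≤
      ENNReal.ofReal ((κ ^ 2) ^ (-(δ / 2)) * ((1 / (n : ℝ)) ^ (1 + δ / 2) * M)) := by
    rw [ofReal_integral_eq_lintegral_ofReal (hmem.const_mul _).integrable_sq.integrableOn
      (ae_of_all _ fun _ => sq_nonneg _), hset]
    refine (setLIntegral_ofReal_le (hg.pow_const 2) (by positivity)
      (show 0 ≤ δ / 2 by positivity)).trans ?_
    rw [ENNReal.ofReal_mul (by positivity), ENNReal.ofReal_mul (by positivity)]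
    refine mul_le_mul_right (le_trans ?_ (mul_le_mul_right hmom _)) _
    rw [← lintegral_const_mul _ (by fun_prop)]
    refine lintegral_mono fun o => le_of_eq ?_
    rw [one_div_sqrt_mul_sq, ENNReal.ofReal_mul (by positivity),
      ENNReal.mul_rpow_of_nonneg _ _ (by positivity), ENNReal.ofReal_rpow_of_pos (by positivity),
      ← enorm_sq_eq_ofReal, ← ENNReal.rpow_mul]
    congr 2
    ring
  rw [ENNReal.ofReal_le_ofReal_iff (by positivity)] at h1
  rw [Finset.sum_const, Finset.card_univ, Fintype.card_fin, nsmul_eq_mul]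
  refine (mul_le_mul_of_nonneg_left h1 hn0.le).trans_eq ?_
  rw [one_div, Real.inv_rpow hn0.le, Real.rpow_add hn0, Real.rpow_one, Real.rpow_neg hn0.le]
  field_simp

/-- The central limit theorem for the products of the true residuals. -/
theorem tendsto_noiseProd_cdf (hnull : ∀ n, 1 ≤ n → IsNull (L n))
    (hvar : ∀ n, 1 ≤ n → HasCondVariances (L n)) (hSP2 : BoundedMoments L) (u : ℝ) :
    Tendsto (fun n => (sampleLaw n (L n)).real
      {d | ∑ i, 1 / √(n : ℝ) * noiseProd (L n) (d i) ≤ √(noiseVar (L n)) * u}) atTop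
      (𝓝 ((gaussianReal 0 1).real (Set.Iic u))) := by
  obtain ⟨c, C, M, δ, hc, -, hM, hδ, H⟩ := hSP2.exists_bounds
  rw [Metric.tendsto_atTop']
  intro η hη
  obtain ⟨κ, hκ, hCLT⟩ := exists_lindeberg_bound_pi u hη
  -- A truncation level independent of `n`. It lies below `κ` times the scale `√(noiseVar (L n))`,
  -- so it only enlarges the tails.
  have hκc : 0 < κ * √c := mul_pos hκ (Real.sqrt_pos.2 hc)
  have hlim : Tendsto (fun n : ℕ => ((κ * √c) ^ 2) ^ (-(δ / 2)) * M * (n : ℝ) ^ (-(δ / 2))) atTop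
      (𝓝 0) := by
    have := ((tendsto_rpow_neg_atTop (half_pos hδ)).comp tendsto_natCast_atTop_atTop).const_mul
      (((κ * √c) ^ 2) ^ (-(δ / 2)) * M)
    simpa using this
  obtain ⟨N, hN⟩ := eventually_atTop.1 (hlim.eventually_le_const (show 0 < κ * c by positivity))
  refine ⟨max N 1, fun n hn => ?_⟩
  have hn1 : 1 ≤ n := (le_max_right N 1).trans hn.le
  have hnN := hN n ((le_max_left N 1).trans hn.le)
  obtain ⟨hmem, hcl, -, hmom⟩ := H n hn1
  have hv0 : 0 < noiseVar (L n) := hc.trans_le hcl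
  have hs2 : √(noiseVar (L n)) ^ 2 = noiseVar (L n) := Real.sq_sqrt hv0.le
  have hn0 : (0 : ℝ) < n := by exact_mod_cast hn1
  rw [Real.dist_eq]
  refine hCLT n (Obs (p n)) (fun _ => L n) (fun _ o => 1 / √(n : ℝ) * noiseProd (L n) o)
    (√(noiseVar (L n))) (Real.sqrt_pos.2 hv0) (fun _ => by fun_prop)
    (fun _ => hmem.const_mul _) (fun _ => ?_) ?_ ?_
  · rw [integral_const_mul, integral_noiseProd (hnull n hn1) (hvar n hn1)
      (hmem.integrable one_le_two), mul_zero]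
  · have e : ∑ _i : Fin n, ∫ o, (1 / √(n : ℝ) * noiseProd (L n) o) ^ 2 ∂L n = noiseVar (L n) := by
      simp_rw [one_div_sqrt_mul_sq]
      rw [integral_const_mul, Finset.sum_const, Finset.card_univ, Fintype.card_fin, nsmul_eq_mul]
      change (n : ℝ) * (1 / (n : ℝ) * noiseVar (L n)) = noiseVar (L n)
      field_simp
    rw [e, hs2, sub_self, abs_zero]
    positivity
  · rw [hs2]
    refine le_trans (le_trans (Finset.sum_le_sum fun i _ => ?_)
      (lindeberg_noiseProd hn1 hM hδ hκc hmem hmom)) (hnN.trans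
        (mul_le_mul_of_nonneg_left hcl hκ.le))
    refine setIntegral_mono_set (hmem.const_mul _).integrable_sq.integrableOn
      (ae_of_all _ fun _ => sq_nonneg _) (LE.le.eventuallyLE fun o ho => ?_)
    exact (mul_le_mul_of_nonneg_left (Real.sqrt_le_sqrt hcl) hκ.le).trans_lt ho

/-- The conditional central limit theorem for the resampled statistic. -/
theorem tendsto_resamplingLaw_cdf (hnull : ∀ n, 1 ≤ n → IsNull (L n))
    (hvar : ∀ n, 1 ≤ n → HasCondVariances (L n)) (hSP1 : SmallErrors A L)
    (hSP2 : BoundedMoments L) (hNDG : Nondegenerate A L) (hcons : VarianceConsistent A L)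
    (hLyap : LyapunovCondition A L) (u : ℝ) :
    TendstoZeroInProb (fun n => sampleLaw n (L n)) fun n d =>
      (resamplingLaw (A n) d).real (Set.Iic (√(noiseVar (L n)) * u)) -
        (gaussianReal 0 1).real (Set.Iic u) := by
  obtain ⟨c, _, _, _, hc, -, -, -, H⟩ := hSP2.exists_bounds
  rw [tendstoZeroInProb_iff_enorm]
  intro ε' hε'
  obtain ⟨η, -, hη⟩ := ENNReal.lt_iff_exists_real_btwn.1 hε'
  have hη0 : 0 < η := ENNReal.ofReal_pos.1 hη.1
  obtain ⟨κ, hκ, hCLT⟩ := exists_lindeberg_bound_pi u hη0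
  have hκc : 0 < κ * √c := mul_pos hκ (Real.sqrt_pos.2 hc)
  have hκc2 : 0 < κ * c := mul_pos hκ hc
  have h1 := tendstoZeroInProb_iff_enorm.1
    (tendsto_resampledVar_sub hnull hvar hSP1 hSP2 hNDG hcons hLyap)
  have h2 := tendsto_resampled_lindeberg hnull hSP1 hNDG hLyap hκc
  -- Outside these two events the uniform central limit theorem applies to the fixed realisation
  -- `d`. Its tolerance for the variance permits scaling by `noiseVar` in place of the conditional
  -- variance.
  have hlim := (h1 _ (ENNReal.ofReal_pos.2 hκc2)).add (h2 _ (ENNReal.ofReal_pos.2 hκc2))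
  rw [add_zero] at hlim
  refine tendsto_of_tendsto_of_tendsto_of_le_of_le' tendsto_const_nhds hlim
    (Eventually.of_forall fun _ => zero_le) ?_
  filter_upwards [eventually_ge_atTop 1, ae_memLp_lawHatAt hNDG] with n hn hX
  refine (measure_mono_ae ?_).trans (measure_union_le _ _)
  filter_upwards [hX] with d hXd (hd : ε' ≤ _)
  change ENNReal.ofReal (κ * c) ≤ _ ∨ ENNReal.ofReal (κ * c) ≤ _
  by_contra hbad
  push Not at hbad
  obtain ⟨b1, b2⟩ := hbad
  rw [enorm_lt_ofReal_iff] at b1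
  have hcl := (H n hn).2.1
  have hv0 : 0 < noiseVar (L n) := hc.trans_le hcl
  have hs2 : √(noiseVar (L n)) ^ 2 = noiseVar (L n) := Real.sq_sqrt hv0.le
  have hκle : κ * c ≤ κ * noiseVar (L n) := mul_le_mul_of_nonneg_left hcl hκ.le
  have hm2 : ∀ i, MemLp (resampledTerm (A n) d i) 2 (lawHatAt (A n) d i) := fun i =>
    (((hXd i).sub (memLp_const _)).mul_const _).const_mul _
  have hsq : ∀ i, ∫ x, resampledTerm (A n) d i x ^ 2 ∂lawHatAt (A n) d i =
      (1 / √(n : ℝ) * √(varHatXAt (A n) d i) * (d.ys i - muHatYAt (A n) d i)) ^ 2 := fun i => by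
    have hv : varHatXAt (A n) d i =
        ∫ x, (x - muHatXAt (A n) d i) ^ 2 ∂lawHatAt (A n) d i :=
      variance_eq_integral aemeasurable_id
    have e : ∀ x, resampledTerm (A n) d i x ^ 2 =
        (1 / √(n : ℝ) * (d.ys i - muHatYAt (A n) d i)) ^ 2 * (x - muHatXAt (A n) d i) ^ 2 :=
      fun x => by rw [resampledTerm]; ring
    simp_rw [e]
    rw [integral_const_mul, ← hv, mul_pow, mul_pow, mul_pow,
      Real.sq_sqrt (varHatXAt_nonneg _ _ _)]
    ring
  have key := hCLT n ℝ (lawHatAt (A n) d) (resampledTerm (A n) d) (√(noiseVar (L n)))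
    (Real.sqrt_pos.2 hv0) (measurable_resampledTerm (A n) d) hm2 (fun i => ?_) ?_ ?_
  · refine absurd ?_ (not_lt.2 hd)
    refine lt_trans ?_ hη.2
    rw [enorm_lt_ofReal_iff]
    convert key using 3
    rw [measureReal_def, resamplingLaw_Iic, measureReal_def]
    congr 2
    ext b
    simp only [Set.mem_ofPred_eq, resampledStat, resampledTerm]
    rw [Finset.mul_sum]
  · have hi : Integrable (fun x : ℝ => x) (lawHatAt (A n) d i) := (hXd i).integrable one_le_two
    simp only [resampledTerm]
    rw [integral_const_mul, integral_mul_const, integral_sub hi (integrable_const _)]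
    simp [muHatXAt]
  · simp_rw [hsq]
    rw [hs2]
    exact b1.le.trans hκle
  · rw [hs2]
    refine le_trans ?_ hκle
    have hle : ∀ i, ∫ x in {x | κ * √(noiseVar (L n)) < |resampledTerm (A n) d i x|},
        resampledTerm (A n) d i x ^ 2 ∂lawHatAt (A n) d i ≤
        ∫ x in {x | κ * √c < |resampledTerm (A n) d i x|},
          resampledTerm (A n) d i x ^ 2 ∂lawHatAt (A n) d i := fun i =>
      setIntegral_mono_set (hm2 i).integrable_sq.integrableOn
        (ae_of_all _ fun _ => sq_nonneg _) (LE.le.eventuallyLE fun x hx =>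
          (mul_le_mul_of_nonneg_left (Real.sqrt_le_sqrt hcl) hκ.le).trans_lt hx)
    refine (Finset.sum_le_sum fun i _ => hle i).trans ?_
    rw [← ENNReal.ofReal_le_ofReal_iff hκc2.le, ENNReal.ofReal_sum_of_nonneg fun i _ =>
      integral_nonneg fun _ => sq_nonneg _]
    refine le_trans (Finset.sum_le_sum fun i _ => ?_) b2.le
    rw [ofReal_integral_eq_lintegral_ofReal (hm2 i).integrable_sq.integrableOn
      (ae_of_all _ fun _ => sq_nonneg _)]
    simp_rw [enorm_sq_eq_ofReal]
    exact le_rfl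

/-- If the resampling quantile and the empirical variance are close to their limits and the two
tests disagree, then the test statistic is close to the limiting critical value. -/
theorem dcrtStat_near_of_tests_ne {n q : ℕ} {B : Learner n q} {d : Sample n q} {α z s ε c : ℝ}
    (hz : z = quantile (gaussianReal 0 1) (1 - α)) (hs : 0 < s) (hε : 0 < ε) (hc : 0 < c)
    (hcs : c ≤ s ^ 2)
    (hlo : s * (z - ε) < quantile (resamplingLaw B d) (1 - α))
    (hhi : quantile (resamplingLaw B d) (1 - α) ≤ s * (z + ε))
    (hv : |gcmVar B d - s ^ 2| < min (c / 2) (ε * c / (|z| + 1)))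
    (hne : dcrtTest B α d ≠ gcmTest B α d) :
    |dcrtStat B d - s * z| ≤ s * ε := by
  have hv1 := hv.trans_le (min_le_left _ _)
  have hv2 := hv.trans_le (min_le_right _ _)
  have hg0 : 0 < gcmVar B d := by have := (abs_lt.1 hv1).1; linarith
  set r := √(gcmVar B d) with hr
  have hr0 : 0 < r := Real.sqrt_pos.2 hg0
  have hr2 : r ^ 2 = gcmVar B d := Real.sq_sqrt hg0.le
  -- From `|r - s| (r + s) = |r² - s²|`. The `+ 1` in the tolerance for the variance covers `z = 0`.
  have hrs : |r * z - s * z| ≤ s * ε := by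
    have h1 : |r - s| * (r + s) = |gcmVar B d - s ^ 2| := by
      rw [← hr2, show r ^ 2 - s ^ 2 = (r - s) * (r + s) by ring, abs_mul,
        abs_of_pos (show 0 < r + s by positivity)]
    have h2 : |r - s| * s ≤ ε * c / (|z| + 1) := by
      have : |r - s| * s ≤ |r - s| * (r + s) :=
        mul_le_mul_of_nonneg_left (by linarith) (abs_nonneg _)
      linarith
    have hz1 : 0 < |z| + 1 := by positivity
    rw [le_div_iff₀ hz1] at h2
    rw [← sub_mul, abs_mul]
    have h3 : |r - s| * |z| * s ≤ s * ε * s := by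
      have h4 : |r - s| * s * |z| ≤ |r - s| * s * (|z| + 1) :=
        mul_le_mul_of_nonneg_left (by linarith) (by positivity)
      nlinarith
    exact le_of_mul_le_mul_right h3 hs
  have hstat : gcmStat B d = dcrtStat B d / r := by
    have e : dcrtStat B d = 1 / √(n : ℝ) * ∑ i, residProd B d i := rfl
    rw [gcmStat, e, ← hr]
    ring
  obtain ⟨h5, h6⟩ := abs_le.1 hrs
  simp only [dcrtTest, gcmTest, ← hz, hstat] at hne
  rw [abs_le]
  -- Disagreement puts the statistic between the two critical values, both of which lie within `s ε`
  -- of `s z`.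
  by_cases c1 : quantile (resamplingLaw B d) (1 - α) < dcrtStat B d
  · by_cases c2 : z < dcrtStat B d / r
    · simp [c1, c2] at hne
    · have := (div_le_iff₀ hr0).1 (not_lt.1 c2)
      constructor <;> nlinarith
  · by_cases c2 : z < dcrtStat B d / r
    · have := (lt_div_iff₀ hr0).1 c2
      have := not_lt.1 c1
      constructor <;> nlinarith
    · simp [c1, c2] at hne

/-- Under the null laws the two tests coincide with probability tending to one. -/
theorem tendsto_measure_tests_ne {α : ℝ} (hα₀ : 0 < α) (hα₁ : α < 1)
    (hnull : ∀ n, 1 ≤ n → IsNull (L n))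
    (hvar : ∀ n, 1 ≤ n → HasCondVariances (L n)) (hSP1 : SmallErrors A L)
    (hSP2 : BoundedMoments L) (hNDG : Nondegenerate A L) (hcons : VarianceConsistent A L)
    (hLyap : LyapunovCondition A L) :
    Tendsto (fun n => sampleLaw n (L n) {d | dcrtTest (A n) α d ≠ gcmTest (A n) α d}) atTop
      (𝓝 0) := by
  obtain ⟨c, _, _, _, hc, -, -, -, H⟩ := hSP2.exists_bounds
  set z := quantile (gaussianReal 0 1) (1 - α) with hz
  rw [ENNReal.tendsto_nhds_zero]
  intro ρ' hρ'
  obtain ⟨ρ, -, hρ⟩ := ENNReal.lt_iff_exists_real_btwn.1 hρ'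
  have hρ0 : 0 < ρ := ENNReal.ofReal_pos.1 hρ.1
  -- The budget is `11 ε`: four exceptional events, two errors in the central limit theorem, and a
  -- window of width `5 ε`.
  set ε : ℝ := ρ / 20 with hεdef
  have hε : 0 < ε := by positivity
  have hΦz : 1 - α ≤ (gaussianReal 0 1).real (Set.Iic z) :=
    (quantile_le_iff _ (by linarith) (by linarith) z).1 le_rfl
  have hΦ1 : 0 < (gaussianReal 0 1).real (Set.Iic (z + ε)) - (1 - α) := by
    have := gaussianReal_Iic_lt (show z < z + ε by linarith)
    linarith
  have hΦ2 : 0 < (1 - α) - (gaussianReal 0 1).real (Set.Iic (z - ε)) := by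
    have h : ¬ z ≤ z - ε := by linarith
    rw [hz, quantile_le_iff _ (by linarith) (by linarith), not_le] at h
    linarith
  have hδ : 0 < min (c / 2) (ε * c / (|z| + 1)) := by positivity
  have hεc : 0 < ε * √c := mul_pos hε (Real.sqrt_pos.2 hc)
  have e1 := (tendsto_resamplingLaw_cdf hnull hvar hSP1 hSP2 hNDG hcons hLyap
    (z + ε)).eventually_real_lt hΦ1 hε
  have e2 := (tendsto_resamplingLaw_cdf hnull hvar hSP1 hSP2 hNDG hcons hLyap
    (z - ε)).eventually_real_lt hΦ2 hε
  have e3 := (tendsto_gcmVar_sub hnull hvar hSP1 hSP2).eventually_real_lt hδ hε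
  have e4 := (tendsto_dcrtStat_sub hnull hvar hSP1).eventually_real_lt hεc hε
  -- The statistic lies within `s ε` of `s z` and within `ε √c ≤ s ε` of the sum of true residual
  -- products. That sum is thus within `2 s ε` of `s z`; the lower end `- 3 ε` only adds slack.
  have e5 := (tendsto_noiseProd_cdf hnull hvar hSP2 (z + 2 * ε)).eventually_lt_const
    (show (gaussianReal 0 1).real (Set.Iic (z + 2 * ε)) <
      (gaussianReal 0 1).real (Set.Iic (z + 2 * ε)) + ε by linarith)
  have e6 := (tendsto_noiseProd_cdf hnull hvar hSP2 (z - 3 * ε)).eventually_const_lt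
    (show (gaussianReal 0 1).real (Set.Iic (z - 3 * ε)) - ε <
      (gaussianReal 0 1).real (Set.Iic (z - 3 * ε)) by linarith)
  have e7 := gaussianReal_Iic_sub_le (show z - 3 * ε ≤ z + 2 * ε by linarith)
  filter_upwards [e1, e2, e3, e4, e5, e6, eventually_ge_atTop 1] with n h1 h2 h3 h4 h5 h6 hn
  set P := sampleLaw n (L n)
  set s := √(noiseVar (L n)) with hs
  have hcl := (H n hn).2.1
  have hs0 : 0 < s := Real.sqrt_pos.2 (hc.trans_le hcl)
  have hs2 : s ^ 2 = noiseVar (L n) := Real.sq_sqrt (hc.trans_le hcl).le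
  set W : Sample n (p n) → ℝ := fun d => ∑ i, 1 / √(n : ℝ) * noiseProd (L n) (d i) with hW
  have hWm : Measurable W := by fun_prop
  set S1 := {d | W d ≤ s * (z + 2 * ε)}
  set S2 := {d | W d ≤ s * (z - 3 * ε)}
  have hS21 : S2 ⊆ S1 := fun d (hd : W d ≤ s * (z - 3 * ε)) => show W d ≤ s * (z + 2 * ε) by
    nlinarith
  have hS2m : MeasurableSet S2 := measurableSet_le hWm measurable_const
  set F1 := {d | (gaussianReal 0 1).real (Set.Iic (z + ε)) - (1 - α) ≤
    |(resamplingLaw (A n) d).real (Set.Iic (s * (z + ε))) -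
      (gaussianReal 0 1).real (Set.Iic (z + ε))|}
  set F2 := {d | 1 - α - (gaussianReal 0 1).real (Set.Iic (z - ε)) ≤
    |(resamplingLaw (A n) d).real (Set.Iic (s * (z - ε))) -
      (gaussianReal 0 1).real (Set.Iic (z - ε))|}
  set F3 := {d | min (c / 2) (ε * c / (|z| + 1)) ≤ |gcmVar (A n) d - noiseVar (L n)|}
  set F4 := {d | ε * √c ≤ |dcrtStat (A n) d - W d|}
  have hsub : {d | dcrtTest (A n) α d ≠ gcmTest (A n) α d} ⊆
      F1 ∪ (F2 ∪ (F3 ∪ (F4 ∪ S1 \ S2))) := by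
    intro d hd
    by_contra hnot
    simp only [F1, F2, F3, F4, Set.mem_union, Set.mem_ofPred_eq, not_or, not_le] at hnot
    obtain ⟨g1', g2', g3', g4', g5⟩ := hnot
    refine g5 ?_
    have hhi : quantile (resamplingLaw (A n) d) (1 - α) ≤ s * (z + ε) := by
      rw [quantile_le_iff _ (by linarith) (by linarith)]
      have := (abs_lt.1 g1').1
      linarith
    have hlo : s * (z - ε) < quantile (resamplingLaw (A n) d) (1 - α) := by
      rw [← not_le, quantile_le_iff _ (by linarith) (by linarith), not_le]
      have := (abs_lt.1 g2').2
      linarith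
    have hnear := dcrtStat_near_of_tests_ne (B := A n) hz hs0 hε hc (by rw [hs2]; exact hcl) hlo hhi
      (by rw [hs2]; exact g3') hd
    have hcs : ε * √c ≤ s * ε := by
      rw [mul_comm]
      exact mul_le_mul_of_nonneg_right (Real.sqrt_le_sqrt hcl) hε.le
    obtain ⟨a1, a2⟩ := abs_le.1 hnear
    obtain ⟨a3, a4⟩ := abs_lt.1 g4'
    refine ⟨show W d ≤ s * (z + 2 * ε) by nlinarith, fun (h : W d ≤ s * (z - 3 * ε)) => ?_⟩
    have : 0 < s * ε := mul_pos hs0 hε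
    nlinarith
  have hreal : P.real {d | dcrtTest (A n) α d ≠ gcmTest (A n) α d} ≤ ρ := by
    refine (measureReal_mono hsub).trans ?_
    have u1 := measureReal_union_le (μ := P) F1 (F2 ∪ (F3 ∪ (F4 ∪ S1 \ S2)))
    have u2 := measureReal_union_le (μ := P) F2 (F3 ∪ (F4 ∪ S1 \ S2))
    have u3 := measureReal_union_le (μ := P) F3 (F4 ∪ S1 \ S2)
    have u4 := measureReal_union_le (μ := P) F4 (S1 \ S2)
    have u5 : P.real (S1 \ S2) = P.real S1 - P.real S2 := measureReal_sdiff hS21 hS2m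
    linarith
  refine le_trans ?_ hρ.2.le
  rw [← ENNReal.ofReal_toReal (measure_ne_top P _)]
  exact ENNReal.ofReal_le_ofReal hreal

end Comparison

end CITest

/-! ### Transfer to the contiguous laws -/

theorem corollary2 (α : ℝ) (hα₀ : 0 < α) (hα₁ : α < 1)
    (p : ℕ → ℕ) (A : ∀ n, CITest.Learner n (p n))
    (L L' : ∀ n, Measure (CITest.Obs (p n)))
    [∀ n, IsProbabilityMeasure (L n)] [∀ n, IsProbabilityMeasure (L' n)]
    (hnull : ∀ n, 1 ≤ n → CITest.IsNull (L n))
    (hvar : ∀ n, 1 ≤ n → CITest.HasCondVariances (L n))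
    (hSP1 : CITest.SmallErrors A L)
    (hSP2 : CITest.BoundedMoments L)
    (hNDG : CITest.Nondegenerate A L)
    (hcons : CITest.VarianceConsistent A L)
    (hLyap : CITest.LyapunovCondition A L)
    (hcont : CITest.Contiguous (fun n => CITest.sampleLaw n (L' n))
      (fun n => CITest.sampleLaw n (L n))) :
    Tendsto (fun n => (CITest.sampleLaw n (L' n)).real
        {d | CITest.dcrtTest (A n) α d = CITest.gcmTest (A n) α d}) atTop (𝓝 1) ∧
      Tendsto (fun n => (∫ d, CITest.dcrtTest (A n) α d ∂CITest.sampleLaw n (L' n)) -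
        ∫ d, CITest.gcmTest (A n) α d ∂CITest.sampleLaw n (L' n)) atTop (𝓝 0) := by
  have hd : ∀ n, Measurable (CITest.dcrtTest (A n) α) := fun n =>
    CITest.measurable_dcrtTest (A n) hα₀ hα₁
  have hg : ∀ n, Measurable (CITest.gcmTest (A n) α) := fun n => CITest.measurable_gcmTest (A n) α
  have hEq : ∀ n, MeasurableSet {d | CITest.dcrtTest (A n) α d = CITest.gcmTest (A n) α d} :=
    fun n => measurableSet_eq_fun (hd n) (hg n)
  have hlim := (ENNReal.tendsto_toReal ENNReal.zero_ne_top).comp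
    (hcont (fun n => {d | CITest.dcrtTest (A n) α d ≠ CITest.gcmTest (A n) α d})
      (fun n => (hEq n).compl)
      (CITest.tendsto_measure_tests_ne hα₀ hα₁ hnull hvar hSP1 hSP2 hNDG hcons hLyap))
  have hlim' : Tendsto (fun n => (CITest.sampleLaw n (L' n)).real
      {d | CITest.dcrtTest (A n) α d ≠ CITest.gcmTest (A n) α d}) atTop (𝓝 0) := hlim
  constructor
  · have h := hlim'.const_sub 1
    rw [sub_zero] at h
    refine h.congr fun n => ?_
    have hc := probReal_compl_eq_one_sub (μ := CITest.sampleLaw n (L' n)) (hEq n)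
    have hs : {d | CITest.dcrtTest (A n) α d = CITest.gcmTest (A n) α d}ᶜ =
        {d | CITest.dcrtTest (A n) α d ≠ CITest.gcmTest (A n) α d} := rfl
    rw [← hs, hc]
    ring
  · rw [tendsto_zero_iff_norm_tendsto_zero]
    refine squeeze_zero (fun _ => norm_nonneg _) (fun n => ?_) hlim'
    have hd01 : ∀ d, ‖CITest.dcrtTest (A n) α d‖ ≤ 1 := fun d => by
      unfold CITest.dcrtTest; split_ifs <;> simp
    have hg01 : ∀ d, ‖CITest.gcmTest (A n) α d‖ ≤ 1 := fun d => by
      unfold CITest.gcmTest; split_ifs <;> simp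
    have hdi : Integrable (CITest.dcrtTest (A n) α) (CITest.sampleLaw n (L' n)) :=
      (integrable_const (1 : ℝ)).mono' (hd n).aestronglyMeasurable (ae_of_all _ hd01)
    have hgi : Integrable (CITest.gcmTest (A n) α) (CITest.sampleLaw n (L' n)) :=
      (integrable_const (1 : ℝ)).mono' (hg n).aestronglyMeasurable (ae_of_all _ hg01)
    -- Both tests take values in `{0, 1}`, so their difference is dominated by the indicator of
    -- disagreement.
    change _ ≤ (CITest.sampleLaw n (L' n)).real
      {d | CITest.dcrtTest (A n) α d = CITest.gcmTest (A n) α d}ᶜ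
    rw [← integral_sub hdi hgi, ← integral_indicator_one (hEq n).compl]
    refine norm_integral_le_of_norm_le ((integrable_const (1 : ℝ)).indicator (hEq n).compl)
      (ae_of_all _ fun d => ?_)
    by_cases h : CITest.dcrtTest (A n) α d = CITest.gcmTest (A n) α d
    · rw [h, sub_self, norm_zero]
      exact Set.indicator_nonneg (fun _ _ => zero_le_one) _
    · rw [Set.indicator_of_mem (show d ∈ {d | CITest.dcrtTest (A n) α d =
        CITest.gcmTest (A n) α d}ᶜ from h)]
      unfold CITest.dcrtTest CITest.gcmTest
      split_ifs <;> simp
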